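/- There is a universal constant $c>0$ such that the following holds. Fix an integer $k\ge 3$, real numbers $\varepsilon,\delta>0$ and an integer $T\ge 0$. Then there is $C=C(k,\varepsilon,\delta,T)>0$ such that for all $n\ge 2$, all $\beta\in\mathbb R$ and all deterministic unit vectors $u,v\in\mathbb R^n$ with $$|\beta|\ge n^{\varepsilon},\qquad |\beta\langle u,v\rangle^{k-2}|\le n^{-\varepsilon},\qquad |\beta|\le n^{\frac{k-2}{2}-\delta},$$ the following is true. Let $X=\beta v^{\otimes k}+Z$, where $Z\in\otimes^k\mathbb R^n$ is a random tensor with i.i.d. $\mathcal N(0,1/n)$ entries, let $X[w^{\otimes(k-1)}]\in\mathbb R^n$ be the vector with $i$-th entry $\langle X,e_i\otimes w^{\otimes(k-1)}\rangle$, and define the power iteration $u_0=u$, $u_{t+1}=X[u_t^{\otimes(k-1)}]/\|X[u_t^{\otimes(k-1)}]\|_2$. 1. Almost surely, $(u_t)_{t\ge0}$ converges neither to $v$ nor to $-v$ as $t\to\infty$. Moreover, with probability at least $1-Cn^{-c(\log n)^2}$, $\|u_t-v\|_2\ge 1$ and $\|u_t+v\|_2\ge 1$ for all $0\le t\le T$.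 2. If $$T\ \ge\ 1+\frac1\varepsilon\left(\frac12-\frac{\log|\beta|}{(k-2)\log n}\right),$$ then there is a standard Gaussian vector $\tilde\xi$ in $\mathbb R^n$, defined on the same probability space as $Z$, such that with probability at least $1-Cn^{-c(\log n)^2}$, $$\left\|u_T-\frac{\tilde\xi}{\|\tilde\xi\|_2}\right\|_2\ \le\ |\beta|\left(\frac{\log n}{\sqrt n}\right)^{k-1}.$$ -/

import Mathlib

open scoped NNReal

noncomputable section

namespace SpikedTensor

/-- `ℝⁿ` with its Euclidean norm. -/
abbrev Vec (n : ℕ) : Type := EuclideanSpace ℝ (Fin n)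

/-- `k`-th order tensors over `ℝⁿ`, as arrays of `n ^ k` real entries. -/
abbrev Tensor (k n : ℕ) : Type := (Fin k → Fin n) → ℝ

/-- The entrywise inner product of two tensors. -/
def tInner {k n : ℕ} (τ η : Tensor k n) : ℝ := ∑ J, τ J * η J

/-- The tensor product `w 0 ⊗ w 1 ⊗ ⋯ ⊗ w (k - 1)` of `k` vectors. -/
def pureTensor {k n : ℕ} (w : Fin k → Vec n) : Tensor k n := fun J => ∏ l, w l (J l)

/-- The tensor power `v ^ {⊗ k}`. -/
def tpow (k : ℕ) {n : ℕ} (v : Vec n) : Tensor k n := pureTensor fun _ => v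

/-- The vector `X[u ^ {⊗ (k - 1)}]`, whose `i`-th coordinate is `⟨X, e_i ⊗ u ^ {⊗ (k - 1)}⟩`
(the first of the `k` tensor factors is `e_i`, the others are `u`). -/
def act {k n : ℕ} (X : Tensor k n) (u : Vec n) : Vec n :=
  WithLp.toLp 2 fun i =>
    tInner X (pureTensor fun l => if l.val = 0 then EuclideanSpace.single i (1 : ℝ) else u)

/-- Tensor power iteration `u_0 = u`, `u_{t+1} = X[u_t ^ {⊗ (k - 1)}] / ‖X[u_t ^ {⊗ (k - 1)}]‖`. -/
def powerIter {k n : ℕ} (X : Tensor k n) (u : Vec n) : ℕ → Vec n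
  | 0 => u
  | t + 1 => ‖act X (powerIter X u t)‖⁻¹ • act X (powerIter X u t)

/-- The rank-one spiked tensor `X = β v ^ {⊗ k} + Z`. -/
def spiked {k n : ℕ} (β : ℝ) (v : Vec n) (Z : Tensor k n) : Tensor k n := β • tpow k v + Z

/-- The entries of the random tensor `Z` are i.i.d. `N(0, 1/n)` random variables. -/
def IsGaussianNoise {Ω : Type*} [MeasurableSpace Ω] (P : MeasureTheory.Measure Ω) {k n : ℕ}
    (Z : Ω → Tensor k n) : Prop :=
  ProbabilityTheory.iIndepFun (fun (J : Fin k → Fin n) (ω : Ω) => Z ω J) P ∧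
    ∀ J : Fin k → Fin n,
      ProbabilityTheory.HasLaw (fun ω => Z ω J)
        (ProbabilityTheory.gaussianReal 0 ((n : ℝ≥0)⁻¹)) P

end SpikedTensor

end

/-! Write `m = k - 1`. Unfolded along its first index, √n Z is an n × n^m standard Gaussian matrix,
and a power iteration step queries its product with `tensorPow m u_t`. A rotation of the row space,
chosen adaptively and always fixing the directions already queried, preserves the Gaussian law
(`measurePreserving_adaptive_rotation`). Hence (`exists_innovations`) the answer to query t is ∑_{r
≤ t} L t r ξ_r, where each ξ_r is standard Gaussian and independent of each iterate u_q with q ≤ r,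
and L is the Cholesky factor of the Gram matrix ⟨u_s, u_t⟩^m.

Outside a union of Gaussian tail events, each ξ_r has norm of order √n and inner products at most s
with v and with the iterates up to time r. By induction, the overlap of u_t with v and with earlier
iterates is bounded by the recursion a ↦ K (|β| a^m + s/√n) (`IsInnovationIteration.overlaps_le`).
The smallness of |β⟨u,v⟩^(m-1)| contracts the initial overlap by n^(-ε) at each step, and the upper
bound on |β| makes s/√n a stable level (`exists_overlapBound_le`). Overlaps with ±v thus stay at
most 1/2, so distances stay at least 1. Almost sure non-convergence is a fixed-point argument: a
limit ±v would force the noise applied to it to be parallel to v.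

At time T, the iterate is the normalization of W v + ξ_{T-1} plus a small contribution of earlier
innovations, where W is the rescaled signal. Bounding W directly with the required probability would
need s of order (log n)^(3/2), and this bound would exceed the stated error. But W is independent of
ξ_{T-1}. So the component G of ξ_{T-1} along v is replaced by tr(G + W), where tr is the monotone
map from the law of G + W to N(0,1) (`hasLaw_transported`). The displacement of tr depends on the
law of W, so rare large values of W are averaged out and the scale log n suffices
(`abs_transport_sub_le`). `exists_gaussian_near_powerIter` combines these estimates. -/

open MeasureTheory ProbabilityTheory

noncomputable section

namespace SpikedTensor

/-! ### Invariance of Gaussian measures under adaptive rotations -/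

section Gaussian

variable {S : Type*} [NormedAddCommGroup S] [InnerProductSpace ℝ S] [FiniteDimensional ℝ S]
  [MeasurableSpace S] [BorelSpace S]

/-- Recombining the two complementary projections of independent standard Gaussian vectors
yields a standard Gaussian vector. -/
theorem measurePreserving_stdGaussian_mix (π : S →L[ℝ] S) (hπ : ∀ x, π (π x) = π x)
    (hs : ∀ x y, inner ℝ (π x) y = inner ℝ x (π y)) :
    MeasurePreserving (fun p : S × S => π p.1 + (p.2 - π p.2))
      ((stdGaussian S).prod (stdGaussian S)) (stdGaussian S) := by
  have hm : Measurable (fun p : S × S => π p.1 + (p.2 - π p.2)) := by fun_prop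
  refine ⟨hm, ?_⟩
  have : IsProbabilityMeasure (((stdGaussian S).prod (stdGaussian S)).map
      (fun p : S × S => π p.1 + (p.2 - π p.2))) :=
    Measure.isProbabilityMeasure_map hm.aemeasurable
  apply Measure.ext_of_charFun
  ext t
  rw [charFun_apply, integral_map hm.aemeasurable (by fun_prop)]
  -- Self-adjointness moves the projections onto the frequency `t`, so the characteristic function
  -- factors over the independent copies; Pythagoras then recombines the exponents.
  have h1 : ∀ p : S × S, Complex.exp ((inner ℝ (π p.1 + (p.2 - π p.2)) t : ℝ) * Complex.I) =
      Complex.exp ((inner ℝ p.1 (π t) : ℝ) * Complex.I) *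
      Complex.exp ((inner ℝ p.2 (t - π t) : ℝ) * Complex.I) := by
    intro p
    rw [← Complex.exp_add, ← add_mul, ← Complex.ofReal_add, inner_add_left, inner_sub_left, hs,
      hs, inner_sub_right]
  simp_rw [h1]
  rw [integral_prod_mul (fun x : S => Complex.exp ((inner ℝ x (π t) : ℝ) * Complex.I))
    (fun x : S => Complex.exp ((inner ℝ x (t - π t) : ℝ) * Complex.I)),
    ← charFun_apply, ← charFun_apply, charFun_stdGaussian, charFun_stdGaussian,
    charFun_stdGaussian, ← Complex.exp_add]
  have h0 : inner ℝ (π t) (t - π t) = 0 := by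
    rw [inner_sub_right, hs, hs, hπ, sub_self]
  have h2 : ‖t‖ ^ 2 = ‖π t‖ ^ 2 + ‖t - π t‖ ^ 2 := by
    have := norm_add_sq_real (π t) (t - π t)
    rw [h0] at this
    simpa using this
  congr 1
  rw [← Complex.ofReal_pow ‖t‖, h2]
  push_cast
  ring

/-- A rotation that depends on, and fixes, the range of a projection preserves the standard
Gaussian measure. -/
theorem measurePreserving_adaptive_rotation (π : S →L[ℝ] S) (hπ : ∀ x, π (π x) = π x)
    (hs : ∀ x y, inner ℝ (π x) y = inner ℝ x (π y)) (R : S → S ≃ₗᵢ[ℝ] S)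
    (hR : Measurable fun p : S × S => R p.1 p.2) (hRπ : ∀ x, R (π x) = R x)
    (hfix : ∀ x y, R x (π y) = π y) :
    MeasurePreserving (fun x => R x x) (stdGaussian S) (stdGaussian S) := by
  have hmix := measurePreserving_stdGaussian_mix π hπ hs
  have hcomm : ∀ x y, π (R x y) = π y := by
    intro x y
    refine ext_inner_right ℝ fun z => ?_
    rw [hs, ← hfix x z, LinearIsometryEquiv.inner_map_map, hs]
  have hskew : MeasurePreserving (fun p : S × S => (p.1, R p.1 p.2))
      ((stdGaussian S).prod (stdGaussian S)) ((stdGaussian S).prod (stdGaussian S)) :=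
    (MeasurePreserving.id (stdGaussian S)).skew_product (g := fun x y => R x y) hR
      (Filter.Eventually.of_forall fun x => stdGaussian_map (R x))
  have hRd : Measurable (fun x : S => R x x) := hR.comp (measurable_id.prodMk measurable_id)
  refine ⟨hRd, ?_⟩
  -- Take the two complementary components from independent copies. The rotation is then chosen by
  -- the first copy and acts on the second, so the diagonal map becomes a skew product with
  -- measure-preserving fibres.
  have key : (fun x => R x x) ∘ (fun p : S × S => π p.1 + (p.2 - π p.2)) =
      (fun p : S × S => π p.1 + (p.2 - π p.2)) ∘ (fun p : S × S => (p.1, R p.1 p.2)) := by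
    funext p
    have e1 : π (π p.1 + (p.2 - π p.2)) = π p.1 := by simp [hπ]
    have e2 : R (π p.1 + (p.2 - π p.2)) = R p.1 := by rw [← hRπ, e1, hRπ]
    simp only [Function.comp_apply, e2, map_add, map_sub, hfix, hcomm]
  have e := (hmix.comp hskew).map_eq
  rw [← key, ← Measure.map_map hRd hmix.measurable, hmix.map_eq] at e
  exact e

/-- The components of a standard Gaussian vector along a projection and along a map that
vanishes on its range are independent. -/
theorem indepFun_stdGaussian_of_orthogonal (π : S →L[ℝ] S) (hπ : ∀ x, π (π x) = π x)
    (hs : ∀ x y, inner ℝ (π x) y = inner ℝ x (π y)) {α β : Type*} [MeasurableSpace α]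
    [MeasurableSpace β] {f : S → α} {g : S → β} (hf : Measurable f) (hg : Measurable g)
    (hfπ : ∀ x, f (π x) = f x) (hgπ : ∀ x, g (x - π x) = g x) :
    IndepFun f g (stdGaussian S) := by
  have hmix := measurePreserving_stdGaussian_mix π hπ hs
  rw [indepFun_iff_map_prod_eq_prod_map_map hf.aemeasurable hg.aemeasurable]
  have hfg : Measurable (fun x => (f x, g x)) := hf.prodMk hg
  rw [← hmix.map_eq, Measure.map_map hfg hmix.measurable, hmix.map_eq,
    Measure.map_prod_map _ _ hf hg]
  congr 1
  funext p
  have e1 : π (π p.1 + (p.2 - π p.2)) = π p.1 := by simp [hπ]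
  simp only [Function.comp_apply, Prod.map]
  rw [← hfπ, e1, hfπ, ← hgπ, e1, ← hgπ p.2]
  simp

/-- The characteristic function of the image at `t` is that of the source at `g t`, which depends
only on ‖g t‖ = ‖t‖. -/
theorem map_stdGaussian_of_adjoint_isometry {V : Type*} [NormedAddCommGroup V]
    [InnerProductSpace ℝ V] [FiniteDimensional ℝ V] [MeasurableSpace V] [BorelSpace V]
    (f : S → V) (hf : Measurable f) (g : V → S) (hfg : ∀ x v, inner ℝ (f x) v = inner ℝ x (g v))
    (hg : ∀ v, ‖g v‖ = ‖v‖) : (stdGaussian S).map f = stdGaussian V := by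
  have : IsProbabilityMeasure ((stdGaussian S).map f) :=
    Measure.isProbabilityMeasure_map hf.aemeasurable
  apply Measure.ext_of_charFun
  ext t
  rw [charFun_apply, integral_map hf.aemeasurable (by fun_prop)]
  simp_rw [hfg]
  rw [← charFun_apply, charFun_stdGaussian, charFun_stdGaussian, hg]

end Gaussian

/-! ### Householder reflections and projections on initial basis segments -/

section Innovations

variable {E : Type*} [NormedAddCommGroup E] [InnerProductSpace ℝ E]

/-- The reflection in the hyperplane orthogonal to `h`. -/
def hyperRefl (h : E) : E ≃ₗᵢ[ℝ] E := ((Submodule.span ℝ {h})ᗮ).reflection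

theorem hyperRefl_apply (h w : E) : hyperRefl h w = w - (2 * (inner ℝ h w / ‖h‖ ^ 2)) • h := by
  rw [hyperRefl, Submodule.reflection_orthogonal_apply, Submodule.reflection_singleton_apply]
  simp only [RCLike.ofReal_real_eq_id, id, neg_sub, mul_smul, two_smul]

theorem hyperRefl_of_inner_eq_zero {h w : E} (hw : inner ℝ h w = 0) : hyperRefl h w = w := by
  simp [hyperRefl_apply, hw]

theorem hyperRefl_sub {v w : E} (h : ‖v‖ = ‖w‖) : hyperRefl (v - w) v = w :=
  Submodule.reflection_sub h

/-- The orthogonal projection to the span of the first `t` vectors of an orthonormal family. -/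
def projLT (e : ℕ → E) (t : ℕ) : E →L[ℝ] E :=
  ∑ r ∈ Finset.range t, (innerSL ℝ (e r)).smulRight (e r)

theorem projLT_apply (e : ℕ → E) (t : ℕ) (w : E) :
    projLT e t w = ∑ r ∈ Finset.range t, inner ℝ (e r) w • e r := by
  simp [projLT]

theorem inner_projLT (e : ℕ → E) (t : ℕ) (w z : E) :
    inner ℝ (projLT e t w) z = inner ℝ w (projLT e t z) := by
  simp only [projLT_apply, sum_inner, inner_sum, inner_smul_left, inner_smul_right]
  refine Finset.sum_congr rfl fun r _ => ?_
  rw [real_inner_comm w (e r)]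
  simp [mul_comm]

variable {e : ℕ → E} {T : ℕ}

theorem projLT_of_lt (he : ∀ r < T, ∀ s < T, inner ℝ (e r) (e s) = if r = s then (1 : ℝ) else 0)
    {t s : ℕ} (ht : t ≤ T) (hs : s < t) : projLT e t (e s) = e s := by
  rw [projLT_apply, Finset.sum_eq_single s]
  · rw [he s (hs.trans_le ht) s (hs.trans_le ht), if_pos rfl, one_smul]
  · intro r hr hrs
    rw [he r ((Finset.mem_range.1 hr).trans_le ht) s (hs.trans_le ht), if_neg hrs, zero_smul]
  · intro h
    exact absurd (Finset.mem_range.2 hs) h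

theorem projLT_of_le (he : ∀ r < T, ∀ s < T, inner ℝ (e r) (e s) = if r = s then (1 : ℝ) else 0)
    {t s : ℕ} (ht : t < T) (hs : s ≤ t) : projLT e s (e t) = 0 := by
  rw [projLT_apply]
  refine Finset.sum_eq_zero fun r hr => ?_
  have := Finset.mem_range.1 hr
  rw [he r (by omega) t ht, if_neg (by omega), zero_smul]

theorem projLT_projLT (he : ∀ r < T, ∀ s < T, inner ℝ (e r) (e s) = if r = s then (1 : ℝ) else 0)
    {t s : ℕ} (ht : t ≤ T) (hs : s ≤ t) (w : E) : projLT e t (projLT e s w) = projLT e s w := by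
  rw [projLT_apply e s, map_sum]
  refine Finset.sum_congr rfl fun r hr => ?_
  have := Finset.mem_range.1 hr
  rw [map_smul, projLT_of_lt he ht (by omega)]

theorem projLT_projLT' (he : ∀ r < T, ∀ s < T, inner ℝ (e r) (e s) = if r = s then (1 : ℝ) else 0)
    {t s : ℕ} (ht : t ≤ T) (hs : s ≤ t) (w : E) : projLT e s (projLT e t w) = projLT e s w := by
  refine ext_inner_right ℝ fun z => ?_
  rw [inner_projLT, inner_projLT, projLT_projLT he ht hs, inner_projLT]

/-- The unit vector along the component of `q` orthogonal to the first `t` basis vectors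
(the `t`-th basis vector if that component vanishes). -/
def residualDir (e : ℕ → E) (t : ℕ) (q : E) : E :=
  open Classical in
  if q - projLT e t q = 0 then e t else ‖q - projLT e t q‖⁻¹ • (q - projLT e t q)

theorem residualDir_spec (he : ∀ r < T, ∀ s < T, inner ℝ (e r) (e s) = if r = s then (1 : ℝ) else 0)
    {t : ℕ} (ht : t < T) (q : E) :
    ‖residualDir e t q‖ = 1 ∧ projLT e t (residualDir e t q) = 0 ∧
      q = projLT e t q + ‖q - projLT e t q‖ • residualDir e t q := by
  unfold residualDir
  have hn : ‖e t‖ = 1 := by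
    have := he t ht t ht
    rw [if_pos rfl, real_inner_self_eq_norm_sq] at this
    nlinarith [norm_nonneg (e t)]
  split_ifs with h
  · refine ⟨hn, projLT_of_le he ht le_rfl, ?_⟩
    rw [h, norm_zero, zero_smul, add_zero]
    exact sub_eq_zero.1 h
  · have h' : ‖q - projLT e t q‖ ≠ 0 := norm_ne_zero_iff.2 h
    refine ⟨?_, ?_, ?_⟩
    · rw [norm_smul, norm_inv, norm_norm, inv_mul_cancel₀ h']
    · rw [map_smul, map_sub, projLT_projLT he ht.le le_rfl, sub_self, smul_zero]
    · rw [smul_smul, mul_inv_cancel₀ h', one_smul]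
      abel

/-- The direction of the reflection which aligns the orthogonal component of `q` with `e t`. -/
def alignDir (e : ℕ → E) (t : ℕ) (q : E) : E := residualDir e t q - e t

/-- Both unit vectors whose difference defines the reflection are orthogonal to the first `t` basis
vectors, so it fixes their span. -/
theorem hyperRefl_alignDir_of_projLT
    (he : ∀ r < T, ∀ s < T, inner ℝ (e r) (e s) = if r = s then (1 : ℝ) else 0)
    {t : ℕ} (ht : t < T) (q w : E) :
    hyperRefl (alignDir e t q) (projLT e t w) = projLT e t w := by
  apply hyperRefl_of_inner_eq_zero
  rw [← inner_projLT, alignDir, map_sub, (residualDir_spec he ht q).2.1,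
    projLT_of_le he ht le_rfl, sub_zero, inner_zero_left]

/-- One Householder step of a QR factorization: the residual direction is sent to `e t`, so the last
coordinate of the image is a norm and hence nonnegative. -/
theorem hyperRefl_alignDir_self
    (he : ∀ r < T, ∀ s < T, inner ℝ (e r) (e s) = if r = s then (1 : ℝ) else 0)
    {t : ℕ} (ht : t < T) (q : E) :
    hyperRefl (alignDir e t q) q = projLT e t q + ‖q - projLT e t q‖ • e t := by
  have hn : ‖e t‖ = 1 := by
    have := he t ht t ht
    rw [if_pos rfl, real_inner_self_eq_norm_sq] at this
    nlinarith [norm_nonneg (e t)]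
  obtain ⟨h1, h2, h3⟩ := residualDir_spec he ht q
  have h4 : hyperRefl (alignDir e t q) (residualDir e t q) = e t :=
    hyperRefl_sub (h1.trans hn.symm)
  conv_lhs => arg 2; rw [h3]
  rw [map_add, map_smul, h4, hyperRefl_alignDir_of_projLT he ht]

variable [MeasurableSpace E] [BorelSpace E] [SecondCountableTopology E]

theorem measurable_alignDir (e : ℕ → E) (t : ℕ) : Measurable (alignDir e t) := by
  unfold alignDir residualDir
  refine Measurable.sub_const (Measurable.ite ?_ measurable_const ?_) _
  · exact (measurableSet_singleton (0 : E)).preimage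
      (f := fun q => q - projLT e t q) (by fun_prop)
  · fun_prop

theorem measurable_hyperRefl {α : Type*} [MeasurableSpace α] {h w : α → E} (hh : Measurable h)
    (hw : Measurable w) : Measurable fun a => hyperRefl (h a) (w a) := by
  simp_rw [hyperRefl_apply]
  fun_prop

end Innovations

/-! ### Adaptive queries to a Gaussian matrix -/

section AdaptiveQueries

variable {ι : Type*} [Fintype ι] {E : Type*} [NormedAddCommGroup E] [InnerProductSpace ℝ E]

/-- The product of a matrix, given by its rows, with a vector. -/
def rowMul (x : PiLp 2 fun _ : ι => E) (w : E) : EuclideanSpace ℝ ι :=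
  WithLp.toLp 2 fun i => inner ℝ (x i) w

/-- Right multiplication of a matrix, given by its rows, with a rotation. -/
def rowRot (r : E ≃ₗᵢ[ℝ] E) : (PiLp 2 fun _ : ι => E) ≃ₗᵢ[ℝ] (PiLp 2 fun _ : ι => E) :=
  LinearIsometryEquiv.piLpCongrRight 2 fun _ => r

theorem rowRot_apply (r : E ≃ₗᵢ[ℝ] E) (x : PiLp 2 fun _ : ι => E) (i : ι) :
    rowRot r x i = r (x i) := rfl

theorem rowMul_rowRot (r : E ≃ₗᵢ[ℝ] E) (x : PiLp 2 fun _ : ι => E) (w : E) :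
    rowMul (rowRot r x) (r w) = rowMul x w := by
  unfold rowMul
  congr 1
  funext i
  rw [rowRot_apply, LinearIsometryEquiv.inner_map_map]

theorem rowMul_sum_smul {κ : Type*} (s : Finset κ) (c : κ → ℝ) (w : κ → E)
    (x : PiLp 2 fun _ : ι => E) :
    rowMul x (∑ r ∈ s, c r • w r) = ∑ r ∈ s, c r • rowMul x (w r) := by
  ext i
  simp [rowMul, inner_sum, inner_smul_right]

variable [FiniteDimensional ℝ E]

/-- The projection `projLT` applied to each row. -/
def rowProj (ι : Type*) [Fintype ι] (e : ℕ → E) (t : ℕ) :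
    (PiLp 2 fun _ : ι => E) →L[ℝ] (PiLp 2 fun _ : ι => E) :=
  LinearMap.toContinuousLinearMap
    { toFun := fun x => WithLp.toLp 2 fun i => projLT e t (x i)
      map_add' := fun x y => by ext i; simp
      map_smul' := fun c x => by ext i; simp }

theorem rowProj_apply (e : ℕ → E) (t : ℕ) (x : PiLp 2 fun _ : ι => E) (i : ι) :
    rowProj ι e t x i = projLT e t (x i) := rfl

theorem inner_rowProj (e : ℕ → E) (t : ℕ) (x y : PiLp 2 fun _ : ι => E) :
    inner ℝ (rowProj ι e t x) y = inner ℝ x (rowProj ι e t y) := by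
  simp [PiLp.inner_apply, rowProj_apply, inner_projLT]

theorem rowMul_rowProj (e : ℕ → E) (t : ℕ) (x : PiLp 2 fun _ : ι => E) (w : E) :
    rowMul (rowProj ι e t x) w = rowMul x (projLT e t w) := by
  unfold rowMul
  congr 1
  funext i
  rw [rowProj_apply, inner_projLT]

variable [MeasurableSpace E] [BorelSpace E]

theorem measurable_rowMul :
    Measurable fun p : (PiLp 2 fun _ : ι => E) × E => rowMul p.1 p.2 := by
  unfold rowMul
  fun_prop

theorem measurable_rowRot {α : Type*} [MeasurableSpace α] (ρ : α → (E ≃ₗᵢ[ℝ] E))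
    (hρ : Measurable fun p : α × E => ρ p.1 p.2) :
    Measurable fun p : α × (PiLp 2 fun _ : ι => E) => rowRot (ρ p.1) p.2 := by
  refine (WithLp.measurable_toLp 2 (ι → E)).comp (measurable_pi_lambda _ fun i => ?_)
  have hi : Measurable fun p : α × (PiLp 2 fun _ : ι => E) => p.2 i := by fun_prop
  exact hρ.comp (measurable_fst.prodMk hi)

/-- A unit vector multiplied by a Gaussian matrix is a standard Gaussian vector. -/
theorem map_rowMul_stdGaussian {w : E} (hw : ‖w‖ = 1) :
    (stdGaussian (PiLp 2 fun _ : ι => E)).map (fun x => rowMul x w) =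
      stdGaussian (EuclideanSpace ℝ ι) := by
  refine map_stdGaussian_of_adjoint_isometry _
    (measurable_rowMul.comp (measurable_id.prodMk measurable_const))
    (fun v => WithLp.toLp 2 fun i => v i • w) ?_ ?_
  · intro x v
    simp [PiLp.inner_apply, rowMul, inner_smul_right]
  · intro v
    simp [PiLp.norm_eq_of_L2, norm_smul, hw]

variable {𝒰 : Type*} [MeasurableSpace 𝒰]

/-- The states of an algorithm which, in the state `u`, queries the product of the matrix `x`
with the vector `φ u`. -/
def queryStates (φ : 𝒰 → E) (Φ : 𝒰 → EuclideanSpace ℝ ι → 𝒰) (u₀ : 𝒰)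
    (x : PiLp 2 fun _ : ι => E) : ℕ → 𝒰
  | 0 => u₀
  | t + 1 => Φ (queryStates φ Φ u₀ x t) (rowMul x (φ (queryStates φ Φ u₀ x t)))

-- Induction on the number of queries, one reflection per query. `Θ x` is the rotated matrix, whose
-- columns are its products with the `e r`. The rotation `O` is recoverable from the first `t`
-- columns of `Θ x`, and the state at time `s` from the first `s`. The rotated queries are
-- triangular with nonnegative diagonal, which produces a Cholesky factor. Recording everything as a
-- function of `Θ x` rather than of `x` is what makes the dependence on initial columns, and hence
-- independence, expressible.
set_option maxHeartbeats 1000000 in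
theorem exists_adapted_rotation {φ : 𝒰 → E} (hφ : Measurable φ)
    {Φ : 𝒰 → EuclideanSpace ℝ ι → 𝒰} (hΦ : Measurable fun p : 𝒰 × EuclideanSpace ℝ ι => Φ p.1 p.2)
    (u₀ : 𝒰) {e : ℕ → E} {T : ℕ}
    (he : ∀ r < T, ∀ s < T, inner ℝ (e r) (e s) = if r = s then (1 : ℝ) else 0)
    (t : ℕ) (ht : t ≤ T) :
    ∃ (Θ : (PiLp 2 fun _ : ι => E) → (PiLp 2 fun _ : ι => E))
      (O : (PiLp 2 fun _ : ι => E) → (E ≃ₗᵢ[ℝ] E)) (U : ℕ → (PiLp 2 fun _ : ι => E) → 𝒰),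
      MeasurePreserving Θ (stdGaussian _) (stdGaussian _) ∧
      (∀ x w, rowMul (Θ x) (O (Θ x) w) = rowMul x w) ∧
      (Measurable fun p : (PiLp 2 fun _ : ι => E) × E => O p.1 p.2) ∧
      (∀ y, O (rowProj ι e t y) = O y) ∧
      (∀ s ≤ t, Measurable (U s) ∧ (∀ y, U s (rowProj ι e s y) = U s y) ∧
        ∀ x, queryStates φ Φ u₀ x s = U s (Θ x)) ∧
      ∀ s < t, ∀ y, projLT e (s + 1) (O y (φ (U s y))) = O y (φ (U s y)) ∧
        0 ≤ inner ℝ (e s) (O y (φ (U s y))) := by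
  induction t with
  | zero =>
    refine ⟨id, fun _ => LinearIsometryEquiv.refl ℝ E, fun _ _ => u₀, MeasurePreserving.id _,
      fun x w => rfl, measurable_snd, fun _ => rfl, ?_, fun s hs => absurd hs (by omega)⟩
    intro s hs
    obtain rfl : s = 0 := by omega
    exact ⟨measurable_const, fun _ => rfl, fun _ => rfl⟩
  | succ t ih =>
    have htT : t < T := by omega
    obtain ⟨Θ, O, U, hΘ, hO, hOm, hOπ, hU, hL⟩ := ih (by omega)
    have hππ : ∀ a b, a ≤ b → b ≤ T → ∀ y : PiLp 2 fun _ : ι => E,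
        rowProj ι e a (rowProj ι e b y) = rowProj ι e a y := by
      intro a b hab hb y
      ext i
      simp [rowProj_apply, projLT_projLT' he hb hab]
    obtain ⟨hUm, hUπ, hUt⟩ := hU t le_rfl
    -- The next query in the rotated coordinates; it is determined by the first `t` columns, so a
    -- reflection aligned with it is an admissible adaptive rotation.
    obtain ⟨q, hq⟩ : ∃ q : (PiLp 2 fun _ : ι => E) → E, ∀ y, q y = O y (φ (U t y)) :=
      ⟨_, fun _ => rfl⟩
    have hqm : Measurable q := by
      rw [funext hq]
      exact hOm.comp (measurable_id.prodMk (hφ.comp hUm))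
    have hqπ : ∀ y, q (rowProj ι e t y) = q y := fun y => by simp only [hq, hOπ, hUπ]
    obtain ⟨ρ, hρ⟩ : ∃ ρ : (PiLp 2 fun _ : ι => E) → (E ≃ₗᵢ[ℝ] E),
        ∀ y, ρ y = hyperRefl (alignDir e t (q y)) := ⟨_, fun _ => rfl⟩
    have hρπ : ∀ y, ρ (rowProj ι e t y) = ρ y := fun y => by simp only [hρ, hqπ]
    have hρm : Measurable fun p : (PiLp 2 fun _ : ι => E) × E => ρ p.1 p.2 := by
      have h1 : Measurable fun y : PiLp 2 fun _ : ι => E => alignDir e t (q y) :=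
        (measurable_alignDir e t).comp hqm
      simp only [hρ]
      exact measurable_hyperRefl (h1.comp measurable_fst) measurable_snd
    have hρfix : ∀ y w, ρ y (projLT e t w) = projLT e t w := fun y w => by
      rw [hρ, hyperRefl_alignDir_of_projLT he htT]
    have hρP : ∀ y w, projLT e t (ρ y w) = projLT e t w := by
      intro y w
      refine ext_inner_right ℝ fun z => ?_
      rw [inner_projLT, ← hρfix y z, LinearIsometryEquiv.inner_map_map, inner_projLT]
    have hrotm := measurable_rowRot (ι := ι) ρ hρm
    have hrotP : ∀ y z : PiLp 2 fun _ : ι => E,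
        rowProj ι e t (rowRot (ρ y) z) = rowProj ι e t z := by
      intro y z
      ext i
      simp only [rowProj_apply, rowRot_apply, hρP]
    have hrot : MeasurePreserving (fun y : PiLp 2 fun _ : ι => E => rowRot (ρ y) y)
        (stdGaussian _) (stdGaussian _) := by
      refine measurePreserving_adaptive_rotation (rowProj ι e t) (hππ t t le_rfl htT.le)
        (inner_rowProj e t) (fun y => rowRot (ρ y)) hrotm (fun y => ?_) (fun y z => ?_)
      · simp only [hρπ]
      · ext i
        simp only [rowProj_apply, rowRot_apply, hρfix]
    -- The new reflection leaves the first `t` columns unchanged, so whatever was read from them can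
    -- still be read after rotating.
    have hρrot : ∀ y, ρ (rowRot (ρ y) y) = ρ y := fun y => by rw [← hρπ, hrotP, hρπ]
    have hOrot : ∀ y, O (rowRot (ρ y) y) = O y := fun y => by rw [← hOπ, hrotP, hOπ]
    have hUs : ∀ s ≤ t, ∀ y, U s (rowRot (ρ y) y) = U s y := fun s hs y => by
      rw [← (hU s hs).2.1, ← hππ s t hs htT.le, hrotP, hππ s t hs htT.le, (hU s hs).2.1]
    have halign : ∀ y, ρ y (q y) = projLT e t (q y) + ‖q y - projLT e t (q y)‖ • e t := fun y => by
      rw [hρ, hyperRefl_alignDir_self he htT]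
    have het : inner ℝ (e t) (e t) = (1 : ℝ) := by rw [he t htT t htT, if_pos rfl]
    have hPt : ∀ y, projLT e (t + 1) (ρ y (q y)) = ρ y (q y) := by
      intro y
      rw [halign, map_add, map_smul, projLT_projLT he (by omega) (by omega),
        projLT_of_lt he (by omega) (by omega)]
    refine ⟨fun x => rowRot (ρ (Θ x)) (Θ x), fun y => (O y).trans (ρ y),
      fun s y => if s ≤ t then U s y else Φ (U t y) (rowMul y (ρ y (q y))),
      hrot.comp hΘ, ?_, ?_, ?_, ?_, ?_⟩
    · intro x w
      simp only [LinearIsometryEquiv.trans_apply, hρrot, hOrot, rowMul_rowRot, hO]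
    · exact hρm.comp (measurable_fst.prodMk hOm)
    · intro y
      beta_reduce
      rw [← hOπ, ← hρπ, hππ _ _ (by omega) (by omega), hOπ, hρπ]
    · intro s hs
      rcases Nat.lt_or_ge t s with hst | hst
      · obtain rfl : s = t + 1 := by omega
        simp only [show ¬ (t + 1 ≤ t) by omega, if_false]
        refine ⟨?_, ?_, ?_⟩
        · exact hΦ.comp (hUm.prodMk (measurable_rowMul.comp
            (measurable_id.prodMk (hρm.comp (measurable_id.prodMk hqm)))))
        · intro y
          have e1 : q (rowProj ι e (t + 1) y) = q y := by
            rw [← hqπ, hππ _ _ (by omega) (by omega), hqπ]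
          have e2 : ρ (rowProj ι e (t + 1) y) = ρ y := by
            rw [← hρπ, hππ _ _ (by omega) (by omega), hρπ]
          have e3 : U t (rowProj ι e (t + 1) y) = U t y := by
            rw [← hUπ, hππ _ _ (by omega) (by omega), hUπ]
          -- The rotated query lies in the span of the first `t + 1` basis vectors, so its answer
          -- involves only the first `t + 1` columns.
          rw [e1, e2, e3, rowMul_rowProj, hPt]
        · intro x
          have e1 : q (rowRot (ρ (Θ x)) (Θ x)) = q (Θ x) := by
            simp only [hq, hOrot, hUs t le_rfl]
          rw [hUs t le_rfl, hρrot, e1, rowMul_rowRot]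
          simp only [queryStates, hq, hUt, hO]
      · simp only [hst, if_true]
        refine ⟨(hU s hst).1, (hU s hst).2.1, fun x => ?_⟩
        rw [hUs s hst, (hU s hst).2.2]
    · intro s hs y
      simp only [show s ≤ t by omega, if_true, LinearIsometryEquiv.trans_apply]
      rcases Nat.lt_or_ge s t with hst | hst
      · obtain ⟨h1, h2⟩ := hL s hst y
        have h3 : ρ y (O y (φ (U s y))) = O y (φ (U s y)) := by
          rw [← h1, ← projLT_projLT he htT.le (show s + 1 ≤ t by omega), hρfix]
        rw [h3]
        exact ⟨h1, h2⟩
      · obtain rfl : s = t := by omega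
        refine ⟨by rw [← hq, hPt], ?_⟩
        rw [← hq, halign, inner_add_right, inner_smul_right, het, ← inner_projLT,
          projLT_of_le he htT le_rfl, inner_zero_left, zero_add, mul_one]
        exact norm_nonneg _

/-- Answers of a Gaussian matrix to `T` adaptive queries: they are combinations, given by the
Cholesky factor of the Gram matrix of the queries, of standard Gaussian vectors, each of which
is independent of the states up to its own time. -/
theorem exists_innovations {φ : 𝒰 → E} (hφ : Measurable φ)
    {Φ : 𝒰 → EuclideanSpace ℝ ι → 𝒰} (hΦ : Measurable fun p : 𝒰 × EuclideanSpace ℝ ι => Φ p.1 p.2)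
    (u₀ : 𝒰) {T : ℕ} (hT : T ≤ Module.finrank ℝ E) :
    ∃ ξ : ℕ → (PiLp 2 fun _ : ι => E) → EuclideanSpace ℝ ι,
      (∀ r < T, Measurable (ξ r) ∧ (stdGaussian _).map (ξ r) = stdGaussian (EuclideanSpace ℝ ι)) ∧
      (∀ s r, s ≤ r → r < T →
        IndepFun (fun x => queryStates φ Φ u₀ x s) (ξ r) (stdGaussian _)) ∧
      ∀ x, ∃ L : ℕ → ℕ → ℝ, (∀ t < T, 0 ≤ L t t) ∧
        (∀ s t, s ≤ t → t < T → inner ℝ (φ (queryStates φ Φ u₀ x s))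
          (φ (queryStates φ Φ u₀ x t)) = ∑ r ∈ Finset.range (s + 1), L s r * L t r) ∧
        ∀ t < T, rowMul x (φ (queryStates φ Φ u₀ x t)) =
          ∑ r ∈ Finset.range (t + 1), L t r • ξ r x := by
  obtain ⟨e, he⟩ : ∃ e : ℕ → E,
      ∀ r < T, ∀ s < T, inner ℝ (e r) (e s) = if r = s then (1 : ℝ) else 0 := by
    have hb := (stdOrthonormalBasis ℝ E).orthonormal
    rw [orthonormal_iff_ite] at hb
    refine ⟨fun r => if h : r < Module.finrank ℝ E then stdOrthonormalBasis ℝ E ⟨r, h⟩ else 0, ?_⟩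
    intro r hr s hs
    simp only [hr.trans_le hT, hs.trans_le hT, dif_pos, hb, Fin.mk.injEq]
  obtain ⟨Θ, O, U, hΘ, hO, hOm, hOπ, hU, hL⟩ := exists_adapted_rotation (ι := ι) hφ hΦ u₀ he T le_rfl
  have hcol : ∀ r, Measurable fun y : PiLp 2 fun _ : ι => E => rowMul y (e r) := fun r =>
    measurable_rowMul.comp (measurable_id.prodMk measurable_const)
  -- The innovations are the columns of the rotated matrix. Column `r` is orthogonal to the columns
  -- that determine the states up to time `r`.
  refine ⟨fun r x => rowMul (Θ x) (e r), ?_, ?_, ?_⟩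
  · intro r hr
    refine ⟨(hcol r).comp hΘ.measurable, ?_⟩
    have hn : ‖e r‖ = 1 := by
      have := he r hr r hr
      rw [if_pos rfl, real_inner_self_eq_norm_sq] at this
      nlinarith [norm_nonneg (e r)]
    rw [← map_rowMul_stdGaussian (ι := ι) hn]
    conv_rhs => rw [← hΘ.map_eq]
    rw [Measure.map_map (hcol r) hΘ.measurable]
    rfl
  · intro s r hsr hr
    obtain ⟨h1, h2, h3⟩ := hU s (by omega)
    simp_rw [h3]
    have hi : IndepFun (U s) (fun y : PiLp 2 fun _ : ι => E => rowMul y (e r)) (stdGaussian _) := by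
      refine indepFun_stdGaussian_of_orthogonal (rowProj ι e s) ?_ (inner_rowProj e s) h1 (hcol r)
        h2 ?_
      · intro y
        ext i
        simp [rowProj_apply, projLT_projLT' he (show s ≤ T by omega) le_rfl]
      · intro y
        ext i
        simp only [rowMul, PiLp.sub_apply, rowProj_apply, inner_sub_left, inner_projLT,
          projLT_of_le he hr hsr, inner_zero_right, sub_zero]
    rw [← hΘ.map_eq, indepFun_iff_map_prod_eq_prod_map_map h1.aemeasurable (hcol r).aemeasurable,
      Measure.map_map (h1.prodMk (hcol r)) hΘ.measurable, Measure.map_map h1 hΘ.measurable,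
      Measure.map_map (hcol r) hΘ.measurable] at hi
    exact (indepFun_iff_map_prod_eq_prod_map_map (h1.comp hΘ.measurable).aemeasurable
      ((hcol r).comp hΘ.measurable).aemeasurable).2 hi
  · intro x
    -- Row `t` of `L` consists of the coordinates of the rotated query; rotation preserves the Gram
    -- matrix, and triangularity truncates the sums.
    refine ⟨fun t r => inner ℝ (e r) (O (Θ x) (φ (U t (Θ x)))), fun t ht => (hL t ht _).2, ?_, ?_⟩
    · intro s t hst ht
      rw [(hU s (by omega)).2.2, (hU t (by omega)).2.2,
        ← LinearIsometryEquiv.inner_map_map (O (Θ x))]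
      conv_lhs => arg 2; rw [← (hL s (by omega) _).1, projLT_apply]
      rw [sum_inner]
      exact Finset.sum_congr rfl fun r _ => by rw [real_inner_smul_left]
    · intro t ht
      rw [(hU t (by omega)).2.2, ← hO]
      conv_lhs => arg 2; rw [← (hL t (by omega) _).1, projLT_apply]
      rw [rowMul_sum_smul]

end AdaptiveQueries

/-! ### Unfolding of tensors and power iteration as a query algorithm -/

section Tensors

variable {m n : ℕ}

theorem sum_cons {M : Type*} [AddCommMonoid M] (f : (Fin (m + 1) → Fin n) → M) :
    ∑ J, f J = ∑ i : Fin n, ∑ J : Fin m → Fin n, f (Fin.cons i J) := by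
  rw [← (Fin.consEquiv fun _ : Fin (m + 1) => Fin n).sum_comp f, Fintype.sum_prod_type]
  rfl

/-- The tensor power as an element of a Euclidean space. -/
def tensorPow (m : ℕ) {n : ℕ} (u : Vec n) : EuclideanSpace ℝ (Fin m → Fin n) :=
  WithLp.toLp 2 (tpow m u)

theorem tensorPow_apply (u : Vec n) (J : Fin m → Fin n) : tensorPow m u J = ∏ l, u (J l) := rfl

theorem measurable_tensorPow : Measurable (tensorPow m : Vec n → _) := by
  refine (WithLp.measurable_toLp 2 _).comp (measurable_pi_lambda _ fun J => ?_)
  unfold tpow pureTensor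
  fun_prop

theorem inner_tensorPow (u w : Vec n) :
    inner ℝ (tensorPow m u) (tensorPow m w) = (inner ℝ u w) ^ m := by
  simp only [PiLp.inner_apply, tensorPow_apply, RCLike.inner_apply, conj_trivial,
    ← Finset.prod_mul_distrib]
  rw [← Fintype.prod_sum fun (_ : Fin m) i => w i * u i]
  simp

theorem act_apply (X : Tensor (m + 1) n) (u : Vec n) (i : Fin n) :
    act X u i = ∑ J : Fin m → Fin n, X (Fin.cons i J) * ∏ l, u (J l) := by
  simp only [act, tInner, pureTensor]
  rw [sum_cons, Finset.sum_eq_single i]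
  · refine Finset.sum_congr rfl fun J _ => ?_
    rw [Fin.prod_univ_succ]
    simp
  · intro j _ hj
    refine Finset.sum_eq_zero fun J _ => ?_
    rw [Fin.prod_univ_succ]
    simp [hj]
  · simp

/-- The unfolding of a tensor to a matrix, given by its rows. -/
def unfoldRows (X : EuclideanSpace ℝ (Fin (m + 1) → Fin n)) :
    PiLp 2 fun _ : Fin n => EuclideanSpace ℝ (Fin m → Fin n) :=
  WithLp.toLp 2 fun i => WithLp.toLp 2 fun J => X (Fin.cons i J)

theorem measurable_unfoldRows : Measurable (unfoldRows : EuclideanSpace ℝ (Fin (m + 1) → Fin n) → _) := by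
  unfold unfoldRows
  fun_prop

theorem rowMul_unfoldRows (X : Tensor (m + 1) n) (u : Vec n) :
    rowMul (unfoldRows (WithLp.toLp 2 X)) (tensorPow m u) = act X u := by
  ext i
  rw [act_apply]
  simp [rowMul, unfoldRows, PiLp.inner_apply, tensorPow_apply, mul_comm]

theorem map_unfoldRows_stdGaussian :
    (stdGaussian (EuclideanSpace ℝ (Fin (m + 1) → Fin n))).map unfoldRows = stdGaussian _ := by
  refine map_stdGaussian_of_adjoint_isometry _ measurable_unfoldRows
    (fun y => WithLp.toLp 2 fun J => y (J 0) (Fin.tail J)) ?_ ?_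
  · intro x y
    simp only [PiLp.inner_apply, unfoldRows]
    rw [sum_cons]
    simp
  · intro y
    rw [PiLp.norm_eq_of_L2, PiLp.norm_eq_of_L2, sum_cons]
    simp [PiLp.norm_sq_eq_of_L2]

theorem act_add (X Y : Tensor (m + 1) n) (u : Vec n) : act (X + Y) u = act X u + act Y u := by
  ext i
  simp [act_apply, add_mul, Finset.sum_add_distrib]

theorem act_smul (c : ℝ) (X : Tensor (m + 1) n) (u : Vec n) : act (c • X) u = c • act X u := by
  ext i
  simp [act_apply, mul_assoc, Finset.mul_sum]

theorem act_tpow (u v : Vec n) : act (tpow (m + 1) v) u = (inner ℝ u v) ^ m • v := by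
  ext i
  rw [act_apply, ← inner_tensorPow]
  simp only [tpow, pureTensor, PiLp.inner_apply, tensorPow_apply, RCLike.inner_apply, conj_trivial,
    PiLp.smul_apply, smul_eq_mul, Fin.prod_univ_succ, Fin.cons_zero, Fin.cons_succ, Finset.sum_mul]
  exact Finset.sum_congr rfl fun J _ => by ring

theorem act_spiked (β : ℝ) (v : Vec n) (Z : Tensor (m + 1) n) (u : Vec n) :
    act (spiked β v Z) u = (β * (inner ℝ u v) ^ m) • v + act Z u := by
  rw [spiked, act_add, act_smul, act_tpow, smul_smul]

theorem hasLaw_unfoldRows {Ω : Type*} [MeasurableSpace Ω] {P : Measure Ω} [IsProbabilityMeasure P]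
    (hn : 0 < n) {Z : Ω → Tensor (m + 1) n} (hZ : IsGaussianNoise P Z) :
    HasLaw (fun ω => unfoldRows (WithLp.toLp 2 (√(n : ℝ) • Z ω))) (stdGaussian _) P := by
  obtain ⟨hi, hl⟩ := hZ
  have hl' : ∀ J, HasLaw (fun ω => √(n : ℝ) * Z ω J) (gaussianReal 0 1) P := by
    intro J
    have := gaussianReal_const_mul (hl J) (√(n : ℝ))
    convert this using 2
    · simp
    · ext
      have : (n : ℝ) ≠ 0 := by positivity
      simp [this]
  have hi' : iIndepFun (fun (J : Fin (m + 1) → Fin n) ω => √(n : ℝ) * Z ω J) P :=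
    hi.comp (fun _ x => √(n : ℝ) * x) fun _ => by fun_prop
  have h1 : HasLaw (fun ω (J : Fin (m + 1) → Fin n) => √(n : ℝ) * Z ω J)
      (Measure.pi fun _ => gaussianReal 0 1) P := by
    refine ⟨aemeasurable_pi_lambda _ fun J => (hl' J).aemeasurable, ?_⟩
    rw [(iIndepFun_iff_map_fun_eq_pi_map fun J => (hl' J).aemeasurable).1 hi']
    simp_rw [(hl' _).map_eq]
  have hm : Measurable fun X : Tensor (m + 1) n => unfoldRows (WithLp.toLp 2 X) :=
    measurable_unfoldRows.comp (WithLp.measurable_toLp 2 _)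
  refine ⟨hm.comp_aemeasurable h1.aemeasurable, ?_⟩
  have h2 := AEMeasurable.map_map_of_aemeasurable (hm.aemeasurable (μ := P.map _)) h1.aemeasurable
  have h3 : P.map (fun ω => unfoldRows (WithLp.toLp 2 (√(n : ℝ) • Z ω))) =
    P.map ((fun X : Tensor (m + 1) n => unfoldRows (WithLp.toLp 2 X)) ∘
      (fun ω (J : Fin (m + 1) → Fin n) => √(n : ℝ) * Z ω J)) := rfl
  rw [h3, ← h2, h1.map_eq, ← map_unfoldRows_stdGaussian, ← map_pi_eq_stdGaussian,
    Measure.map_map measurable_unfoldRows (WithLp.measurable_toLp 2 _)]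
  rfl

/-- The power iteration step in terms of the product of the (normalized) noise with the query. -/
def stepMap (m : ℕ) {n : ℕ} (β : ℝ) (v u z : Vec n) : Vec n :=
  ‖(β * (inner ℝ u v) ^ m) • v + (√(n : ℝ))⁻¹ • z‖⁻¹ •
    ((β * (inner ℝ u v) ^ m) • v + (√(n : ℝ))⁻¹ • z)

theorem measurable_stepMap (β : ℝ) (v : Vec n) :
    Measurable fun p : Vec n × Vec n => stepMap m β v p.1 p.2 := by
  unfold stepMap
  fun_prop

theorem act_eq_rowMul (hn : 0 < n) (Z : Tensor (m + 1) n) (u : Vec n) :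
    act Z u = (√(n : ℝ))⁻¹ • rowMul (unfoldRows (WithLp.toLp 2 (√(n : ℝ) • Z))) (tensorPow m u) := by
  have : √(n : ℝ) ≠ 0 := by positivity
  rw [rowMul_unfoldRows, act_smul, smul_smul, inv_mul_cancel₀ this, one_smul]

theorem queryStates_eq_powerIter (hn : 0 < n) (β : ℝ) (u v : Vec n) (Z : Tensor (m + 1) n) (t : ℕ) :
    queryStates (tensorPow m) (stepMap m β v) u
      (unfoldRows (WithLp.toLp 2 (√(n : ℝ) • Z))) t = powerIter (spiked β v Z) u t := by
  induction t with
  | zero => rfl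
  | succ t ih =>
    simp only [queryStates, powerIter, ih, stepMap]
    rw [← act_eq_rowMul hn, act_spiked]

theorem IndepFun.comp_hasLaw {Ω Ω' α γ : Type*} [MeasurableSpace Ω] [MeasurableSpace Ω'] [MeasurableSpace α]
    [MeasurableSpace γ] {P : Measure Ω} {μ : Measure Ω'} [IsProbabilityMeasure P] {X : Ω → Ω'}
    (hX : HasLaw X μ P) {f : Ω' → α} {g : Ω' → γ} (hf : Measurable f) (hg : Measurable g)
    (h : IndepFun f g μ) : IndepFun (fun ω => f (X ω)) (fun ω => g (X ω)) P := by
  rw [← hX.map_eq] at h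
  have : IsProbabilityMeasure (P.map X) := Measure.isProbabilityMeasure_map hX.aemeasurable
  rw [indepFun_iff_map_prod_eq_prod_map_map hf.aemeasurable hg.aemeasurable,
    AEMeasurable.map_map_of_aemeasurable (hf.prodMk hg).aemeasurable hX.aemeasurable,
    AEMeasurable.map_map_of_aemeasurable hf.aemeasurable hX.aemeasurable,
    AEMeasurable.map_map_of_aemeasurable hg.aemeasurable hX.aemeasurable] at h
  exact (indepFun_iff_map_prod_eq_prod_map_map (hf.comp_aemeasurable hX.aemeasurable)
    (hg.comp_aemeasurable hX.aemeasurable)).2 h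

/-- Power iteration is the query algorithm with query map `tensorPow m` and update `stepMap`. The
condition on `T` says that the row space has room for `T` orthonormal directions, and
`inner_tensorPow` turns the Gram matrix of the queries into powers of overlaps. -/
theorem exists_powerIter_innovations {Ω : Type*} [MeasurableSpace Ω] {P : Measure Ω}
    [IsProbabilityMeasure P] (hn : 0 < n) {Z : Ω → Tensor (m + 1) n} (hZ : IsGaussianNoise P Z)
    (β : ℝ) (u v : Vec n) {T : ℕ} (hT : T ≤ n ^ m) :
    ∃ ξ : ℕ → Ω → Vec n, (∀ r < T, HasLaw (ξ r) (stdGaussian (Vec n)) P) ∧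
      (∀ s, AEMeasurable (fun ω => powerIter (spiked β v (Z ω)) u s) P) ∧
      (∀ s r, s ≤ r → r < T →
        IndepFun (fun ω => powerIter (spiked β v (Z ω)) u s) (ξ r) P) ∧
      ∀ ω, ∃ L : ℕ → ℕ → ℝ, (∀ t < T, 0 ≤ L t t) ∧
        (∀ s t, s ≤ t → t < T → (inner ℝ (powerIter (spiked β v (Z ω)) u s)
          (powerIter (spiked β v (Z ω)) u t)) ^ m = ∑ r ∈ Finset.range (s + 1), L s r * L t r) ∧
        ∀ t < T, act (spiked β v (Z ω)) (powerIter (spiked β v (Z ω)) u t) =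
          (β * (inner ℝ (powerIter (spiked β v (Z ω)) u t) v) ^ m) • v +
          (√(n : ℝ))⁻¹ • ∑ r ∈ Finset.range (t + 1), L t r • ξ r ω := by
  have hfin : T ≤ Module.finrank ℝ (EuclideanSpace ℝ (Fin m → Fin n)) := by simpa using hT
  have hX := hasLaw_unfoldRows hn hZ
  obtain ⟨ξ, h1, h2, h3⟩ := exists_innovations (ι := Fin n) (measurable_tensorPow (m := m) (n := n))
    (measurable_stepMap β v) u hfin
  have hqm : ∀ s, Measurable fun x => queryStates (tensorPow m) (stepMap m β v) u x s := by
    intro s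
    induction s with
    | zero => exact measurable_const
    | succ s ih =>
      have h4 := measurable_rowMul.comp (measurable_id.prodMk (measurable_tensorPow.comp ih))
      have h5 := (measurable_stepMap β v (m := m)).comp (ih.prodMk h4)
      simpa only [Function.comp_def, queryStates, id] using h5
  refine ⟨fun r ω => ξ r (unfoldRows (WithLp.toLp 2 (√(n : ℝ) • Z ω))), ?_, ?_, ?_, ?_⟩
  · intro r hr
    refine ⟨(h1 r hr).1.comp_aemeasurable hX.aemeasurable, ?_⟩
    rw [← (h1 r hr).2, ← hX.map_eq,
      AEMeasurable.map_map_of_aemeasurable (h1 r hr).1.aemeasurable hX.aemeasurable]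
    rfl
  · intro s
    simp_rw [← queryStates_eq_powerIter hn]
    exact (hqm s).comp_aemeasurable hX.aemeasurable
  · intro s r hsr hr
    have := IndepFun.comp_hasLaw hX (hqm s) (h1 r hr).1 (h2 s r hsr hr)
    simpa only [queryStates_eq_powerIter hn] using this
  · intro ω
    obtain ⟨L, hL1, hL2, hL3⟩ := h3 (unfoldRows (WithLp.toLp 2 (√(n : ℝ) • Z ω)))
    simp only [queryStates_eq_powerIter hn, inner_tensorPow] at hL2 hL3
    refine ⟨L, hL1, hL2, fun t ht => ?_⟩
    rw [act_spiked, act_eq_rowMul hn, hL3 t ht]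

end Tensors

/-! ### Gaussian tails and the typical event -/

section Tails

theorem gaussianReal_abs_gt_le {s : ℝ} (hs : 0 ≤ s) :
    gaussianReal 0 1 {x | s < |x|} ≤ ENNReal.ofReal (2 * Real.exp (-s ^ 2 / 2)) := by
  have h : HasSubgaussianMGF (fun x : ℝ => x) 1 (gaussianReal 0 1) :=
    ⟨fun t => integrable_exp_mul_gaussianReal t, fun t => by
      rw [mgf_fun_id_gaussianReal]; simp⟩
  have h1 := h.measure_ge_le hs
  have h2 := h.neg.measure_ge_le hs
  have hsub : {x : ℝ | s < |x|} ⊆ {x | s ≤ x} ∪ {x | s ≤ (-fun x : ℝ => x) x} := by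
    intro x hx
    rcases lt_abs.1 (show s < |x| from hx) with h | h
    · exact Or.inl h.le
    · exact Or.inr h.le
  refine (measure_mono hsub).trans ((measure_union_le _ _).trans ?_)
  rw [two_mul, ENNReal.ofReal_add (by positivity) (by positivity)]
  refine add_le_add ?_ ?_
  · rw [← ofReal_measureReal]
    exact ENNReal.ofReal_le_ofReal (by simpa using h1)
  · rw [← ofReal_measureReal]
    exact ENNReal.ofReal_le_ofReal (by simpa using h2)

variable {V : Type*} [NormedAddCommGroup V] [InnerProductSpace ℝ V] [FiniteDimensional ℝ V]
  [MeasurableSpace V] [BorelSpace V]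

theorem map_inner_stdGaussian {w : V} (hw : ‖w‖ = 1) :
    (stdGaussian V).map (fun x => inner ℝ x w) = gaussianReal 0 1 := by
  have hm : Measurable fun x : V => (inner ℝ x w : ℝ) := by fun_prop
  have : IsProbabilityMeasure ((stdGaussian V).map (fun x => (inner ℝ x w : ℝ))) :=
    Measure.isProbabilityMeasure_map hm.aemeasurable
  apply Measure.ext_of_charFun
  ext t
  rw [charFun_apply, integral_map hm.aemeasurable (by fun_prop)]
  have : ∀ x : V, inner ℝ (inner ℝ x w : ℝ) t = (inner ℝ x (t • w) : ℝ) := by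
    intro x
    simp [inner_smul_right]
  simp_rw [this]
  rw [← charFun_apply, charFun_stdGaussian, charFun_gaussianReal, norm_smul, hw]
  congr 1
  rw [mul_one, ← Complex.ofReal_pow, Real.norm_eq_abs, sq_abs]
  push_cast
  ring

theorem stdGaussian_abs_inner_gt_le {w : V} (hw : ‖w‖ ≤ 1) {s : ℝ} (hs : 0 ≤ s) :
    stdGaussian V {x | s < |inner ℝ x w|} ≤ ENNReal.ofReal (2 * Real.exp (-s ^ 2 / 2)) := by
  by_cases h0 : w = 0
  · simp [h0, hs.not_gt]
  have hw0 : 0 < ‖w‖ := norm_pos_iff.2 h0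
  have hu : ‖(‖w‖⁻¹ • w)‖ = 1 := by
    rw [norm_smul, norm_inv, norm_norm, inv_mul_cancel₀ hw0.ne']
  refine le_trans ?_ (gaussianReal_abs_gt_le hs)
  rw [← map_inner_stdGaussian hu, Measure.map_apply (by fun_prop)
    (measurableSet_lt measurable_const (by fun_prop))]
  refine measure_mono fun x (hx : s < |inner ℝ x w|) => hx.trans_le ?_
  beta_reduce
  rw [inner_smul_right, abs_mul, abs_inv, abs_norm]
  exact le_mul_of_one_le_left (abs_nonneg _) ((one_le_inv₀ hw0).2 hw)

/-- By independence and Fubini, `w` may be frozen; the tail bound is uniform over the unit ball. -/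
theorem measure_abs_inner_gt_le_of_indepFun {Ω : Type*} [MeasurableSpace Ω] {P : Measure Ω}
    [IsProbabilityMeasure P] {ξ w : Ω → V} (hξ : HasLaw ξ (stdGaussian V) P)
    (hw : AEMeasurable w P) (hw1 : ∀ ω, ‖w ω‖ ≤ 1) (h : IndepFun w ξ P) {s : ℝ} (hs : 0 ≤ s) :
    P {ω | s < |inner ℝ (ξ ω) (w ω)|} ≤ ENNReal.ofReal (2 * Real.exp (-s ^ 2 / 2)) := by
  have hS : MeasurableSet {p : V × V | s < |inner ℝ p.2 p.1|} :=
    measurableSet_lt measurable_const (by fun_prop)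
  have e1 : P {ω | s < |inner ℝ (ξ ω) (w ω)|} =
      P.map (fun ω => (w ω, ξ ω)) {p : V × V | s < |inner ℝ p.2 p.1|} := by
    rw [Measure.map_apply_of_aemeasurable (hw.prodMk hξ.aemeasurable) hS]
    rfl
  have : IsProbabilityMeasure (P.map w) := Measure.isProbabilityMeasure_map hw
  rw [e1, (indepFun_iff_map_prod_eq_prod_map_map hw hξ.aemeasurable).1 h, hξ.map_eq,
    Measure.prod_apply hS]
  have hae : ∀ᵐ a ∂(P.map w), ‖a‖ ≤ 1 := by
    rw [ae_map_iff hw (measurableSet_le (by fun_prop) measurable_const)]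
    exact Filter.Eventually.of_forall hw1
  calc _ ≤ ∫⁻ _, ENNReal.ofReal (2 * Real.exp (-s ^ 2 / 2)) ∂(P.map w) := by
        refine lintegral_mono_ae ?_
        filter_upwards [hae] with a ha
        exact stdGaussian_abs_inner_gt_le ha hs
    _ = _ := by simp

theorem integral_exp_mul_sq_gaussianReal {t : ℝ} (ht : t < 1 / 2) :
    ∫ x, Real.exp (t * x ^ 2) ∂(gaussianReal 0 1) = (√(1 - 2 * t))⁻¹ := by
  rw [integral_gaussianReal_eq_integral_smul one_ne_zero]
  have : ∀ x : ℝ, gaussianPDFReal 0 1 x • Real.exp (t * x ^ 2) =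
      (√(2 * Real.pi))⁻¹ * Real.exp (-(1 / 2 - t) * x ^ 2) := by
    intro x
    rw [gaussianPDFReal, smul_eq_mul, mul_assoc, ← Real.exp_add]
    simp only [NNReal.coe_one, mul_one, sub_zero]
    congr 2
    ring
  simp_rw [this]
  rw [integral_const_mul, integral_gaussian, ← Real.sqrt_inv, ← Real.sqrt_inv,
    ← Real.sqrt_mul (by positivity)]
  congr 1
  have : (1 : ℝ) - 2 * t ≠ 0 := by linarith
  have : (1 : ℝ) / 2 - t ≠ 0 := by linarith
  have := Real.pi_ne_zero
  field_simp

theorem mgf_norm_sq_stdGaussian (n : ℕ) {t : ℝ} (ht : t < 1 / 2) :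
    mgf (fun x : Vec n => ‖x‖ ^ 2) (stdGaussian (Vec n)) t = (√(1 - 2 * t))⁻¹ ^ n := by
  rw [mgf, ← map_pi_eq_stdGaussian, integral_map (by fun_prop) (by fun_prop)]
  have : ∀ x : Fin n → ℝ, Real.exp (t * ‖WithLp.toLp 2 x‖ ^ 2) = ∏ i, Real.exp (t * x i ^ 2) := by
    intro x
    rw [EuclideanSpace.real_norm_sq_eq, Finset.mul_sum, Real.exp_sum]
  simp_rw [this]
  rw [integral_fintype_prod_eq_prod (fun (_ : Fin n) (x : ℝ) => Real.exp (t * x ^ 2))]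
  simp [integral_exp_mul_sq_gaussianReal ht]

theorem integrable_exp_norm_sq_stdGaussian (n : ℕ) {t : ℝ} (ht : t < 1 / 2) :
    Integrable (fun x : Vec n => Real.exp (t * ‖x‖ ^ 2)) (stdGaussian (Vec n)) := by
  refine Integrable.of_integral_ne_zero ?_
  have := mgf_norm_sq_stdGaussian n ht
  rw [mgf] at this
  rw [this]
  have : 0 < 1 - 2 * t := by linarith
  positivity

/-- Chernoff at parameter 1/4: the bound e^(-n) 2^(n/2) is simplified through √2 ≤ e^(7/8). -/
theorem stdGaussian_norm_gt_le (n : ℕ) :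
    stdGaussian (Vec n) {x | 2 * √(n : ℝ) < ‖x‖} ≤ ENNReal.ofReal (Real.exp (-(n : ℝ) / 8)) := by
  have h := measure_ge_le_exp_mul_mgf (μ := stdGaussian (Vec n)) (X := fun x => ‖x‖ ^ 2)
    (4 * n) (t := 1 / 4) (by norm_num) (integrable_exp_norm_sq_stdGaussian n (by norm_num))
  rw [mgf_norm_sq_stdGaussian n (by norm_num)] at h
  have hsub : {x : Vec n | 2 * √(n : ℝ) < ‖x‖} ⊆ {x | (4 : ℝ) * n ≤ ‖x‖ ^ 2} := by
    intro x (hx : 2 * √(n : ℝ) < ‖x‖)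
    have h1 : (2 * √(n : ℝ)) ^ 2 ≤ ‖x‖ ^ 2 := by gcongr
    rw [mul_pow, Real.sq_sqrt (by positivity)] at h1
    simpa using (by linarith : (4 : ℝ) * n ≤ ‖x‖ ^ 2)
  refine (measure_mono hsub).trans ?_
  rw [← ofReal_measureReal]
  refine ENNReal.ofReal_le_ofReal (h.trans ?_)
  have hb : (√(1 - 2 * (1 / 4) : ℝ))⁻¹ ≤ Real.exp (7 / 8) := by
    have h1 : (1 : ℝ) / 2 ≤ √(1 - 2 * (1 / 4) : ℝ) := by
      apply Real.le_sqrt_of_sq_le; norm_num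
    have h2 : (7 / 8 : ℝ) + (7 / 8) ^ 2 / 2 + 1 ≤ Real.exp (7 / 8) := by
      have := Real.quadratic_le_exp_of_nonneg (x := 7 / 8) (by norm_num)
      linarith
    have h3 : (√(1 - 2 * (1 / 4) : ℝ))⁻¹ ≤ 2 := by
      rw [inv_le_comm₀ (by linarith) (by norm_num)]; linarith
    linarith
  calc Real.exp (-(1 / 4) * (4 * n)) * (√(1 - 2 * (1 / 4) : ℝ))⁻¹ ^ n
      ≤ Real.exp (-(1 / 4) * (4 * n)) * Real.exp (7 / 8) ^ n := by gcongr
    _ = Real.exp (-(n : ℝ) / 8) := by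
      rw [← Real.exp_nat_mul, ← Real.exp_add]; congr 1; ring

/-- Chernoff at parameter -2: the bound e^(n/2) 5^(-n/2) is simplified through e^(5/8) ≤ 2.2 ≤ √5.
-/
theorem stdGaussian_norm_lt_le (n : ℕ) :
    stdGaussian (Vec n) {x | ‖x‖ < √(n : ℝ) / 2} ≤ ENNReal.ofReal (Real.exp (-(n : ℝ) / 8)) := by
  have h := measure_le_le_exp_mul_mgf (μ := stdGaussian (Vec n)) (X := fun x => ‖x‖ ^ 2)
    (n / 4) (t := -2) (by norm_num) (integrable_exp_norm_sq_stdGaussian n (by norm_num))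
  rw [mgf_norm_sq_stdGaussian n (by norm_num)] at h
  have hsub : {x : Vec n | ‖x‖ < √(n : ℝ) / 2} ⊆ {x | ‖x‖ ^ 2 ≤ (n : ℝ) / 4} := by
    intro x (hx : ‖x‖ < √(n : ℝ) / 2)
    have h1 : ‖x‖ ^ 2 ≤ (√(n : ℝ) / 2) ^ 2 := by gcongr
    rw [div_pow, Real.sq_sqrt (by positivity)] at h1
    simpa using (by linarith : ‖x‖ ^ 2 ≤ (n : ℝ) / 4)
  refine (measure_mono hsub).trans ?_
  rw [← ofReal_measureReal]
  refine ENNReal.ofReal_le_ofReal (h.trans ?_)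
  have hb : (√(1 - 2 * (-2) : ℝ))⁻¹ ≤ Real.exp (-(5 / 8)) := by
    rw [Real.exp_neg]
    gcongr
    have h1 : (2.2 : ℝ) ≤ √(1 - 2 * (-2) : ℝ) := by
      apply Real.le_sqrt_of_sq_le; norm_num
    refine le_trans ?_ h1
    have h2 : Real.exp (5 / 8) ^ 8 ≤ 2.2 ^ 8 := by
      rw [← Real.exp_nat_mul]
      have h3 := Real.exp_one_lt_d9.le
      have h4 : Real.exp (((8 : ℕ) : ℝ) * (5 / 8)) = Real.exp 1 ^ 5 := by
        rw [← Real.exp_nat_mul]; norm_num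
      rw [h4]
      calc Real.exp 1 ^ 5 ≤ 2.7182818286 ^ 5 := by gcongr
        _ ≤ _ := by norm_num
    exact le_of_pow_le_pow_left₀ (by norm_num) (by norm_num) h2
  calc Real.exp (-(-2) * (n / 4)) * (√(1 - 2 * (-2) : ℝ))⁻¹ ^ n
      ≤ Real.exp (-(-2) * (n / 4)) * Real.exp (-(5 / 8)) ^ n := by gcongr
    _ = Real.exp (-(n : ℝ) / 8) := by
      rw [← Real.exp_nat_mul, ← Real.exp_add]; congr 1; ring

/-- The innovations `ξ` and the iterates `u` up to time `T` satisfy the typical bounds at scale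
`s`. -/
structure TypicalAt {n : ℕ} (T : ℕ) (v : Vec n) (s : ℝ) (ξ u : ℕ → Vec n) : Prop where
  spike : ∀ r < T, |inner ℝ (ξ r) v| ≤ s
  past : ∀ r < T, ∀ q ≤ r, |inner ℝ (ξ r) (u q)| ≤ s
  norm_le : ∀ r < T, ‖ξ r‖ ≤ 2 * √(n : ℝ)
  le_norm : ∀ r < T, √(n : ℝ) / 2 ≤ ‖ξ r‖

theorem HasLaw.measure_le {Ω Ω' : Type*} [MeasurableSpace Ω] [MeasurableSpace Ω'] {P : Measure Ω}
    {μ : Measure Ω'} {X : Ω → Ω'} (hX : HasLaw X μ P) (A : Set Ω') :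
    P {ω | X ω ∈ A} ≤ μ A := by
  rw [← hX.map_eq]
  exact Measure.le_map_apply hX.aemeasurable A

theorem measure_not_typicalAt_le {Ω : Type*} [MeasurableSpace Ω] {P : Measure Ω}
    [IsProbabilityMeasure P] {n T : ℕ} {v : Vec n} (hv : ‖v‖ = 1) {ξ u : ℕ → Ω → Vec n}
    (hξ : ∀ r < T, HasLaw (ξ r) (stdGaussian (Vec n)) P) (hu : ∀ q, AEMeasurable (u q) P)
    (hu1 : ∀ q ω, ‖u q ω‖ ≤ 1) (hind : ∀ q r, q ≤ r → r < T → IndepFun (u q) (ξ r) P)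
    {s : ℝ} (hs : 0 ≤ s) :
    P {ω | ¬ TypicalAt T v s (fun r => ξ r ω) (fun q => u q ω)} ≤
      ENNReal.ofReal (4 * (T + 1) ^ 2 * (Real.exp (-s ^ 2 / 2) + Real.exp (-(n : ℝ) / 8))) := by
  set a := Real.exp (-s ^ 2 / 2)
  set b := Real.exp (-(n : ℝ) / 8)
  have ha : 0 < a := Real.exp_pos _
  have hb : 0 < b := Real.exp_pos _
  -- The failures caused by innovation `r`. Only pairs with `q ≤ r` enter, as independence is
  -- available only for these.
  let A : ℕ → Set Ω := fun r => {ω | s < |inner ℝ (ξ r ω) v|} ∪ ({ω | 2 * √(n : ℝ) < ‖ξ r ω‖} ∪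
    ({ω | ‖ξ r ω‖ < √(n : ℝ) / 2} ∪
      ⋃ q ∈ Finset.range T, if q ≤ r then {ω | s < |inner ℝ (ξ r ω) (u q ω)|} else ∅))
  have hA : ∀ r < T, P (A r) ≤ ENNReal.ofReal (4 * (T + 1) * (a + b)) := by
    intro r hr
    have h1 : P {ω | s < |inner ℝ (ξ r ω) v|} ≤ ENNReal.ofReal (2 * a) :=
      (HasLaw.measure_le (hξ r hr) {x | s < |inner ℝ x v|}).trans
        (stdGaussian_abs_inner_gt_le hv.le hs)
    have h2 : P {ω | 2 * √(n : ℝ) < ‖ξ r ω‖} ≤ ENNReal.ofReal b :=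
      (HasLaw.measure_le (hξ r hr) {x | 2 * √(n : ℝ) < ‖x‖}).trans (stdGaussian_norm_gt_le n)
    have h3 : P {ω | ‖ξ r ω‖ < √(n : ℝ) / 2} ≤ ENNReal.ofReal b :=
      (HasLaw.measure_le (hξ r hr) {x | ‖x‖ < √(n : ℝ) / 2}).trans (stdGaussian_norm_lt_le n)
    have h4 : P (⋃ q ∈ Finset.range T, if q ≤ r then {ω | s < |inner ℝ (ξ r ω) (u q ω)|} else ∅) ≤
        ENNReal.ofReal (T * (2 * a)) := by
      refine (measure_biUnion_finset_le _ _).trans ?_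
      calc _ ≤ ∑ q ∈ Finset.range T, ENNReal.ofReal (2 * a) := by
            refine Finset.sum_le_sum fun q _ => ?_
            split_ifs with h
            · exact measure_abs_inner_gt_le_of_indepFun (hξ r hr) (hu q) (hu1 q) (hind q r h hr) hs
            · simp
        _ = _ := by
          rw [Finset.sum_const, Finset.card_range, nsmul_eq_mul,
            ENNReal.ofReal_mul (by positivity : (0 : ℝ) ≤ T), ENNReal.ofReal_natCast]
    calc P (A r) ≤ ENNReal.ofReal (2 * a) + (ENNReal.ofReal b + (ENNReal.ofReal b +
          ENNReal.ofReal (T * (2 * a)))) :=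
          (measure_union_le _ _).trans (add_le_add h1 ((measure_union_le _ _).trans
            (add_le_add h2 ((measure_union_le _ _).trans (add_le_add h3 h4)))))
      _ = ENNReal.ofReal (2 * a + (b + (b + T * (2 * a)))) := by
        rw [ENNReal.ofReal_add, ENNReal.ofReal_add, ENNReal.ofReal_add] <;> positivity
      _ ≤ _ := by
        apply ENNReal.ofReal_le_ofReal
        have : (0 : ℝ) ≤ T := by positivity
        nlinarith [mul_nonneg this ha.le, mul_nonneg this hb.le]
  have hsub : {ω | ¬ TypicalAt T v s (fun r => ξ r ω) (fun q => u q ω)} ⊆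
      ⋃ r ∈ Finset.range T, A r := by
    intro ω hω
    by_contra hcon
    apply hω
    simp only [Set.mem_iUnion, not_exists, Finset.mem_range] at hcon
    have hmem : ∀ r < T, ω ∉ A r := fun r hr h => hcon r hr h
    simp only [A, Set.mem_union, not_or] at hmem
    refine ⟨fun r hr => not_lt.1 (hmem r hr).1, fun r hr q hq => ?_,
      fun r hr => not_lt.1 (hmem r hr).2.1, fun r hr => not_lt.1 (hmem r hr).2.2.1⟩
    by_contra hlt
    refine (hmem r hr).2.2.2 ?_
    simp only [Set.mem_iUnion, Finset.mem_range]
    exact ⟨q, by omega, by rw [if_pos hq]; exact not_le.1 hlt⟩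
  refine (measure_mono hsub).trans ((measure_biUnion_finset_le _ _).trans ?_)
  calc _ ≤ ∑ r ∈ Finset.range T, ENNReal.ofReal (4 * (T + 1) * (a + b)) :=
        Finset.sum_le_sum fun r hr => hA r (Finset.mem_range.1 hr)
    _ = ENNReal.ofReal (T * (4 * (T + 1) * (a + b))) := by
      rw [Finset.sum_const, Finset.card_range, nsmul_eq_mul,
        ENNReal.ofReal_mul (by positivity : (0 : ℝ) ≤ T), ENNReal.ofReal_natCast]
    _ ≤ _ := by
      apply ENNReal.ofReal_le_ofReal
      have h1 : (0 : ℝ) ≤ 4 * (T + 1) * (a + b) := by positivity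
      nlinarith

end Tails

/-! ### Deterministic control of overlaps and Cholesky coefficients -/

section Overlaps

/-- The entries of a row of a Cholesky factor whose Gram entries are at most `M`. -/
theorem cholesky_row_le {L : ℕ → ℕ → ℝ} {t : ℕ} {M : ℝ}
    (hdiag : ∀ q < t, 1 / 2 ≤ L q q)
    (hone : ∀ q < t, ∑ r ∈ Finset.range (q + 1), L q r * L q r = 1)
    (hM : ∀ q < t, |∑ r ∈ Finset.range (q + 1), L q r * L t r| ≤ M) :
    ∀ q < t, |L t q| ≤ 2 * 3 ^ q * M := by
  intro q
  induction q using Nat.strong_induction_on with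
  | _ q ih =>
  intro hq
  have hle : ∀ r < q, |L q r| ≤ 1 := by
    intro r hr
    have h1 : L q r * L q r ≤ ∑ r ∈ Finset.range (q + 1), L q r * L q r :=
      Finset.single_le_sum (f := fun r => L q r * L q r) (fun i _ => mul_self_nonneg _)
        (Finset.mem_range.2 (by omega))
    rw [hone q hq] at h1
    exact abs_le_one_iff_mul_self_le_one.2 h1
  have h2 := hM q hq
  rw [Finset.sum_range_succ] at h2
  -- Forward substitution: the earlier entries contribute (3^q - 1) M and the Gram entry M. Dividing
  -- the total 3^q M by a diagonal entry at least 1/2 closes the induction.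
  have hgeom : ∑ r ∈ Finset.range q, 2 * (3 : ℝ) ^ r * M = (3 ^ q - 1) * M := by
    rw [← Finset.sum_mul, ← Finset.mul_sum, geom_sum_eq (by norm_num)]
    ring
  have h3 : |∑ r ∈ Finset.range q, L q r * L t r| ≤ (3 ^ q - 1) * M := by
    rw [← hgeom]
    refine (Finset.abs_sum_le_sum_abs _ _).trans (Finset.sum_le_sum fun r hr => ?_)
    have hr' := Finset.mem_range.1 hr
    rw [abs_mul]
    calc |L q r| * |L t r| ≤ 1 * |L t r| := by gcongr; exact hle r hr'
      _ ≤ _ := by rw [one_mul]; exact ih r hr' (hr'.trans hq)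
  have h4 : |L q q * L t q| ≤ M + (3 ^ q - 1) * M := by
    have : L q q * L t q = (∑ r ∈ Finset.range q, L q r * L t r + L q q * L t q) -
      ∑ r ∈ Finset.range q, L q r * L t r := by ring
    rw [this]
    exact (abs_sub _ _).trans (add_le_add h2 h3)
  have h5 := hdiag q hq
  rw [abs_mul, abs_of_nonneg (by linarith)] at h4
  nlinarith [abs_nonneg (L t q)]

/-- The recursive upper bound on the overlaps of the iterates with the spike and with the past. -/
def overlapBound (m : ℕ) (K b s α : ℝ) : ℕ → ℝ
  | 0 => α
  | t + 1 => K * (b * overlapBound m K b s α t ^ m + s)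

theorem overlapBound_nonneg {m : ℕ} {K b s α : ℝ} (hK : 0 ≤ K) (hb : 0 ≤ b) (hs : 0 ≤ s)
    (hα : 0 ≤ α) (t : ℕ) : 0 ≤ overlapBound m K b s α t := by
  induction t with
  | zero => exact hα
  | succ t ih => unfold overlapBound; positivity

/-- Up to a constant, (η^t α + s)^m splits into two powers. The hypotheses give b (η^t α)^m ≤
η^(t+1) α and b s^m ≤ s, so each step gains a factor η on the initial overlap while the level s is
kept. The constant grows with `t` but never depends on `b`, `s`, `α`, `η`. -/
theorem exists_overlapBound_le {m : ℕ} (hm : 1 ≤ m) {K : ℝ} (hK : 1 ≤ K) (T : ℕ) :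
    ∃ C : ℝ, 1 ≤ C ∧ ∀ b s α η : ℝ, 0 ≤ b → 0 ≤ s → 0 ≤ α → 0 ≤ η → η ≤ 1 →
      b * α ^ (m - 1) ≤ η → b * s ^ (m - 1) ≤ 1 → ∀ t ≤ T,
      overlapBound m K b s α t ≤ C * (η ^ t * α + s) ∧
      b * overlapBound m K b s α t ^ m ≤ C * (η ^ (t + 1) * α + s) := by
  have step : ∀ C b s α η : ℝ, 1 ≤ C → 0 ≤ b → 0 ≤ s → 0 ≤ α → 0 ≤ η → η ≤ 1 →
      b * α ^ (m - 1) ≤ η → b * s ^ (m - 1) ≤ 1 → ∀ t,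
      overlapBound m K b s α t ≤ C * (η ^ t * α + s) →
      b * overlapBound m K b s α t ^ m ≤ (C ^ m * 2 ^ m) * (η ^ (t + 1) * α + s) := by
    intro C b s α η hC hb hs hα hη hη1 h1 h2 t ht
    have h0 := overlapBound_nonneg (m := m) (by linarith : 0 ≤ K) hb hs hα t
    have e1 : b * α ^ m ≤ η * α := by
      calc b * α ^ m = b * α ^ (m - 1) * α := by
            rw [mul_assoc, ← pow_succ, Nat.sub_add_cancel hm]
        _ ≤ _ := by gcongr
    have e2 : b * s ^ m ≤ s := by
      calc b * s ^ m = b * s ^ (m - 1) * s := by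
            rw [mul_assoc, ← pow_succ, Nat.sub_add_cancel hm]
        _ ≤ 1 * s := by gcongr
        _ = s := one_mul s
    have e3 : (η ^ t) ^ m ≤ η ^ t := pow_le_of_le_one (by positivity) (pow_le_one₀ hη hη1) (by omega)
    calc b * overlapBound m K b s α t ^ m ≤ b * (C * (η ^ t * α + s)) ^ m := by gcongr
      _ = C ^ m * (b * (η ^ t * α + s) ^ m) := by rw [mul_pow]; ring
      _ ≤ C ^ m * (b * (2 ^ (m - 1) * ((η ^ t * α) ^ m + s ^ m))) := by
        gcongr
        exact add_pow_le (by positivity) hs m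
      _ ≤ C ^ m * (b * (2 ^ m * ((η ^ t * α) ^ m + s ^ m))) := by
        gcongr
        · norm_num
        · omega
      _ = C ^ m * 2 ^ m * ((η ^ t) ^ m * (b * α ^ m) + b * s ^ m) := by rw [mul_pow]; ring
      _ ≤ C ^ m * 2 ^ m * (η ^ t * (η * α) + s) := by gcongr
      _ = _ := by rw [pow_succ]; ring
  have main : ∀ t, ∃ C : ℝ, 1 ≤ C ∧ ∀ b s α η : ℝ, 0 ≤ b → 0 ≤ s → 0 ≤ α → 0 ≤ η → η ≤ 1 →
      b * α ^ (m - 1) ≤ η → b * s ^ (m - 1) ≤ 1 →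
      overlapBound m K b s α t ≤ C * (η ^ t * α + s) := by
    intro t
    induction t with
    | zero =>
      exact ⟨1, le_rfl, fun b s α η _ hs _ _ _ _ _ => by simp [overlapBound, hs]⟩
    | succ t ih =>
      obtain ⟨C, hC, h⟩ := ih
      refine ⟨K * (C ^ m * 2 ^ m + 1), ?_, ?_⟩
      · have : 0 ≤ C ^ m * 2 ^ m := by positivity
        nlinarith
      · intro b s α η hb hs hα hη hη1 h1 h2
        have h3 := step C b s α η hC hb hs hα hη hη1 h1 h2 t (h b s α η hb hs hα hη hη1 h1 h2)
        have h4 : 0 ≤ η ^ (t + 1) * α := by positivity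
        calc overlapBound m K b s α (t + 1) = K * (b * overlapBound m K b s α t ^ m + s) := rfl
          _ ≤ K * ((C ^ m * 2 ^ m) * (η ^ (t + 1) * α + s) + (η ^ (t + 1) * α + s)) := by
            gcongr; linarith
          _ = _ := by ring
  choose C hC hCb using main
  have hpos : ∀ t, 0 ≤ C t ^ m * 2 ^ m := fun t => by have := hC t; positivity
  have hCp : ∀ t, C t ≤ C t ^ m * 2 ^ m := fun t =>
    (le_self_pow₀ (hC t) (by omega)).trans
      (le_mul_of_one_le_right (by have := hC t; positivity) (one_le_pow₀ (by norm_num)))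
  -- The sum dominates the constants of both estimates at all times up to `T`.
  refine ⟨∑ t ∈ Finset.range (T + 1), C t ^ m * 2 ^ m, ?_, ?_⟩
  · exact ((hC 0).trans (hCp 0)).trans (Finset.single_le_sum
      (f := fun t => C t ^ m * 2 ^ m) (fun i _ => hpos i) (Finset.mem_range.2 (by omega)))
  · intro b s α η hb hs hα hη hη1 h1 h2 t ht
    have h3 := hCb t b s α η hb hs hα hη hη1 h1 h2
    have h4 : C t ^ m * 2 ^ m ≤ ∑ t ∈ Finset.range (T + 1), C t ^ m * 2 ^ m :=
      Finset.single_le_sum (f := fun t => C t ^ m * 2 ^ m) (fun i _ => hpos i)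
        (Finset.mem_range.2 (by omega))
    refine ⟨h3.trans ?_, (step (C t) b s α η (hC t) hb hs hα hη hη1 h1 h2 t h3).trans ?_⟩
    · gcongr
      exact (hCp t).trans h4
    · gcongr

/-- Iterates which solve the power iteration in terms of innovations `ξ` with Cholesky
coefficients `L`. -/
structure IsInnovationIteration {n : ℕ} (m T : ℕ) (β : ℝ) (v : Vec n) (ξ u y : ℕ → Vec n)
    (L : ℕ → ℕ → ℝ) : Prop where
  diag_nonneg : ∀ t < T, 0 ≤ L t t
  gram : ∀ s t, s ≤ t → t < T →
    (inner ℝ (u s) (u t)) ^ m = ∑ r ∈ Finset.range (s + 1), L s r * L t r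
  step : ∀ t < T, y t = (β * (inner ℝ (u t) v) ^ m) • v +
    (√(n : ℝ))⁻¹ • ∑ r ∈ Finset.range (t + 1), L t r • ξ r
  succ : ∀ t, u (t + 1) = ‖y t‖⁻¹ • y t

variable {n m T : ℕ} {β : ℝ} {v : Vec n} {ξ u y : ℕ → Vec n} {L : ℕ → ℕ → ℝ}

/-- One row of the Cholesky factor of a power iteration with small overlaps. -/
theorem IsInnovationIteration.row_bounds (h : IsInnovationIteration m T β v ξ u y L)
    {D M : ℝ} (hD : D = 2 * 3 ^ T) {t : ℕ} (ht : t < T) (hM0 : 0 ≤ M)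
    (hM : 1 ≤ t → 64 * (T + 1) * D ^ 2 * M ≤ 1)
    (hunit : ∀ q ≤ t, ‖u q‖ = 1) (hdiag : ∀ q < t, 1 / 2 ≤ L q q)
    (hov : ∀ q < t, |inner ℝ (u q) (u t)| ^ m ≤ M) :
    (∀ q < t, |L t q| ≤ D * M) ∧ 1 / 2 ≤ L t t ∧ (∀ q ≤ t, |L t q| ≤ 1) ∧
      1 - L t t ≤ T * D ^ 2 * M ^ 2 := by
  have hD1 : 1 ≤ D := by
    rw [hD]; have : (1 : ℝ) ≤ 3 ^ T := one_le_pow₀ (by norm_num)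
    linarith
  have hone : ∀ q ≤ t, ∑ r ∈ Finset.range (q + 1), L q r * L q r = 1 := by
    intro q hq
    rw [← h.gram q q le_rfl (by omega), real_inner_self_eq_norm_sq, hunit q hq]
    simp
  have hrow : ∀ q < t, |L t q| ≤ D * M := by
    intro q hq
    refine (cholesky_row_le (M := M) hdiag (fun q hq => hone q hq.le) (fun q hq => ?_) q hq).trans ?_
    · rw [← h.gram q t hq.le ht, abs_pow]
      exact hov q hq
    · rw [hD]
      gcongr
      · norm_num
      · omega
  have hle : ∀ q ≤ t, |L t q| ≤ 1 := by
    intro r hr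
    have h1 : L t r * L t r ≤ ∑ r ∈ Finset.range (t + 1), L t r * L t r :=
      Finset.single_le_sum (f := fun r => L t r * L t r) (fun i _ => mul_self_nonneg _)
        (Finset.mem_range.2 (by omega))
    rw [hone t le_rfl] at h1
    exact abs_le_one_iff_mul_self_le_one.2 h1
  have hsum : ∑ r ∈ Finset.range t, L t r * L t r ≤ T * D ^ 2 * M ^ 2 := by
    calc ∑ r ∈ Finset.range t, L t r * L t r ≤ ∑ r ∈ Finset.range t, (D * M) ^ 2 := by
          refine Finset.sum_le_sum fun r hr => ?_
          have h1 := hrow r (Finset.mem_range.1 hr)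
          have h2 : |L t r| * |L t r| = L t r * L t r := abs_mul_abs_self _
          nlinarith [abs_nonneg (L t r)]
      _ = t * (D * M) ^ 2 := by simp
      _ ≤ T * (D * M) ^ 2 := by gcongr
      _ = _ := by ring
  have hsq : L t t * L t t = 1 - ∑ r ∈ Finset.range t, L t r * L t r := by
    have := hone t le_rfl
    rw [Finset.sum_range_succ] at this
    linarith
  have h0 := h.diag_nonneg t ht
  have h1 := (abs_le.1 (hle t le_rfl)).2
  refine ⟨hrow, ?_, hle, by nlinarith⟩
  -- The first row has no past, so `M` need not be small there; the initial overlap has not yet been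
  -- contracted.
  rcases Nat.eq_zero_or_pos t with rfl | htpos
  · simp at hsq
    nlinarith
  · have h2 := hM htpos
    have hM1 : M ≤ 1 := by
      have : (1 : ℝ) ≤ 64 * (T + 1) * D ^ 2 := by
        have h3 : (0 : ℝ) ≤ T := by positivity
        nlinarith
      nlinarith
    have h3 : T * D ^ 2 * M ^ 2 ≤ 1 / 64 := by
      have h4 : (0 : ℝ) ≤ T := by positivity
      have h5 : (0 : ℝ) ≤ D ^ 2 * M := by positivity
      have h6 : (T : ℝ) * D ^ 2 * M ^ 2 ≤ T * D ^ 2 * M := by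
        have : M ^ 2 ≤ M := by nlinarith
        gcongr
      nlinarith
    nlinarith

/-- A simultaneous induction. Small past overlaps make the Cholesky row close to its diagonal, so
the newest innovation dominates and keeps ‖y t‖ bounded below. Dividing by this norm then bounds all
new overlaps by the next value of the recursion. -/
theorem IsInnovationIteration.overlaps_le (h : IsInnovationIteration m T β v ξ u y L)
    (hn : 0 < n) (hv : ‖v‖ = 1) (hu0 : ‖u 0‖ = 1) {s : ℝ} (hs : 0 ≤ s)
    (htyp : TypicalAt T v s ξ u) {D K : ℝ} (hD : D = 2 * 3 ^ T) (hK : K = 32 * (T + 1) * D)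
    (hβ : 1 ≤ |β|) {B : ℕ → ℝ}
    (hB : ∀ t, B t = overlapBound m K |β| (s / √(n : ℝ)) |inner ℝ (u 0) v| t)
    (hB1 : ∀ t < T, 1 ≤ t → 64 * (T + 1) * D ^ 2 * B t ^ m ≤ 1)
    (hB2 : ∀ t < T, 32 * (|β| * B t ^ m) ≤ 1) (t : ℕ) (ht : t ≤ T) :
    (∀ q ≤ t, ‖u q‖ = 1) ∧ |inner ℝ (u t) v| ≤ B t ∧ (∀ q < t, |inner ℝ (u q) (u t)| ≤ B t) ∧
      (∀ q < t, 1 / 2 ≤ L q q) ∧ ∀ q < t, 1 / 8 ≤ ‖y q‖ := by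
  have hD1 : 1 ≤ D := by
    rw [hD]; have : (1 : ℝ) ≤ 3 ^ T := one_le_pow₀ (by norm_num)
    linarith
  have hT0 : (0 : ℝ) ≤ T := by positivity
  have hsn : 0 < √(n : ℝ) := by positivity
  have hB0 : ∀ t, 0 ≤ B t := fun t => by
    rw [hB]
    exact overlapBound_nonneg (by rw [hK]; positivity) (abs_nonneg _) (by positivity)
      (abs_nonneg _) t
  induction t with
  | zero =>
    refine ⟨fun q hq => ?_, by rw [hB]; exact le_rfl, fun q hq => absurd hq (by omega),
      fun q hq => absurd hq (by omega), fun q hq => absurd hq (by omega)⟩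
    obtain rfl : q = 0 := by omega
    exact hu0
  | succ t ih =>
    have htT : t < T := by omega
    obtain ⟨hunit, hav, hov, hdiag, hy⟩ := ih htT.le
    set M := B t ^ m with hM
    have hM0 : 0 ≤ M := pow_nonneg (hB0 t) m
    obtain ⟨hrow, htt, hrow1, -⟩ := h.row_bounds hD htT hM0 (hB1 t htT) hunit hdiag
      (fun q hq => pow_le_pow_left₀ (abs_nonneg _) (hov q hq) m)
    have hsig : |β * inner ℝ (u t) v ^ m| ≤ |β| * M := by
      rw [abs_mul, abs_pow]
      exact mul_le_mul_of_nonneg_left (pow_le_pow_left₀ (abs_nonneg _) hav m) (abs_nonneg _)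
    have hsig1 := hB2 t htT
    rw [← hM] at hsig1
    have hpast : ‖∑ r ∈ Finset.range t, L t r • ξ r‖ ≤ √(n : ℝ) / 32 := by
      rcases Nat.eq_zero_or_pos t with rfl | htpos
      · simp only [Finset.range_zero, Finset.sum_empty, norm_zero]
        positivity
      · have h1 := hB1 t htT htpos
        rw [← hM] at h1
        calc ‖∑ r ∈ Finset.range t, L t r • ξ r‖ ≤ ∑ r ∈ Finset.range t, (D * M) * (2 * √(n : ℝ)) := by
              refine (norm_sum_le _ _).trans (Finset.sum_le_sum fun r hr => ?_)
              have hr' := Finset.mem_range.1 hr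
              rw [norm_smul, Real.norm_eq_abs]
              exact mul_le_mul (hrow r hr') (htyp.norm_le r (by omega)) (norm_nonneg _)
                (by positivity)
          _ = t * (D * M) * (2 * √(n : ℝ)) := by simp; ring
          _ ≤ T * (D * M) * (2 * √(n : ℝ)) := by gcongr
          _ ≤ (1 / 64) * (2 * √(n : ℝ)) := by
            gcongr
            have h2 : D * M ≤ D ^ 2 * M := by
              gcongr; nlinarith
            have h3 : 0 ≤ D ^ 2 * M := by positivity
            nlinarith
          _ = _ := by ring
    -- The newest innovation contributes at least 1/4; signal and past contribute at most 1/32 each.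
    have hylow : 1 / 8 ≤ ‖y t‖ := by
      have e1 : ‖L t t • ξ t‖ ≥ √(n : ℝ) / 4 := by
        rw [norm_smul, Real.norm_eq_abs, abs_of_nonneg (by linarith)]
        have := htyp.le_norm t htT
        nlinarith
      have e2 : ‖(β * inner ℝ (u t) v ^ m) • v‖ ≤ 1 / 32 := by
        rw [norm_smul, hv, mul_one, Real.norm_eq_abs]
        linarith
      have e3 : ‖(√(n : ℝ))⁻¹ • ∑ r ∈ Finset.range t, L t r • ξ r‖ ≤ 1 / 32 := by
        rw [norm_smul, norm_inv, Real.norm_of_nonneg hsn.le]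
        calc _ ≤ (√(n : ℝ))⁻¹ * (√(n : ℝ) / 32) := by gcongr
          _ = _ := by field_simp
      have e4 : ‖(√(n : ℝ))⁻¹ • L t t • ξ t‖ ≥ 1 / 4 := by
        rw [norm_smul, norm_inv, Real.norm_of_nonneg hsn.le]
        calc _ ≥ (√(n : ℝ))⁻¹ * (√(n : ℝ) / 4) := by gcongr
          _ = _ := by field_simp
      have e5 : (√(n : ℝ))⁻¹ • L t t • ξ t = y t - (β * inner ℝ (u t) v ^ m) • v -
          (√(n : ℝ))⁻¹ • ∑ r ∈ Finset.range t, L t r • ξ r := by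
        rw [h.step t htT, Finset.sum_range_succ, smul_add]
        abel
      have e6 := norm_sub_le (y t - (β * inner ℝ (u t) v ^ m) • v)
        ((√(n : ℝ))⁻¹ • ∑ r ∈ Finset.range t, L t r • ξ r)
      have e7 := norm_sub_le (y t) ((β * inner ℝ (u t) v ^ m) • v)
      rw [← e5] at e6
      linarith
    have hy0 : 0 < ‖y t‖ := by linarith
    have hyinv : ‖y t‖⁻¹ ≤ 8 := by
      rw [inv_le_comm₀ hy0 (by norm_num)]; linarith
    have hunit' : ‖u (t + 1)‖ = 1 := by
      rw [h.succ, norm_smul, norm_inv, norm_norm, inv_mul_cancel₀ hy0.ne']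
    have hinner : ∀ z : Vec n, inner ℝ (u (t + 1)) z = ‖y t‖⁻¹ *
        (β * inner ℝ (u t) v ^ m * inner ℝ v z +
          (√(n : ℝ))⁻¹ * ∑ r ∈ Finset.range (t + 1), L t r * inner ℝ (ξ r) z) := by
      intro z
      rw [h.succ, h.step t htT, real_inner_smul_left, inner_add_left, real_inner_smul_left,
        real_inner_smul_left, sum_inner]
      simp_rw [real_inner_smul_left]
    -- One estimate for both kinds of overlap, with `z = v` or `z` an earlier iterate. The condition
    -- 1 ≤ |β| absorbs the past coefficients `M` into the signal term |β| `M`, and `K` collects the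
    -- constants.
    have hgen : ∀ z : Vec n, ‖z‖ ≤ 1 →
        (∀ r ≤ t, |L t r * inner ℝ (ξ r) z| ≤ s + D * M * (2 * √(n : ℝ))) →
        |inner ℝ (u (t + 1)) z| ≤ B (t + 1) := by
      intro z hz hr
      have hvz : |inner ℝ v z| ≤ 1 := by
        refine (abs_real_inner_le_norm _ _).trans ?_
        rw [hv, one_mul]; exact hz
      have h1 : |β * inner ℝ (u t) v ^ m * inner ℝ v z| ≤ |β| * M := by
        rw [abs_mul]
        calc _ ≤ (|β| * M) * 1 := by gcongr
          _ = _ := mul_one _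
      have h2 : |∑ r ∈ Finset.range (t + 1), L t r * inner ℝ (ξ r) z| ≤
          T * (s + D * M * (2 * √(n : ℝ))) := by
        calc _ ≤ ∑ r ∈ Finset.range (t + 1), (s + D * M * (2 * √(n : ℝ))) :=
              (Finset.abs_sum_le_sum_abs _ _).trans (Finset.sum_le_sum fun r hr' =>
                hr r (by have := Finset.mem_range.1 hr'; omega))
          _ = ((t + 1 : ℕ) : ℝ) * (s + D * M * (2 * √(n : ℝ))) := by simp; ring
          _ ≤ _ := by gcongr
      have h3 : |(√(n : ℝ))⁻¹ * ∑ r ∈ Finset.range (t + 1), L t r * inner ℝ (ξ r) z| ≤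
          T * (s / √(n : ℝ)) + 2 * T * D * M := by
        rw [abs_mul, abs_inv, abs_of_pos hsn]
        calc _ ≤ (√(n : ℝ))⁻¹ * (T * (s + D * M * (2 * √(n : ℝ)))) := by gcongr
          _ = _ := by field_simp
      have hbM : M ≤ |β| * M := le_mul_of_one_le_left hM0 hβ
      have hs' : 0 ≤ s / √(n : ℝ) := by positivity
      rw [hinner, abs_mul, abs_inv, abs_norm]
      calc ‖y t‖⁻¹ * |_| ≤ 8 * (|β| * M + (T * (s / √(n : ℝ)) + 2 * T * D * M)) := by
            gcongr
            exact (abs_add_le _ _).trans (add_le_add h1 h3)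
        _ ≤ 8 * (|β| * M + (T * (s / √(n : ℝ)) + 2 * T * D * (|β| * M))) := by gcongr
        _ ≤ K * (|β| * M + s / √(n : ℝ)) := by
          rw [hK]
          have h4 : 0 ≤ |β| * M := by positivity
          have h5 : 0 ≤ D * (|β| * M) := by positivity
          have h6 : |β| * M ≤ D * (|β| * M) := le_mul_of_one_le_left h4 hD1
          have h7 : s / √(n : ℝ) ≤ D * (s / √(n : ℝ)) := le_mul_of_one_le_left hs' hD1
          nlinarith [mul_nonneg hT0 h5, mul_nonneg hT0 hs',
            mul_nonneg hT0 (sub_nonneg.2 h7), mul_nonneg hT0 (sub_nonneg.2 h6)]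
        _ = B (t + 1) := by rw [hB (t + 1), overlapBound, ← hB, hM]
    have hDM : 0 ≤ D * M * (2 * √(n : ℝ)) := by positivity
    refine ⟨?_, ?_, ?_, ?_, ?_⟩
    · intro q hq
      rcases Nat.lt_or_ge q (t + 1) with hq' | hq'
      · exact hunit q (by omega)
      · obtain rfl : q = t + 1 := by omega
        exact hunit'
    · refine hgen v hv.le fun r hr => ?_
      rw [abs_mul]
      have h1 := hrow1 r hr
      have h2 := htyp.spike r (by omega)
      nlinarith [abs_nonneg (L t r), abs_nonneg (inner ℝ (ξ r) v)]
    · intro q hq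
      rw [real_inner_comm]
      refine hgen (u q) (hunit q (by omega)).le fun r hr => ?_
      rw [abs_mul]
      -- An innovation older than `u q` may correlate with it, but since `r < q ≤ t` its coefficient
      -- is small; the others are controlled by `past`.
      rcases Nat.lt_or_ge r q with hrq | hrq
      · have h1 := hrow r (by omega)
        have h2 : |inner ℝ (ξ r) (u q)| ≤ 2 * √(n : ℝ) := by
          refine (abs_real_inner_le_norm _ _).trans ?_
          rw [hunit q (by omega), mul_one]
          exact htyp.norm_le r (by omega)
        have : |L t r| * |inner ℝ (ξ r) (u q)| ≤ D * M * (2 * √(n : ℝ)) := by gcongr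
        linarith
      · have h1 := hrow1 r hr
        have h2 := htyp.past r (by omega) q hrq
        nlinarith [abs_nonneg (L t r), abs_nonneg (inner ℝ (ξ r) (u q))]
    · intro q hq
      rcases Nat.lt_or_ge q t with hq' | hq'
      · exact hdiag q hq'
      · obtain rfl : q = t := by omega
        exact htt
    · intro q hq
      rcases Nat.lt_or_ge q t with hq' | hq'
      · exact hy q hq'
      · obtain rfl : q = t := by omega
        exact hylow

/-- On the typical event, the overlap with the spike contracts until it reaches the noise level
`s / √n`, and the new direction is dominated by the newest innovation. -/
theorem exists_iterate_bounds (m : ℕ) (hm : 2 ≤ m) (T : ℕ) :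
    ∃ C : ℝ, 1 ≤ C ∧ ∀ (n : ℕ) (β : ℝ) (v : Vec n) (ξ u y : ℕ → Vec n) (L : ℕ → ℕ → ℝ) (s η : ℝ),
      IsInnovationIteration m T β v ξ u y L → 0 < n → ‖v‖ = 1 → ‖u 0‖ = 1 → 0 ≤ s →
      TypicalAt T v s ξ u → 1 ≤ |β| → 0 ≤ η → η ≤ 1 →
      |β * (inner ℝ (u 0) v) ^ (m - 1)| ≤ η → |β| * (s / √(n : ℝ)) ^ (m - 1) ≤ 1 →
      C * (η + s / √(n : ℝ)) ≤ 1 → ∀ t ≤ T,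
      ‖u t‖ = 1 ∧
      |inner ℝ (u t) v| ≤ C * (η ^ t * |inner ℝ (u 0) v| + s / √(n : ℝ)) ∧
      (1 ≤ t → t < T → ‖∑ r ∈ Finset.range (t + 1), L t r • ξ r - ξ t‖ ≤
        C * √(n : ℝ) * (η ^ t * |inner ℝ (u 0) v| + s / √(n : ℝ)) ^ m) := by
  obtain ⟨D, hD⟩ : ∃ D : ℝ, D = 2 * 3 ^ T := ⟨_, rfl⟩
  obtain ⟨K, hK⟩ : ∃ K : ℝ, K = 32 * (T + 1) * D := ⟨_, rfl⟩
  have hD1 : 1 ≤ D := by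
    rw [hD]; have : (1 : ℝ) ≤ 3 ^ T := one_le_pow₀ (by norm_num)
    linarith
  have hT0 : (0 : ℝ) ≤ T := by positivity
  have hK1 : 1 ≤ K := by rw [hK]; nlinarith
  obtain ⟨C, hC, hCb⟩ := exists_overlapBound_le (m := m) (by omega) hK1 T
  obtain ⟨A, hA⟩ : ∃ A : ℝ, A = 64 * (T + 1) * D ^ 2 := ⟨_, rfl⟩
  have hA1 : 32 ≤ A := by rw [hA]; nlinarith
  have hAC : 1 ≤ A * C ^ m := by
    have : 1 ≤ C ^ m := one_le_pow₀ hC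
    nlinarith
  have hCAC : A * C ≤ A * C ^ m := by
    gcongr
    exact le_self_pow₀ hC (by omega)
  refine ⟨A * C ^ m, hAC, ?_⟩
  intro n β v ξ u y L s η h hn hv hu0 hs htyp hβ hη hη1 hα hβs hsmall
  have hsn : 0 < √(n : ℝ) := by positivity
  set s' := s / √(n : ℝ) with hs'
  have hs0 : 0 ≤ s' := by positivity
  set α := |inner ℝ (u 0) v| with hαdef
  have hα0 : 0 ≤ α := abs_nonneg _
  have hα1 : α ≤ 1 := by
    refine (abs_real_inner_le_norm _ _).trans ?_
    rw [hu0, hv, one_mul]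
  rw [abs_mul, abs_pow] at hα
  have hBb := hCb |β| s' α η (abs_nonneg _) hs0 hα0 hη hη1 hα hβs
  set B := overlapBound m K |β| s' α with hB
  have hB0 : ∀ t, 0 ≤ B t := fun t =>
    overlapBound_nonneg (by linarith) (abs_nonneg _) hs0 hα0 t
  have hsmall' : A * (C * (η + s')) ≤ 1 := by
    refine le_trans ?_ hsmall
    rw [← mul_assoc]
    gcongr
  have hpow : ∀ t, η ^ (t + 1) * α + s' ≤ η + s' := by
    intro t
    have : η ^ (t + 1) * α ≤ η * 1 := by
      gcongr
      exact pow_le_of_le_one hη hη1 (by omega)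
    linarith
  -- From time 1 on, at least one contraction factor η is available, so the bound is below the
  -- smallness threshold.
  have hB1 : ∀ t < T, 1 ≤ t → 64 * (T + 1) * D ^ 2 * B t ^ m ≤ 1 := by
    intro t ht ht1
    obtain ⟨t, rfl⟩ : ∃ q, t = q + 1 := ⟨t - 1, by omega⟩
    have h1 : B (t + 1) ≤ C * (η + s') :=
      ((hBb (t + 1) ht.le).1).trans (mul_le_mul_of_nonneg_left (hpow t) (by linarith))
    have h2 : B (t + 1) ≤ 1 := by nlinarith [hB0 (t + 1)]
    rw [← hA]
    calc A * B (t + 1) ^ m ≤ A * B (t + 1) := by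
          gcongr
          exact pow_le_of_le_one (hB0 _) h2 (by omega)
      _ ≤ A * (C * (η + s')) := by gcongr
      _ ≤ 1 := hsmall'
  have hB2 : ∀ t < T, 32 * (|β| * B t ^ m) ≤ 1 := by
    intro t ht
    calc 32 * (|β| * B t ^ m) ≤ A * (C * (η + s')) := by
          refine mul_le_mul hA1 (((hBb t ht.le).2).trans (mul_le_mul_of_nonneg_left (hpow t)
            (by linarith))) ?_ (by linarith)
          have := hB0 t
          positivity
      _ ≤ 1 := hsmall'
  have key := h.overlaps_le hn hv hu0 hs htyp hD hK hβ (B := B) (fun t => rfl) hB1 hB2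
  intro t ht
  obtain ⟨hunit, hav, hov, hdiag, -⟩ := key t ht
  have hz : 0 ≤ η ^ t * α + s' := by positivity
  refine ⟨hunit t le_rfl, hav.trans ((hBb t ht).1.trans ?_), fun ht1 htT => ?_⟩
  · gcongr
    calc C ≤ A * C := by nlinarith
      _ ≤ _ := hCAC
  · have hM0 : 0 ≤ B t ^ m := pow_nonneg (hB0 t) m
    obtain ⟨hrow, htt, hrow1, hlast⟩ := h.row_bounds hD htT hM0 (hB1 t htT) hunit hdiag
      (fun q hq => pow_le_pow_left₀ (abs_nonneg _) (hov q hq) m)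
    have hMle : B t ^ m ≤ 1 := by
      have := hB1 t htT ht1
      rw [← hA] at this
      exact (le_mul_of_one_le_left hM0 (by linarith)).trans this
    have e1 : ‖∑ r ∈ Finset.range t, L t r • ξ r‖ ≤ T * (D * B t ^ m) * (2 * √(n : ℝ)) := by
      calc ‖∑ r ∈ Finset.range t, L t r • ξ r‖
          ≤ ∑ r ∈ Finset.range t, (D * B t ^ m) * (2 * √(n : ℝ)) := by
            refine (norm_sum_le _ _).trans (Finset.sum_le_sum fun r hr => ?_)
            have hr' := Finset.mem_range.1 hr
            rw [norm_smul, Real.norm_eq_abs]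
            exact mul_le_mul (hrow r hr') (htyp.norm_le r (by omega)) (norm_nonneg _)
              (by positivity)
        _ = t * (D * B t ^ m) * (2 * √(n : ℝ)) := by simp; ring
        _ ≤ _ := by gcongr
    have e2 : ‖(L t t - 1) • ξ t‖ ≤ (T * D ^ 2 * (B t ^ m) ^ 2) * (2 * √(n : ℝ)) := by
      rw [norm_smul, Real.norm_eq_abs]
      gcongr
      · rw [abs_sub_comm, abs_of_nonneg]
        · exact hlast
        · have := (abs_le.1 (hrow1 t le_rfl)).2
          linarith
      · exact htyp.norm_le t htT
    -- The error splits into the older innovations, linear in the overlap power `B t ^ m`, and the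
    -- diagonal defect, quadratic in it.
    have e3 : ∑ r ∈ Finset.range (t + 1), L t r • ξ r - ξ t =
        ∑ r ∈ Finset.range t, L t r • ξ r + (L t t - 1) • ξ t := by
      rw [Finset.sum_range_succ, sub_smul, one_smul]
      abel
    rw [e3]
    have e4 : B t ^ m ≤ C ^ m * (η ^ t * α + s') ^ m := by
      rw [← mul_pow]
      exact pow_le_pow_left₀ (hB0 t) (hBb t ht).1 m
    calc _ ≤ T * (D * B t ^ m) * (2 * √(n : ℝ)) + (T * D ^ 2 * (B t ^ m) ^ 2) * (2 * √(n : ℝ)) :=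
          (norm_add_le _ _).trans (add_le_add e1 e2)
      _ ≤ T * (D ^ 2 * B t ^ m) * (2 * √(n : ℝ)) + (T * D ^ 2 * (B t ^ m)) * (2 * √(n : ℝ)) := by
          gcongr
          · nlinarith
          · nlinarith
      _ = (4 * T * D ^ 2) * √(n : ℝ) * B t ^ m := by ring
      _ ≤ A * √(n : ℝ) * (C ^ m * (η ^ t * α + s') ^ m) := by
          gcongr
          rw [hA]
          gcongr <;> linarith
      _ = _ := by ring

end Overlaps

/-! ### Monotone transport of a perturbed normal law -/

section Coupling

/-- The distribution function of the standard Gaussian law. -/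
def normalCDF (x : ℝ) : ℝ := cdf (gaussianReal 0 1) x

theorem normalCDF_sub {a b : ℝ} (hab : a ≤ b) :
    normalCDF b - normalCDF a = ∫ x in Set.Ioc a b, gaussianPDFReal 0 1 x := by
  have h1 : (gaussianReal 0 1).real (Set.Ioc a b) = normalCDF b - normalCDF a := by
    rw [normalCDF, normalCDF, cdf_eq_real, cdf_eq_real, ← Set.Iic_sdiff_Iic,
      measureReal_sdiff (Set.Iic_subset_Iic.2 hab) measurableSet_Iic]
  rw [← h1, measureReal_def, gaussianReal_apply_eq_integral 0 one_ne_zero,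
    ENNReal.toReal_ofReal (integral_nonneg fun x => gaussianPDFReal_nonneg 0 1 x)]

theorem mul_le_normalCDF_sub {a b c : ℝ} (hab : a ≤ b)
    (hc : ∀ x ∈ Set.Ioc a b, c ≤ gaussianPDFReal 0 1 x) :
    c * (b - a) ≤ normalCDF b - normalCDF a := by
  rw [normalCDF_sub hab]
  have h := setIntegral_mono_on (μ := volume) (s := Set.Ioc a b) (f := fun _ => c)
    (g := gaussianPDFReal 0 1) (by simp) (integrable_gaussianPDFReal 0 1).integrableOn
    measurableSet_Ioc hc
  simp only [setIntegral_const, measureReal_def, Real.volume_Ioc, smul_eq_mul] at h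
  rw [ENNReal.toReal_ofReal (by linarith)] at h
  linarith

theorem normalCDF_sub_le_mul {a b c : ℝ} (hab : a ≤ b)
    (hc : ∀ x ∈ Set.Ioc a b, gaussianPDFReal 0 1 x ≤ c) :
    normalCDF b - normalCDF a ≤ c * (b - a) := by
  rw [normalCDF_sub hab]
  have h := setIntegral_mono_on (μ := volume) (s := Set.Ioc a b) (g := fun _ => c)
    (f := gaussianPDFReal 0 1) (integrable_gaussianPDFReal 0 1).integrableOn (by simp)
    measurableSet_Ioc hc
  simp only [setIntegral_const, measureReal_def, Real.volume_Ioc, smul_eq_mul] at h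
  rw [ENNReal.toReal_ofReal (by linarith)] at h
  linarith

theorem gaussianPDFReal_zero_one (x : ℝ) :
    gaussianPDFReal 0 1 x = (√(2 * Real.pi))⁻¹ * Real.exp (-x ^ 2 / 2) := by
  simp [gaussianPDFReal]

theorem gaussianPDFReal_zero_one_le_one (x : ℝ) : gaussianPDFReal 0 1 x ≤ 1 := by
  rw [gaussianPDFReal_zero_one]
  have h1 : (√(2 * Real.pi))⁻¹ ≤ 1 := by
    apply inv_le_one_of_one_le₀
    apply Real.le_sqrt_of_sq_le
    have := Real.pi_gt_three
    linarith
  have h2 : Real.exp (-x ^ 2 / 2) ≤ 1 := Real.exp_le_one_iff.2 (by nlinarith [sq_nonneg x])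
  calc _ ≤ (1 : ℝ) * 1 := by gcongr
    _ = 1 := one_mul 1

theorem gaussianPDFReal_zero_one_anti {x y : ℝ} (h : |x| ≤ |y|) :
    gaussianPDFReal 0 1 y ≤ gaussianPDFReal 0 1 x := by
  rw [gaussianPDFReal_zero_one, gaussianPDFReal_zero_one]
  have := sq_le_sq.2 h
  gcongr

/-- The condition on `ω` gives |x² - y²| ≤ 2, so the exponents differ by at most 1. -/
theorem gaussianPDFReal_zero_one_le_mul {R ω x y : ℝ} (hR : 0 ≤ R) (hω : ω * (R + 2) ≤ 1)
    (hy : |y| ≤ R) (hxy : |x - y| ≤ ω) :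
    gaussianPDFReal 0 1 x ≤ Real.exp 1 * gaussianPDFReal 0 1 y ∧
      gaussianPDFReal 0 1 y ≤ Real.exp 1 * gaussianPDFReal 0 1 x := by
  have hω0 : 0 ≤ ω := (abs_nonneg _).trans hxy
  have hω1 : ω ≤ 1 := by nlinarith
  have h1 : |x ^ 2 - y ^ 2| ≤ 2 := by
    have e : x ^ 2 - y ^ 2 = (x - y) * ((x - y) + 2 * y) := by ring
    rw [e, abs_mul]
    have h2 : |(x - y) + 2 * y| ≤ ω + 2 * R := by
      refine (abs_add_le _ _).trans (add_le_add hxy ?_)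
      rw [abs_mul, abs_two]
      linarith
    calc _ ≤ ω * (ω + 2 * R) := by gcongr
      _ ≤ 2 := by nlinarith
  obtain ⟨h2, h3⟩ := abs_le.1 h1
  have hp : 0 ≤ (√(2 * Real.pi))⁻¹ := by positivity
  rw [gaussianPDFReal_zero_one, gaussianPDFReal_zero_one]
  constructor
  · rw [mul_left_comm, ← Real.exp_add]
    gcongr
    linarith
  · rw [mul_left_comm, ← Real.exp_add]
    gcongr
    linarith

theorem normalCDF_strictMono : StrictMono normalCDF := by
  intro a b hab
  have h := mul_le_normalCDF_sub (c := gaussianPDFReal 0 1 (|a| + |b|)) hab.le fun x hx => by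
    apply gaussianPDFReal_zero_one_anti
    rw [abs_of_nonneg (by positivity : 0 ≤ |a| + |b|)]
    rcases abs_cases x with ⟨h, _⟩ | ⟨h, _⟩ <;> rw [h]
    · linarith [hx.2, le_abs_self b, abs_nonneg a]
    · linarith [hx.1, neg_le_abs a, abs_nonneg b]
  have h2 := mul_pos (gaussianPDFReal_pos 0 1 (|a| + |b|) one_ne_zero) (sub_pos.2 hab)
  linarith

theorem normalCDF_lipschitz (a b : ℝ) : |normalCDF a - normalCDF b| ≤ |a - b| := by
  wlog h : b ≤ a generalizing a b
  · rw [abs_sub_comm, abs_sub_comm a b]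
    exact this b a (by linarith)
  have h1 := normalCDF_sub_le_mul (c := 1) h fun x _ => gaussianPDFReal_zero_one_le_one x
  have h2 := normalCDF_strictMono.monotone h
  rw [abs_of_nonneg (by linarith), abs_of_nonneg (by linarith)]
  linarith

theorem continuous_normalCDF : Continuous normalCDF := by
  have : LipschitzWith 1 normalCDF := LipschitzWith.of_dist_le_mul fun a b => by
    simpa [Real.dist_eq] using normalCDF_lipschitz a b
  exact this.continuous

theorem normalCDF_mem_Ioo (x : ℝ) : 0 < normalCDF x ∧ normalCDF x < 1 :=
  ⟨(cdf_nonneg _ (x - 1)).trans_lt (normalCDF_strictMono (by linarith)),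
    (normalCDF_strictMono (by linarith : x < x + 1)).trans_le (cdf_le_one _ _)⟩

theorem norm_normalCDF_le_one (x : ℝ) : ‖normalCDF x‖ ≤ 1 := by
  rw [Real.norm_of_nonneg (normalCDF_mem_Ioo x).1.le]
  exact (normalCDF_mem_Ioo x).2.le

theorem exists_eq_of_tendsto {f : ℝ → ℝ} (hf : Continuous f)
    (h0 : Filter.Tendsto f Filter.atBot (nhds 0)) (h1 : Filter.Tendsto f Filter.atTop (nhds 1))
    {p : ℝ} (hp0 : 0 < p) (hp1 : p < 1) : ∃ x, f x = p := by
  obtain ⟨a, ha⟩ := (h0.eventually (eventually_lt_nhds hp0)).exists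
  obtain ⟨b, hb⟩ := (h1.eventually (eventually_gt_nhds hp1)).exists
  exact mem_range_of_exists_le_of_exists_ge hf ⟨a, ha.le⟩ ⟨b, hb.le⟩

variable (μ : Measure ℝ) [IsProbabilityMeasure μ]

/-- The law of the sum of a standard Gaussian variable and an independent perturbation. -/
def perturbedNormal : Measure ℝ :=
  (μ.prod (gaussianReal 0 1)).map fun p => p.2 + p.1

instance : IsProbabilityMeasure (perturbedNormal μ) :=
  Measure.isProbabilityMeasure_map (by fun_prop)

theorem integrable_normalCDF_sub (y : ℝ) : Integrable (fun w => normalCDF (y - w)) μ := by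
  refine Integrable.of_bound (C := 1) ?_ (Filter.Eventually.of_forall fun w =>
    norm_normalCDF_le_one _)
  exact (continuous_normalCDF.comp (by fun_prop)).aestronglyMeasurable

theorem cdf_perturbedNormal (y : ℝ) :
    cdf (perturbedNormal μ) y = ∫ w, normalCDF (y - w) ∂μ := by
  have hS : MeasurableSet ((fun p : ℝ × ℝ => p.2 + p.1) ⁻¹' Set.Iic y) :=
    measurableSet_Iic.preimage (by fun_prop)
  rw [cdf_eq_real, measureReal_def, perturbedNormal, Measure.map_apply (by fun_prop)
    measurableSet_Iic, Measure.prod_apply hS,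
    integral_eq_lintegral_of_nonneg_ae (f := fun w => normalCDF (y - w))
      (Filter.Eventually.of_forall fun w => cdf_nonneg _ _) (integrable_normalCDF_sub μ y).aestronglyMeasurable]
  congr 1
  refine lintegral_congr fun w => ?_
  rw [normalCDF, ofReal_cdf]
  congr 1
  ext g
  simp [le_sub_iff_add_le]

theorem integral_pos_of_forall_pos {f : ℝ → ℝ} (hf : Integrable f μ) (h : ∀ x, 0 < f x) :
    0 < ∫ x, f x ∂μ := by
  rw [integral_pos_iff_support_of_nonneg (fun x => (h x).le) hf]
  have : Function.support f = Set.univ := by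
    ext x
    simp [(h x).ne']
  simp [this]

theorem cdf_perturbedNormal_strictMono : StrictMono (cdf (perturbedNormal μ)) := by
  intro a b hab
  rw [cdf_perturbedNormal, cdf_perturbedNormal, ← sub_pos,
    ← integral_sub (integrable_normalCDF_sub μ b) (integrable_normalCDF_sub μ a)]
  exact integral_pos_of_forall_pos μ ((integrable_normalCDF_sub μ b).sub
    (integrable_normalCDF_sub μ a)) fun w => sub_pos.2 (normalCDF_strictMono (by linarith))

theorem continuous_cdf_perturbedNormal : Continuous (cdf (perturbedNormal μ)) := by
  have : (cdf (perturbedNormal μ) : ℝ → ℝ) = fun y => ∫ w, normalCDF (y - w) ∂μ :=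
    funext (cdf_perturbedNormal μ)
  rw [this]
  refine continuous_of_dominated (bound := fun _ => 1)
    (fun y => (integrable_normalCDF_sub μ y).aestronglyMeasurable)
    (fun y => Filter.Eventually.of_forall fun w => norm_normalCDF_le_one _) (integrable_const _)
    (Filter.Eventually.of_forall fun w => continuous_normalCDF.comp (by fun_prop))

/-- The monotone rearrangement which turns the perturbed normal law into the normal law. -/
theorem exists_transport : ∃ tr : ℝ → ℝ, Monotone tr ∧
    (perturbedNormal μ).map tr = gaussianReal 0 1 ∧
    ∀ y, normalCDF (tr y) = cdf (perturbedNormal μ) y := by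
  have hmem : ∀ y, 0 < cdf (perturbedNormal μ) y ∧ cdf (perturbedNormal μ) y < 1 := fun y =>
    ⟨(cdf_nonneg _ (y - 1)).trans_lt (cdf_perturbedNormal_strictMono μ (by linarith)),
      (cdf_perturbedNormal_strictMono μ (by linarith : y < y + 1)).trans_le (cdf_le_one _ _)⟩
  have hex : ∀ y, ∃ z, normalCDF z = cdf (perturbedNormal μ) y := fun y =>
    exists_eq_of_tendsto continuous_normalCDF (tendsto_cdf_atBot _) (tendsto_cdf_atTop _)
      (hmem y).1 (hmem y).2
  -- The quantile map: the inverse of the normal distribution function composed with that of the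
  -- perturbed law.
  choose tr htr using hex
  have hmono : Monotone tr := fun a b hab => by
    rw [← normalCDF_strictMono.le_iff_le, htr, htr]
    exact monotone_cdf _ hab
  refine ⟨tr, hmono, ?_, htr⟩
  have : IsProbabilityMeasure ((perturbedNormal μ).map tr) :=
    Measure.isProbabilityMeasure_map hmono.measurable.aemeasurable
  apply Measure.eq_of_cdf
  ext z
  obtain ⟨y, hy⟩ := exists_eq_of_tendsto (continuous_cdf_perturbedNormal μ) (tendsto_cdf_atBot _)
    (tendsto_cdf_atTop _) (normalCDF_mem_Ioo z).1 (normalCDF_mem_Ioo z).2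
  change _ = normalCDF z
  rw [← hy, cdf_eq_real, cdf_eq_real, map_measureReal_apply hmono.measurable measurableSet_Iic]
  congr 1
  ext x
  rw [Set.mem_preimage, Set.mem_Iic, Set.mem_Iic, ← normalCDF_strictMono.le_iff_le, htr, ← hy,
    (cdf_perturbedNormal_strictMono μ).le_iff_le]

variable {μ}

/-- Average over the perturbation `w`. If |w| > ω, the distribution function changes by at most 1.
Otherwise the density stays comparable to its value at `y`, so the change is at most e φ(y) |w|, and
|w| ≤ τ' + ω 1{|w| > τ'}. The rare event at level `τ'` is thus weighted by the small factor `ω`. -/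
theorem abs_cdf_perturbedNormal_sub_le {R ω τ' y : ℝ} (hR : 0 ≤ R) (hω0 : 0 ≤ ω)
    (hω : ω * (R + 2) ≤ 1) (hτ' : 0 ≤ τ') (hy : |y| ≤ R) :
    |cdf (perturbedNormal μ) y - normalCDF y| ≤ Real.exp 1 * gaussianPDFReal 0 1 y *
      (τ' + ω * μ.real {w | τ' < |w|}) + μ.real {w | ω < |w|} := by
  set φ := gaussianPDFReal 0 1 y
  have hφ : 0 ≤ φ := gaussianPDFReal_nonneg _ _ _
  have hS : ∀ c : ℝ, MeasurableSet {w : ℝ | c < |w|} := fun c =>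
    measurableSet_lt measurable_const (by fun_prop)
  have hint : ∀ c : ℝ, Integrable ({w : ℝ | c < |w|}.indicator fun _ => (1 : ℝ)) μ := fun c =>
    (integrable_const 1).indicator (hS c)
  have hpt : ∀ w, |normalCDF (y - w) - normalCDF y| ≤ Real.exp 1 * φ *
      (τ' + ω * {w : ℝ | τ' < |w|}.indicator (fun _ => (1 : ℝ)) w) +
      {w : ℝ | ω < |w|}.indicator (fun _ => (1 : ℝ)) w := by
    intro w
    have hi : ∀ c : ℝ, 0 ≤ {w : ℝ | c < |w|}.indicator (fun _ => (1 : ℝ)) w := fun c =>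
      Set.indicator_nonneg (fun _ _ => zero_le_one) _
    by_cases hw : ω < |w|
    · rw [Set.indicator_of_mem (show w ∈ {w : ℝ | ω < |w|} from hw)]
      have h1 := normalCDF_mem_Ioo (y - w)
      have h2 := normalCDF_mem_Ioo y
      have h3 : |normalCDF (y - w) - normalCDF y| ≤ 1 := abs_le.2 ⟨by linarith, by linarith⟩
      have h4 : 0 ≤ Real.exp 1 * φ *
        (τ' + ω * {w : ℝ | τ' < |w|}.indicator (fun _ => (1 : ℝ)) w) := by
        have := hi τ'
        positivity
      linarith
    · have hw' := not_lt.1 hw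
      rw [Set.indicator_of_notMem (show w ∉ {w : ℝ | ω < |w|} from hw), add_zero]
      have h1 : |normalCDF (y - w) - normalCDF y| ≤ Real.exp 1 * φ * |w| := by
        rcases le_total 0 w with h | h
        · have h2 := normalCDF_sub_le_mul (a := y - w) (b := y) (c := Real.exp 1 * φ)
            (by linarith) fun x hx => (gaussianPDFReal_zero_one_le_mul hR hω hy (by
              rw [abs_of_nonneg h] at hw'
              rw [abs_le]; constructor <;> linarith [hx.1, hx.2])).1
          have h3 := normalCDF_strictMono.monotone (show y - w ≤ y by linarith)
          rw [abs_sub_comm, abs_of_nonneg (by linarith), abs_of_nonneg h]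
          linarith
        · have h2 := normalCDF_sub_le_mul (a := y) (b := y - w) (c := Real.exp 1 * φ)
            (by linarith) fun x hx => (gaussianPDFReal_zero_one_le_mul hR hω hy (by
              rw [abs_of_nonpos h] at hw'
              rw [abs_le]; constructor <;> linarith [hx.1, hx.2])).1
          have h3 := normalCDF_strictMono.monotone (show y ≤ y - w by linarith)
          rw [abs_of_nonneg (by linarith), abs_of_nonpos h]
          linarith
      refine h1.trans ?_
      gcongr
      by_cases hw2 : τ' < |w|
      · rw [Set.indicator_of_mem (show w ∈ {w : ℝ | τ' < |w|} from hw2)]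
        linarith
      · rw [Set.indicator_of_notMem (show w ∉ {w : ℝ | τ' < |w|} from hw2)]
        linarith
  have e1 : cdf (perturbedNormal μ) y - normalCDF y = ∫ w, (normalCDF (y - w) - normalCDF y) ∂μ := by
    rw [integral_sub (integrable_normalCDF_sub μ y) (integrable_const _), cdf_perturbedNormal]
    simp
  have hint2 : Integrable (fun w => Real.exp 1 * φ *
      (τ' + ω * {w : ℝ | τ' < |w|}.indicator (fun _ => (1 : ℝ)) w)) μ :=
    ((integrable_const τ').add ((hint τ').const_mul ω)).const_mul _
  rw [e1]
  refine (abs_integral_le_integral_abs).trans ?_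
  refine (integral_mono ((integrable_normalCDF_sub μ y).sub (integrable_const _)).abs
    (hint2.add (hint ω)) hpt).trans_eq ?_
  rw [integral_add' hint2 (hint ω), integral_const_mul,
    integral_add (integrable_const τ') ((hint τ').const_mul ω), integral_const_mul,
    integral_indicator_const _ (hS _), integral_indicator_const _ (hS _)]
  simp

/-- The monotone rearrangement moves points of moderate size by at most the typical size of the
perturbation. -/
theorem abs_transport_sub_le {tr : ℝ → ℝ}
    (htr : ∀ y, normalCDF (tr y) = cdf (perturbedNormal μ) y) {R ω τ τ' y : ℝ} (hR : 0 ≤ R)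
    (hω0 : 0 ≤ ω) (hω : ω * (R + 2) ≤ 1) (hτ0 : 0 ≤ τ) (hτ : τ * (R + 2) ≤ 1) (hτ' : 0 ≤ τ')
    (hy : |y| ≤ R) (h1 : τ' + ω * μ.real {w | τ' < |w|} ≤ τ / 16)
    (h2 : μ.real {w | ω < |w|} ≤ τ * gaussianPDFReal 0 1 R / 16) : |tr y - y| ≤ τ := by
  have h := abs_cdf_perturbedNormal_sub_le (μ := μ) hR hω0 hω hτ' hy
  have hφR : gaussianPDFReal 0 1 R ≤ gaussianPDFReal 0 1 y :=
    gaussianPDFReal_zero_one_anti (by rwa [abs_of_nonneg hR])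
  set φ := gaussianPDFReal 0 1 y
  have hφ : 0 < φ := gaussianPDFReal_pos _ _ _ one_ne_zero
  have he0 := Real.exp_pos 1
  have he : Real.exp 1 ≤ 3 := Real.exp_one_lt_three.le
  have h3 : |cdf (perturbedNormal μ) y - normalCDF y| ≤ φ * τ / 4 := by
    calc _ ≤ Real.exp 1 * φ * (τ / 16) + τ * gaussianPDFReal 0 1 R / 16 := by
          refine h.trans (add_le_add ?_ h2)
          gcongr
      _ ≤ 3 * φ * (τ / 16) + τ * φ / 16 := by gcongr
      _ = _ := by ring
  -- Shifting by `τ` moves the normal distribution function by at least φτ/3, as e < 3; this beats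
  -- the discrepancy φτ/4.
  have h4 : φ * τ / 3 ≤ normalCDF (y + τ) - normalCDF y := by
    have := mul_le_normalCDF_sub (a := y) (b := y + τ) (c := φ / 3) (by linarith) fun x hx => by
      have h5 := (gaussianPDFReal_zero_one_le_mul (x := x) hR hτ hy (by
        rw [abs_le]; constructor <;> linarith [hx.1, hx.2])).2
      have h6 := gaussianPDFReal_nonneg 0 1 x
      change φ ≤ _ at h5
      nlinarith
    linarith
  have h5 : φ * τ / 3 ≤ normalCDF y - normalCDF (y - τ) := by
    have := mul_le_normalCDF_sub (a := y - τ) (b := y) (c := φ / 3) (by linarith) fun x hx => by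
      have h5 := (gaussianPDFReal_zero_one_le_mul (x := x) hR hτ hy (by
        rw [abs_le]; constructor <;> linarith [hx.1, hx.2])).2
      have h6 := gaussianPDFReal_nonneg 0 1 x
      change φ ≤ _ at h5
      nlinarith
    linarith
  have h6 : 0 ≤ φ * τ := by positivity
  obtain ⟨h7, h8⟩ := abs_le.1 h3
  rw [← htr] at h7 h8
  have h9 : tr y ≤ y + τ := normalCDF_strictMono.le_iff_le.1 (by linarith)
  have h10 : y - τ ≤ tr y := normalCDF_strictMono.le_iff_le.1 (by linarith)
  rw [abs_le]
  constructor <;> linarith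

variable {V : Type*} [NormedAddCommGroup V] [InnerProductSpace ℝ V] [FiniteDimensional ℝ V]
  [MeasurableSpace V] [BorelSpace V]

/-- Replacing the component of a standard Gaussian vector in the direction `v` by the
rearrangement of its perturbation yields a standard Gaussian vector. -/
theorem hasLaw_transported {Ω : Type*} [MeasurableSpace Ω] {P : Measure Ω} [IsProbabilityMeasure P]
    {ξ : Ω → V} {W : Ω → ℝ} (hξ : HasLaw ξ (stdGaussian V) P) (hW : HasLaw W μ P)
    (hind : IndepFun W ξ P) {v : V} (hv : ‖v‖ = 1) {tr : ℝ → ℝ} (htrm : Measurable tr)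
    (htr : (perturbedNormal μ).map tr = gaussianReal 0 1) :
    HasLaw (fun ω => ξ ω + (tr (inner ℝ (ξ ω) v + W ω) - inner ℝ (ξ ω) v) • v)
      (stdGaussian V) P := by
  let π : V →L[ℝ] V := (innerSL ℝ v).smulRight v
  have hπa : ∀ x, π x = (inner ℝ x v : ℝ) • v := fun x => by
    simp [π, real_inner_comm]
  have hvv : inner ℝ v v = (1 : ℝ) := by rw [real_inner_self_eq_norm_sq, hv, one_pow]
  have hππ : ∀ x, π (π x) = π x := fun x => by
    rw [hπa, hπa, real_inner_smul_left, hvv, mul_one]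
  have hπs : ∀ x y, inner ℝ (π x) y = inner ℝ x (π y) := fun x y => by
    rw [hπa, hπa, real_inner_smul_left, real_inner_smul_right, real_inner_comm y v, mul_comm]
  have hmix := measurePreserving_stdGaussian_mix π hππ hπs
  have hG : MeasurePreserving (fun x : V => (inner ℝ x v : ℝ)) (stdGaussian V) (gaussianReal 0 1) :=
    ⟨by fun_prop, map_inner_stdGaussian hv⟩
  have hG2 : MeasurePreserving (fun p : ℝ × V => (p.1, (inner ℝ p.2 v : ℝ)))
      (μ.prod (stdGaussian V)) (μ.prod (gaussianReal 0 1)) := (MeasurePreserving.id μ).prod hG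
  have hpert : MeasurePreserving (fun p : ℝ × ℝ => p.2 + p.1) (μ.prod (gaussianReal 0 1))
      (perturbedNormal μ) := ⟨by fun_prop, rfl⟩
  have htr' : MeasurePreserving tr (perturbedNormal μ) (gaussianReal 0 1) := ⟨htrm, htr⟩
  have h3 : MeasurePreserving (fun p : ℝ × V => tr (inner ℝ p.2 v + p.1))
      (μ.prod (stdGaussian V)) (gaussianReal 0 1) := htr'.comp (hpert.comp hG2)
  have h4 : MeasurePreserving (fun p : (ℝ × V) × V => (tr (inner ℝ p.1.2 v + p.1.1), p.2))
      ((μ.prod (stdGaussian V)).prod (stdGaussian V)) ((gaussianReal 0 1).prod (stdGaussian V)) :=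
    h3.prod (MeasurePreserving.id _)
  have h5m : Measurable (fun p : ℝ × V => p.1 • v + (p.2 - π p.2)) := by fun_prop
  have h5 : MeasurePreserving (fun p : ℝ × V => p.1 • v + (p.2 - π p.2))
      ((gaussianReal 0 1).prod (stdGaussian V)) (stdGaussian V) := by
    refine ⟨h5m, ?_⟩
    have e := (hG.prod (MeasurePreserving.id (stdGaussian V)))
    rw [← e.map_eq, Measure.map_map h5m e.measurable]
    refine Eq.trans ?_ hmix.map_eq
    congr 1
    funext p
    simp [hπa]
  have h1 : MeasurePreserving (fun p : ℝ × V × V => (p.1, π p.2.1 + (p.2.2 - π p.2.2)))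
      (μ.prod ((stdGaussian V).prod (stdGaussian V))) (μ.prod (stdGaussian V)) :=
    (MeasurePreserving.id μ).prod hmix
  have h2 := measurePreserving_prodAssoc μ (stdGaussian V) (stdGaussian V)
  have h12 := h1.comp h2
  have hψ : Measurable fun p : ℝ × V => p.2 + (tr (inner ℝ p.2 v + p.1) - inner ℝ p.2 v) • v := by
    fun_prop
  -- Represent ξ by two independent copies: one supplies the component along `v`, which is perturbed
  -- and transported together with W, while the other supplies the orthogonal component and stays
  -- untouched.
  have hfinal : (μ.prod (stdGaussian V)).map
      (fun p : ℝ × V => p.2 + (tr (inner ℝ p.2 v + p.1) - inner ℝ p.2 v) • v) = stdGaussian V := by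
    rw [← h12.map_eq, Measure.map_map hψ h12.measurable]
    refine Eq.trans ?_ (h5.comp h4).map_eq
    congr 1
    funext p
    have e1 : (inner ℝ (π p.1.2 + (p.2 - π p.2)) v : ℝ) = inner ℝ p.1.2 v := by
      rw [inner_add_left, inner_sub_left, hπa, hπa, real_inner_smul_left, real_inner_smul_left,
        hvv]
      ring
    simp only [Function.comp_apply, MeasurableEquiv.prodAssoc, MeasurableEquiv.coe_mk,
      Equiv.prodAssoc_apply, e1]
    rw [sub_smul, hπa p.1.2]
    abel
  refine ⟨hψ.comp_aemeasurable (hW.aemeasurable.prodMk hξ.aemeasurable), ?_⟩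
  have e := (indepFun_iff_map_prod_eq_prod_map_map hW.aemeasurable hξ.aemeasurable).1 hind
  rw [hW.map_eq, hξ.map_eq] at e
  rw [← hfinal, ← e, AEMeasurable.map_map_of_aemeasurable hψ.aemeasurable
    (hW.aemeasurable.prodMk hξ.aemeasurable)]
  rfl

end Coupling

/-! ### Almost sure non-convergence -/

section Convergence

variable {m n : ℕ}

theorem continuous_act (X : Tensor (m + 1) n) : Continuous (act X) := by
  have : act X = fun u => WithLp.toLp 2 fun i =>
      ∑ J : Fin m → Fin n, X (Fin.cons i J) * ∏ l, u (J l) := by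
    funext u
    ext i
    exact act_apply X u i
  rw [this]
  fun_prop

theorem exists_unit_orthogonal (hn : 2 ≤ n) (v : Vec n) : ∃ e : Vec n, ‖e‖ = 1 ∧ inner ℝ v e = (0 : ℝ) := by
  have h1 : (Submodule.span ℝ {v})ᗮ ≠ ⊥ := by
    intro h
    have h2 := Submodule.finrank_add_finrank_orthogonal (Submodule.span ℝ {v})
    have h3 : Module.finrank ℝ (Submodule.span ℝ {v}) ≤ 1 := by
      simpa using finrank_span_le_card (R := ℝ) ({v} : Set (Vec n))
    rw [h, finrank_bot, finrank_euclideanSpace_fin] at h2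
    omega
  obtain ⟨e, he, he0⟩ := Submodule.exists_mem_ne_zero_of_ne_bot h1
  refine ⟨‖e‖⁻¹ • e, by rw [norm_smul, norm_inv, norm_norm, inv_mul_cancel₀ (norm_ne_zero_iff.2 he0)], ?_⟩
  rw [inner_smul_right, Submodule.mem_orthogonal_singleton_iff_inner_right.1 he, mul_zero]

theorem norm_tensorPow {u : Vec n} (hu : ‖u‖ = 1) : ‖tensorPow m u‖ = 1 := by
  have h := inner_tensorPow (m := m) u u
  rw [real_inner_self_eq_norm_sq, real_inner_self_eq_norm_sq, hu, one_pow, one_pow] at h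
  nlinarith [norm_nonneg (tensorPow m u)]

theorem hasLaw_sqrt_smul_act {Ω : Type*} [MeasurableSpace Ω] {P : Measure Ω}
    [IsProbabilityMeasure P] (hn : 0 < n) {Z : Ω → Tensor (m + 1) n} (hZ : IsGaussianNoise P Z)
    {p : Vec n} (hp : ‖p‖ = 1) :
    HasLaw (fun ω => √(n : ℝ) • act (Z ω) p) (stdGaussian (Vec n)) P := by
  have hX := hasLaw_unfoldRows hn hZ
  have hm : Measurable fun x : PiLp 2 fun _ : Fin n => EuclideanSpace ℝ (Fin m → Fin n) =>
      rowMul x (tensorPow m p) := measurable_rowMul.comp (measurable_id.prodMk measurable_const)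
  have h1 : HasLaw (fun x : PiLp 2 fun _ : Fin n => EuclideanSpace ℝ (Fin m → Fin n) =>
      rowMul x (tensorPow m p)) (stdGaussian (Vec n)) (stdGaussian _) :=
    ⟨hm.aemeasurable, map_rowMul_stdGaussian (norm_tensorPow hp)⟩
  have h2 := h1.comp hX
  have h3 : (fun ω => √(n : ℝ) • act (Z ω) p) = (fun x => rowMul x (tensorPow m p)) ∘
      fun ω => unfoldRows (WithLp.toLp 2 (√(n : ℝ) • Z ω)) := by
    funext ω
    rw [Function.comp_apply, rowMul_unfoldRows, act_smul]
  rw [h3]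
  exact h2

/-- Power iteration almost surely does not converge to a given unit vector parallel to the
spike. -/
theorem ae_not_tendsto_powerIter {Ω : Type*} [MeasurableSpace Ω] {P : Measure Ω}
    [IsProbabilityMeasure P] (hn : 2 ≤ n) {Z : Ω → Tensor (m + 1) n} (hZ : IsGaussianNoise P Z)
    (β : ℝ) (u v : Vec n) {c : ℝ} (hp : ‖c • v‖ = 1) :
    ∀ᵐ ω ∂P, ¬ Filter.Tendsto (powerIter (spiked β v (Z ω)) u) Filter.atTop (nhds (c • v)) := by
  obtain ⟨e, he, hve⟩ := exists_unit_orthogonal hn v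
  have hlaw := hasLaw_sqrt_smul_act (m := m) (by omega) hZ hp
  have hlaw2 : HasLaw (fun x : Vec n => (inner ℝ x e : ℝ)) (gaussianReal 0 1)
      (stdGaussian (Vec n)) := ⟨by fun_prop, map_inner_stdGaussian he⟩
  have hlaw3 := hlaw2.comp hlaw
  have hne : ∀ᵐ x ∂(gaussianReal 0 1), x ≠ 0 := by
    have := nullSingletonClass_gaussianReal (μ := 0) (v := 1) one_ne_zero
    rw [ae_iff]
    simp
  rw [← hlaw3.map_eq] at hne
  filter_upwards [ae_of_ae_map hlaw3.aemeasurable hne] with ω hω htend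
  have hω' : inner ℝ (act (spiked β v (Z ω)) (c • v)) e ≠ (0 : ℝ) := by
    rw [act_spiked, inner_add_left, real_inner_smul_left, hve, mul_zero, zero_add]
    intro h0
    apply hω
    simp [real_inner_smul_left, h0]
  have h0 : act (spiked β v (Z ω)) (c • v) ≠ 0 := by
    intro h
    rw [h, inner_zero_left] at hω'
    exact hω' rfl
  -- Since `act` does not vanish at the limit, the normalized step is continuous there and the limit
  -- is a fixed point. It would then have a nonzero component along `e`, which is orthogonal to `v`.
  have h1 := ((continuous_act (spiked β v (Z ω))).tendsto (c • v)).comp htend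
  have h2 := (h1.norm.inv₀ (norm_ne_zero_iff.2 h0)).smul h1
  have h3 := htend.comp (Filter.tendsto_add_atTop_nat 1)
  have h4 := tendsto_nhds_unique h3 h2
  have h5 : inner ℝ (c • v) e = (0 : ℝ) := by rw [real_inner_smul_left, hve, mul_zero]
  rw [h4, real_inner_smul_left] at h5
  exact (mul_ne_zero (inv_ne_zero (norm_ne_zero_iff.2 h0)) hω') h5

theorem norm_powerIter_le_one {k : ℕ} (X : Tensor k n) {u : Vec n} (hu : ‖u‖ ≤ 1) (t : ℕ) :
    ‖powerIter X u t‖ ≤ 1 := by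
  cases t with
  | zero => exact hu
  | succ t =>
    rw [powerIter, norm_smul, norm_inv, norm_norm]
    exact inv_mul_le_one

end Convergence

/-! ### Stability of normalization and distance from overlap -/

section Normalization

variable {E : Type*} [NormedAddCommGroup E] [NormedSpace ℝ E]

/-- After multiplication by ‖x‖, correcting the length of `g` costs at most ‖g - x‖, and replacing
`g` by `x` costs the same again. -/
theorem norm_normalize_sub_le (g x : E) (hx : x ≠ 0) :
    ‖‖g‖⁻¹ • g - ‖x‖⁻¹ • x‖ ≤ 2 * ‖g - x‖ / ‖x‖ := by
  have hx0 : 0 < ‖x‖ := norm_pos_iff.2 hx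
  rw [le_div_iff₀ hx0]
  have h1 : ‖‖g‖⁻¹ • g - ‖x‖⁻¹ • x‖ * ‖x‖ = ‖(‖g‖⁻¹ * (‖x‖ - ‖g‖)) • g +
      ((‖g‖⁻¹ * ‖g‖) • g - x)‖ := by
    rw [mul_comm, ← abs_of_pos hx0, ← Real.norm_eq_abs, ← norm_smul, Real.norm_eq_abs,
      abs_of_pos hx0, smul_sub, smul_smul, smul_smul, mul_inv_cancel₀ hx0.ne', one_smul]
    congr 1
    module
  rw [h1]
  by_cases hg : g = 0
  · simp only [hg, norm_zero, smul_zero, zero_sub, zero_add, norm_neg]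
    linarith
  have hg0 : 0 < ‖g‖ := norm_pos_iff.2 hg
  rw [inv_mul_cancel₀ hg0.ne', one_smul]
  refine (norm_add_le _ _).trans ?_
  have h2 : ‖(‖g‖⁻¹ * (‖x‖ - ‖g‖)) • g‖ ≤ ‖g - x‖ := by
    rw [norm_smul, Real.norm_eq_abs, abs_mul, abs_inv, abs_norm, mul_comm, ← mul_assoc,
      mul_inv_cancel₀ hg0.ne', one_mul, abs_sub_comm]
    exact abs_norm_sub_norm_le g x
  linarith

theorem normalize_smul_of_pos {c : ℝ} (hc : 0 < c) (x : E) :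
    ‖c • x‖⁻¹ • c • x = ‖x‖⁻¹ • x := by
  rw [norm_smul, Real.norm_of_nonneg hc.le, smul_smul, mul_inv, mul_right_comm,
    inv_mul_cancel₀ hc.ne', one_mul]

end Normalization

theorem one_le_norm_sub_of_inner_le {V : Type*} [NormedAddCommGroup V] [InnerProductSpace ℝ V]
    {x v : V} (hx : ‖x‖ = 1) (hv : ‖v‖ = 1) (h : |inner ℝ x v| ≤ 1 / 2) :
    1 ≤ ‖x - v‖ ∧ 1 ≤ ‖x + v‖ := by
  obtain ⟨h1, h2⟩ := abs_le.1 h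
  have e1 := norm_sub_sq_real x v
  have e2 := norm_add_sq_real x v
  rw [hx, hv] at e1 e2
  constructor
  · nlinarith [norm_nonneg (x - v)]
  · nlinarith [norm_nonneg (x + v)]

/-! ### Comparison of scales in high dimension -/

section Asymptotics

theorem eventually_mul_pow_le_exp (A : ℝ) (p : ℕ) {a : ℝ} (ha : 0 < a) :
    ∀ᶠ x : ℝ in Filter.atTop, A * x ^ p ≤ Real.exp (a * x) := by
  have h := (isLittleO_pow_exp_pos_mul_atTop p ha).def (c := (|A| + 1)⁻¹) (by positivity)
  filter_upwards [h, Filter.eventually_ge_atTop 0] with x hx hx0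
  rw [Real.norm_of_nonneg (by positivity), Real.norm_of_nonneg (Real.exp_pos _).le] at hx
  calc A * x ^ p ≤ (|A| + 1) * x ^ p := by
        gcongr
        linarith [le_abs_self A]
    _ ≤ (|A| + 1) * ((|A| + 1)⁻¹ * Real.exp (a * x)) := by gcongr
    _ = _ := by field_simp

/-- The inequalities between the scales which hold in high dimension, `x` being the logarithm of
the dimension. -/
structure HighDim (m T : ℕ) (C ε δ x r : ℝ) : Prop where
  one_le_C : 1 ≤ C
  one_le_r : 1 ≤ r
  le_r : x ≤ r
  r_sq : r ^ 2 = x ^ 3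
  le_x : 64 * C ≤ x
  time_le : (T : ℝ) ≤ Real.exp x
  spike : (4 * C * r) ^ m * (r + 2) ≤ Real.exp (δ * x)
  small : C * (Real.exp (-(ε * x)) + 2 * r / Real.exp (x / 2)) ≤ 1 / 2
  init : Real.exp (-(ε * x)) ≤ (1 / 2) ^ (m - 1)
  norms : 2 * x ^ 3 ≤ Real.exp x / 8
  moderate : (4 * C * r) ^ m * (4 * (T + 1) ^ 2 * (Real.exp (-(x / (64 * C)) ^ 2 / 2) +
    Real.exp (-Real.exp x / 8))) ≤ 1 / 512
  large : 4 * (T + 1) ^ 2 * (Real.exp (-(2 * r) ^ 2 / 2) + Real.exp (-Real.exp x / 8)) ≤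
    Real.exp (-(m * x)) * Real.exp (-r ^ 2 / 2) / 768
  past : 16 * C * (4 * r) ^ m ≤ Real.exp (ε * x)

/-- With `r = x√x`, Gaussian tails at multiples of `r` have exponent of order x³ = (log n)³. The
remaining requirements compare powers of `x` with exponentials. -/
theorem eventually_highDim (m T : ℕ) {C ε δ : ℝ} (hC : 1 ≤ C) (hε : 0 < ε) (hδ : 0 < δ) :
    ∀ᶠ x : ℝ in Filter.atTop, HighDim m T C ε δ x (x * √x) := by
  -- 8192 = 2 · 64², from the exponent (x / (64 C))² / 2 of the moderate tail.
  have ha : (0 : ℝ) < 1 / (8192 * C ^ 2) := by positivity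
  filter_upwards [Filter.eventually_ge_atTop (64 * C), Filter.eventually_ge_atTop ((m : ℝ) + 1),
    eventually_mul_pow_le_exp T 0 one_pos, eventually_mul_pow_le_exp (3 * (4 * C) ^ m) (2 * m + 2) hδ,
    eventually_mul_pow_le_exp (4 * C) 0 hε, eventually_mul_pow_le_exp (8 * C) 2 (one_half_pos),
    eventually_mul_pow_le_exp (2 ^ (m - 1)) 0 hε, eventually_mul_pow_le_exp 16 3 one_pos,
    eventually_mul_pow_le_exp (4096 * (T + 1) ^ 2 * (4 * C) ^ m) (2 * m) ha,
    eventually_mul_pow_le_exp (6144 * (T + 1) ^ 2) 0 one_pos,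
    eventually_mul_pow_le_exp (16 * C * 4 ^ m) (2 * m) hε]
    with x h1 h2 h3 h4 h5 h6 h7 h8 h9 h10 h11
  have hx1 : 1 ≤ x := by linarith
  have hx0 : 0 < x := by linarith
  simp only [pow_zero, mul_one, one_mul] at h3 h5 h7 h8 h10
  have hs1 : 1 ≤ √x := by rwa [Real.one_le_sqrt]
  have hsx : √x ≤ x := by
    rw [Real.sqrt_le_left hx0.le]
    nlinarith
  have hr1 : x ≤ x * √x := by nlinarith
  have hr2 : x * √x ≤ x ^ 2 := by nlinarith
  have hrsq : (x * √x) ^ 2 = x ^ 3 := by rw [mul_pow, Real.sq_sqrt hx0.le]; ring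
  have hr0 : 0 ≤ x * √x := by linarith
  have hnorm : 2 * x ^ 3 ≤ Real.exp x / 8 := by linarith
  have hx3 : x ≤ x ^ 3 := le_self_pow₀ hx1 (by norm_num)
  have hpow : (4 * C * (x * √x)) ^ m ≤ (4 * C) ^ m * x ^ (2 * m) := by
    rw [pow_mul, ← mul_pow]
    gcongr
  refine ⟨hC, hx1.trans hr1, hr1, hrsq, h1, h3, ?_, ?_, ?_, hnorm, ?_, ?_, ?_⟩
  · calc (4 * C * (x * √x)) ^ m * (x * √x + 2) ≤ ((4 * C) ^ m * x ^ (2 * m)) * (3 * x ^ 2) := by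
          gcongr
          linarith [one_le_pow₀ hx1 (n := 2)]
      _ = 3 * (4 * C) ^ m * x ^ (2 * m + 2) := by ring
      _ ≤ _ := h4
  · have e1 : C * Real.exp (-(ε * x)) ≤ 1 / 4 := by
      rw [Real.exp_neg, ← div_eq_mul_inv, div_le_iff₀ (Real.exp_pos _)]
      linarith
    have e2 : C * (2 * (x * √x) / Real.exp (x / 2)) ≤ 1 / 4 := by
      rw [← mul_div_assoc, div_le_iff₀ (Real.exp_pos _), show x / 2 = 1 / 2 * x by ring]
      have : C * (x * √x) ≤ C * x ^ 2 := by gcongr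
      linarith
    linarith
  · rw [Real.exp_neg, one_div, inv_pow]
    gcongr
  · have e1 : Real.exp (-Real.exp x / 8) ≤ Real.exp (-(1 / (8192 * C ^ 2) * x)) := by
      gcongr
      have : 1 / (8192 * C ^ 2) ≤ 1 := by
        rw [div_le_one (by positivity)]
        nlinarith
      have := mul_le_mul_of_nonneg_right this hx0.le
      linarith
    have e2 : Real.exp (-(x / (64 * C)) ^ 2 / 2) ≤ Real.exp (-(1 / (8192 * C ^ 2) * x)) := by
      gcongr
      have : -(x / (64 * C)) ^ 2 / 2 = -(1 / (8192 * C ^ 2) * x ^ 2) := by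
        field_simp
        ring
      rw [this]
      gcongr
      exact le_self_pow₀ hx1 (by norm_num)
    calc (4 * C * (x * √x)) ^ m * (4 * (T + 1) ^ 2 * (Real.exp (-(x / (64 * C)) ^ 2 / 2) +
          Real.exp (-Real.exp x / 8)))
        ≤ ((4 * C) ^ m * x ^ (2 * m)) * (4 * (T + 1) ^ 2 *
          (Real.exp (-(1 / (8192 * C ^ 2) * x)) + Real.exp (-(1 / (8192 * C ^ 2) * x)))) := by gcongr
      _ = (4096 * (T + 1) ^ 2 * (4 * C) ^ m * x ^ (2 * m)) *
          Real.exp (-(1 / (8192 * C ^ 2) * x)) / 512 := by ring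
      _ ≤ Real.exp (1 / (8192 * C ^ 2) * x) * Real.exp (-(1 / (8192 * C ^ 2) * x)) / 512 := by gcongr
      _ = _ := by rw [← Real.exp_add, add_neg_cancel, Real.exp_zero]
  · have e1 : Real.exp (-Real.exp x / 8) ≤ Real.exp (-(2 * x ^ 3)) := by
      gcongr
      linarith
    have e2 : -(2 * (x * √x)) ^ 2 / 2 = -(2 * x ^ 3) := by
      rw [mul_pow, hrsq]; ring
    rw [e2, hrsq]
    calc 4 * ((T : ℝ) + 1) ^ 2 * (Real.exp (-(2 * x ^ 3)) + Real.exp (-Real.exp x / 8))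
        ≤ 4 * ((T : ℝ) + 1) ^ 2 * (Real.exp (-(2 * x ^ 3)) + Real.exp (-(2 * x ^ 3))) := by gcongr
      _ = (6144 * ((T : ℝ) + 1) ^ 2) * Real.exp (-(2 * x ^ 3)) / 768 := by ring
      _ ≤ Real.exp x * Real.exp (-(2 * x ^ 3)) / 768 := by gcongr
      _ ≤ Real.exp (-(m * x)) * Real.exp (-x ^ 3 / 2) / 768 := by
        rw [← Real.exp_add, ← Real.exp_add]
        refine div_le_div_of_nonneg_right (Real.exp_le_exp.2 ?_) (by norm_num)
        have e3 : (m + 1) * x ≤ x ^ 3 := by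
          calc (m + 1) * x ≤ x * x := by gcongr
            _ = x ^ 2 := by ring
            _ ≤ x ^ 3 := pow_le_pow_right₀ hx1 (by norm_num)
        linarith
  · calc 16 * C * (4 * (x * √x)) ^ m ≤ 16 * C * (4 * x ^ 2) ^ m := by gcongr
      _ = 16 * C * 4 ^ m * x ^ (2 * m) := by rw [mul_pow, pow_mul]; ring
      _ ≤ _ := h11

end Asymptotics

/-! ### Probabilistic estimates in high dimension -/

section HighDimension

variable {m n T : ℕ} {β C ε δ x r : ℝ} {u v : Vec n}

theorem isInnovationIteration_powerIter {X : Tensor (m + 1) n} {ξ : ℕ → Vec n} {L : ℕ → ℕ → ℝ}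
    (h1 : ∀ t < T, 0 ≤ L t t)
    (h2 : ∀ s t, s ≤ t → t < T → (inner ℝ (powerIter X u s) (powerIter X u t)) ^ m =
      ∑ r ∈ Finset.range (s + 1), L s r * L t r)
    (h3 : ∀ t < T, act X (powerIter X u t) = (β * (inner ℝ (powerIter X u t) v) ^ m) • v +
      (√(n : ℝ))⁻¹ • ∑ r ∈ Finset.range (t + 1), L t r • ξ r) :
    IsInnovationIteration m T β v ξ (powerIter X u) (fun t => act X (powerIter X u t)) L :=
  ⟨h1, h2, h3, fun _ => rfl⟩

/-- The assumptions on the signal strength and the initialization, in terms of the logarithm `x`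
of the dimension. -/
structure WeakSignal (m : ℕ) {n : ℕ} (ε δ x β : ℝ) (u v : Vec n) : Prop where
  exp_eq : Real.exp x = n
  two_le : 2 ≤ m
  eps_pos : 0 < ε
  log_pos : 0 < x
  unit_init : ‖u‖ = 1
  unit_spike : ‖v‖ = 1
  le_beta : Real.exp (ε * x) ≤ |β|
  init_le : |β * (inner ℝ u v) ^ (m - 1)| ≤ Real.exp (-(ε * x))
  beta_le : |β| ≤ √(n : ℝ) ^ (m - 1) * Real.exp (-(δ * x))

theorem WeakSignal.dim_pos (h : WeakSignal m ε δ x β u v) : 0 < n := by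
  have h1 := h.exp_eq ▸ Real.exp_pos x
  exact_mod_cast h1

theorem WeakSignal.one_le_beta (h : WeakSignal m ε δ x β u v) : 1 ≤ |β| :=
  (Real.one_le_exp (mul_nonneg h.eps_pos.le h.log_pos.le)).trans h.le_beta

theorem WeakSignal.sqrt_eq (h : WeakSignal m ε δ x β u v) : √(n : ℝ) = Real.exp (x / 2) := by
  rw [Real.exp_half, h.exp_eq]

/-- The margin n^(-δ) in the upper bound on |β| beats any power of log n. Thus even the signal
allowed by the scale 2r is small enough, with the factor r + 2, for density comparison on [-r, r].
-/
theorem HighDim.spike_le_one (hd : HighDim m T C ε δ x r) (h : WeakSignal m ε δ x β u v) :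
    |β| / √(n : ℝ) ^ (m - 1) * (4 * C * r) ^ m * (r + 2) ≤ 1 := by
  have hn := h.dim_pos
  have hsn : 0 < √(n : ℝ) ^ (m - 1) := by positivity
  have hr := hd.one_le_r
  have hC := hd.one_le_C
  calc |β| / √(n : ℝ) ^ (m - 1) * (4 * C * r) ^ m * (r + 2)
      ≤ Real.exp (-(δ * x)) * ((4 * C * r) ^ m * (r + 2)) := by
        rw [mul_assoc]
        gcongr
        rw [div_le_iff₀ hsn, mul_comm]
        exact h.beta_le
    _ ≤ Real.exp (-(δ * x)) * Real.exp (δ * x) := by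
        gcongr
        exact hd.spike
    _ = 1 := by rw [← Real.exp_add, neg_add_cancel, Real.exp_zero]


theorem HighDim.noise_le_one (hd : HighDim m T C ε δ x r) (h : WeakSignal m ε δ x β u v) {s : ℝ}
    (hs : 0 ≤ s) (hsr : s ≤ 2 * r) : |β| * (s / √(n : ℝ)) ^ (m - 1) ≤ 1 := by
  have hn := h.dim_pos
  have hr := hd.one_le_r
  have hC := hd.one_le_C
  have h1 : s ^ (m - 1) ≤ (4 * C * r) ^ m * (r + 2) := by
    have h4 : 2 * r ≤ 4 * C * r := by nlinarith
    calc s ^ (m - 1) ≤ (4 * C * r) ^ (m - 1) := by gcongr; linarith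
      _ ≤ (4 * C * r) ^ m := pow_le_pow_right₀ (by linarith) (by omega)
      _ ≤ _ := le_mul_of_one_le_right (by positivity) (by linarith)
  calc |β| * (s / √(n : ℝ)) ^ (m - 1) = |β| / √(n : ℝ) ^ (m - 1) * s ^ (m - 1) := by
        rw [div_pow]; ring
    _ ≤ |β| / √(n : ℝ) ^ (m - 1) * ((4 * C * r) ^ m * (r + 2)) := by gcongr
    _ ≤ 1 := by rw [← mul_assoc]; exact hd.spike_le_one h

theorem HighDim.small' (hd : HighDim m T C ε δ x r) (h : WeakSignal m ε δ x β u v) {s : ℝ}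
    (hsr : s ≤ 2 * r) : C * (Real.exp (-(ε * x)) + s / √(n : ℝ)) ≤ 1 / 2 := by
  have hC := hd.one_le_C
  refine le_trans ?_ hd.small
  rw [h.sqrt_eq]
  gcongr

theorem HighDim.abs_inner_init_le (hd : HighDim m T C ε δ x r) (h : WeakSignal m ε δ x β u v) :
    |inner ℝ u v| ≤ 1 / 2 := by
  have h1 := h.init_le
  have h2 := h.one_le_beta
  rw [abs_mul, abs_pow] at h1
  have h3 : |inner ℝ u v| ^ (m - 1) ≤ (1 / 2) ^ (m - 1) :=
    (le_mul_of_one_le_left (by positivity) h2).trans (h1.trans hd.init)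
  have h4 := h.two_le
  exact le_of_pow_le_pow_left₀ (by omega) (by norm_num) h3

theorem HighDim.failure_le (hd : HighDim m T C ε δ x r) (h : WeakSignal m ε δ x β u v) :
    4 * (T + 1) ^ 2 * (Real.exp (-(2 * r) ^ 2 / 2) + Real.exp (-(n : ℝ) / 8)) ≤
      Real.exp (-(x ^ 3 / 8)) := by
  have h1 := hd.large
  rw [h.exp_eq] at h1
  refine h1.trans ?_
  have h2 : Real.exp (-(m * x)) ≤ 1 :=
    Real.exp_le_one_iff.2 (by have := h.log_pos; have : (0 : ℝ) ≤ m * x := by positivity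
                              linarith)
  have h3 : Real.exp (-r ^ 2 / 2) ≤ Real.exp (-(x ^ 3 / 8)) := by
    rw [hd.r_sq]
    gcongr
    have : 0 ≤ x ^ 3 := pow_nonneg h.log_pos.le 3
    linarith
  have h4 := Real.exp_pos (-r ^ 2 / 2)
  have h5 : Real.exp (-(m * x)) * Real.exp (-r ^ 2 / 2) ≤ 1 * Real.exp (-r ^ 2 / 2) := by gcongr
  linarith

/-- The conclusions of `exists_iterate_bounds` for the constant `C`. -/
def IterateBounds (m T : ℕ) (C : ℝ) : Prop :=
  ∀ (n : ℕ) (β : ℝ) (v : Vec n) (ξ u y : ℕ → Vec n) (L : ℕ → ℕ → ℝ) (s η : ℝ),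
    IsInnovationIteration m T β v ξ u y L → 0 < n → ‖v‖ = 1 → ‖u 0‖ = 1 → 0 ≤ s →
    TypicalAt T v s ξ u → 1 ≤ |β| → 0 ≤ η → η ≤ 1 →
    |β * (inner ℝ (u 0) v) ^ (m - 1)| ≤ η → |β| * (s / √(n : ℝ)) ^ (m - 1) ≤ 1 →
    C * (η + s / √(n : ℝ)) ≤ 1 → ∀ t ≤ T,
    ‖u t‖ = 1 ∧
    |inner ℝ (u t) v| ≤ C * (η ^ t * |inner ℝ (u 0) v| + s / √(n : ℝ)) ∧
    (1 ≤ t → t < T → ‖∑ r ∈ Finset.range (t + 1), L t r • ξ r - ξ t‖ ≤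
      C * √(n : ℝ) * (η ^ t * |inner ℝ (u 0) v| + s / √(n : ℝ)) ^ m)

theorem IterateBounds.apply (hC : IterateBounds m T C) (hd : HighDim m T C ε δ x r)
    (h : WeakSignal m ε δ x β u v) {ξ w y : ℕ → Vec n} {L : ℕ → ℕ → ℝ} {s : ℝ}
    (hit : IsInnovationIteration m T β v ξ w y L) (hw : w 0 = u) (hs : 0 ≤ s) (hsr : s ≤ 2 * r)
    (htyp : TypicalAt T v s ξ w) (t : ℕ) (ht : t ≤ T) :
    ‖w t‖ = 1 ∧
    |inner ℝ (w t) v| ≤ C * (Real.exp (-(ε * x)) ^ t * |inner ℝ u v| + s / √(n : ℝ)) ∧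
    (1 ≤ t → t < T → ‖∑ r ∈ Finset.range (t + 1), L t r • ξ r - ξ t‖ ≤
      C * √(n : ℝ) * (Real.exp (-(ε * x)) ^ t * |inner ℝ u v| + s / √(n : ℝ)) ^ m) := by
  have h1 := hC n β v ξ w y L s (Real.exp (-(ε * x))) hit h.dim_pos h.unit_spike
    (by rw [hw, h.unit_init]) hs htyp h.one_le_beta (Real.exp_pos _).le
    (Real.exp_le_one_iff.2 (by
      have := mul_nonneg h.eps_pos.le h.log_pos.le
      linarith))
    (by rw [hw]; exact h.init_le) (hd.noise_le_one h hs hsr)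
    ((hd.small' h hsr).trans (by norm_num)) t ht
  rwa [hw] at h1

variable {Ω : Type*} [MeasurableSpace Ω] {P : Measure Ω} [IsProbabilityMeasure P]
  {Z : Ω → Tensor (m + 1) n}

theorem HighDim.time_le_pow (hd : HighDim m T C ε δ x r) (h : WeakSignal m ε δ x β u v) :
    T ≤ n ^ m := by
  have h1 := hd.time_le
  rw [h.exp_eq] at h1
  have h2 : T ≤ n := by exact_mod_cast h1
  have := h.two_le
  exact h2.trans (Nat.le_self_pow (by omega) n)

/-- On the typical event at scale 2r, every overlap with `v` is at most 1/2: the initial one by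
assumption, the later ones by contraction. -/
theorem measure_powerIter_near_spike_le (hC : IterateBounds m T C) (hd : HighDim m T C ε δ x r)
    (h : WeakSignal m ε δ x β u v) (hZ : IsGaussianNoise P Z) :
    P {ω | ∃ t ≤ T, ‖powerIter (spiked β v (Z ω)) u t - v‖ < 1 ∨
      ‖powerIter (spiked β v (Z ω)) u t + v‖ < 1} ≤ ENNReal.ofReal (Real.exp (-(x ^ 3 / 8))) := by
  obtain ⟨ξ, hξ, hum, hind, hL⟩ :=
    exists_powerIter_innovations h.dim_pos hZ β u v (hd.time_le_pow h)
  have hr := hd.one_le_r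
  have hp := measure_not_typicalAt_le h.unit_spike hξ hum
    (fun q ω => norm_powerIter_le_one _ h.unit_init.le q) hind (s := 2 * r) (by linarith)
  refine le_trans (measure_mono ?_) (hp.trans (ENNReal.ofReal_le_ofReal (hd.failure_le h)))
  intro ω hω htyp
  obtain ⟨L, h1, h2, h3⟩ := hL ω
  have hit := isInnovationIteration_powerIter h1 h2 h3
  obtain ⟨t, ht, hlt⟩ := hω
  obtain ⟨hu, hov, -⟩ := hC.apply hd h hit rfl (by linarith) le_rfl htyp t ht
  have hhalf : |inner ℝ (powerIter (spiked β v (Z ω)) u t) v| ≤ 1 / 2 := by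
    rcases Nat.eq_zero_or_pos t with rfl | htpos
    · exact hd.abs_inner_init_le h
    · refine hov.trans (le_trans ?_ (hd.small' h (s := 2 * r) le_rfl))
      have hCC := hd.one_le_C
      gcongr
      have h5 : |inner ℝ u v| ≤ 1 := (hd.abs_inner_init_le h).trans (by norm_num)
      have h6 : Real.exp (-(ε * x)) ≤ 1 := Real.exp_le_one_iff.2 (by
        have := mul_nonneg h.eps_pos.le h.log_pos.le
        linarith)
      have h7 : Real.exp (-(ε * x)) ^ t ≤ Real.exp (-(ε * x)) :=
        pow_le_of_le_one (Real.exp_pos _).le h6 (by omega)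
      calc _ ≤ Real.exp (-(ε * x)) * 1 := by gcongr
        _ = _ := mul_one _
  obtain ⟨h8, h9⟩ := one_le_norm_sub_of_inner_le hu h.unit_spike hhalf
  rcases hlt with hlt | hlt <;> linarith

/-- The size of the signal in the direction of the spike, relative to the noise, when the overlap
has reached the noise level. -/
theorem abs_signal_le (h : WeakSignal m ε δ x β u v) {a c s : ℝ}
    (ha : |a| ≤ c * (2 * s / √(n : ℝ))) :
    |√(n : ℝ) * (β * a ^ m)| ≤ |β| / √(n : ℝ) ^ (m - 1) * (2 * c * s) ^ m := by
  have hn := h.dim_pos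
  have hsn : 0 < √(n : ℝ) := by positivity
  have h2 := h.two_le
  rw [abs_mul, abs_mul, abs_pow, abs_of_pos hsn]
  calc √(n : ℝ) * (|β| * |a| ^ m) ≤ √(n : ℝ) * (|β| * (c * (2 * s / √(n : ℝ))) ^ m) := by gcongr
    _ = √(n : ℝ) * (|β| * ((2 * c * s) ^ m / √(n : ℝ) ^ m)) := by
      rw [← div_pow]; congr 3; ring
    _ = _ := by
      rw [show √(n : ℝ) ^ m = √(n : ℝ) ^ (m - 1) * √(n : ℝ) by
        rw [← pow_succ, Nat.sub_add_cancel (by omega)]]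
      field_simp

theorem exp_neg_le_gaussianPDFReal (y : ℝ) : Real.exp (-y ^ 2 / 2) / 3 ≤ gaussianPDFReal 0 1 y := by
  rw [gaussianPDFReal_zero_one, div_eq_inv_mul]
  gcongr
  rw [Real.sqrt_le_left (by norm_num)]
  have := Real.pi_lt_four
  linarith

/-- A crude polynomial lower bound on the relative signal, used to see that the failure probability
is far below the transport tolerance times the density at `r`. -/
theorem WeakSignal.exp_neg_le (h : WeakSignal m ε δ x β u v) :
    Real.exp (-(m * x)) ≤ |β| / √(n : ℝ) ^ (m - 1) := by
  have hn := h.dim_pos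
  have hsn : 0 < √(n : ℝ) ^ (m - 1) := by positivity
  have hx := h.log_pos
  rw [le_div_iff₀ hsn]
  refine le_trans ?_ h.one_le_beta
  rw [h.sqrt_eq, ← Real.exp_nat_mul, ← Real.exp_add]
  apply Real.exp_le_one_iff.2
  have h1 : ((m - 1 : ℕ) : ℝ) ≤ m := by exact_mod_cast Nat.sub_le m 1
  have h2 : ((m - 1 : ℕ) : ℝ) * (x / 2) ≤ m * (x / 2) := by gcongr
  have h3 : 0 ≤ (m : ℝ) * x := by positivity
  linarith

/-- By time T - 1, the initial overlap has decayed to 1/√n, so the last step adds to the newest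
innovation a signal `W` along `v` that is independent of it. The transport absorbs `W` up to the
target scale. The older innovations are negligible because |β| ≥ n^ε outweighs the logarithms in
their bound. -/
theorem exists_gaussian_near_powerIter (hC : IterateBounds m T C) (hd : HighDim m T C ε δ x r)
    (h : WeakSignal m ε δ x β u v) (hZ : IsGaussianNoise P Z) (hT : 2 ≤ T)
    (hα : Real.exp (-(ε * x)) ^ (T - 1) * |inner ℝ u v| ≤ 1 / √(n : ℝ)) :
    ∃ ξ' : Ω → Vec n, HasLaw ξ' (stdGaussian (Vec n)) P ∧
      P {ω | |β| * (x / √(n : ℝ)) ^ m <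
        ‖powerIter (spiked β v (Z ω)) u T - ‖ξ' ω‖⁻¹ • ξ' ω‖} ≤
        ENNReal.ofReal (4 * Real.exp (-(x ^ 3 / 8))) := by
  have hn := h.dim_pos
  have hn' : (0 : ℝ) < n := by exact_mod_cast hn
  have hsn : 0 < √(n : ℝ) := by positivity
  have hr := hd.one_le_r
  have hCC := hd.one_le_C
  have hx64 := hd.le_x
  have hx := h.log_pos
  have hx1 : 1 ≤ x := by linarith
  have hxm : 1 ≤ x ^ m := one_le_pow₀ hx1
  have hm := h.two_le
  obtain ⟨ξ, hξ, hum, hind, hL⟩ := exists_powerIter_innovations hn hZ β u v (hd.time_le_pow h)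
  have hp := fun s (hs : 0 ≤ s) => measure_not_typicalAt_le h.unit_spike hξ hum
    (fun q ω => norm_powerIter_le_one _ h.unit_init.le q) hind (s := s) hs
  obtain ⟨b, hb⟩ : ∃ b, b = |β| / √(n : ℝ) ^ (m - 1) := ⟨_, rfl⟩
  have hb0 : 0 ≤ b := by rw [hb]; positivity
  obtain ⟨t, rfl⟩ : ∃ t, T = t + 1 := ⟨T - 1, by omega⟩
  rw [Nat.add_sub_cancel] at hα
  -- the perturbation of the newest innovation in the direction of the spike
  let W : Ω → ℝ := fun ω => √(n : ℝ) * (β * (inner ℝ (powerIter (spiked β v (Z ω)) u t) v) ^ m)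
  have hgm : Measurable fun w : Vec n => √(n : ℝ) * (β * (inner ℝ w v) ^ m) := by fun_prop
  have hWm : AEMeasurable W P := hgm.comp_aemeasurable (hum t)
  have hWind : IndepFun W (ξ t) P :=
    (hind t t le_rfl (by omega)).comp hgm measurable_id
  have hWtyp : ∀ s, 1 ≤ s → s ≤ 2 * r → ∀ ω,
      TypicalAt (t + 1) v s (fun r => ξ r ω) (fun q => powerIter (spiked β v (Z ω)) u q) →
      |W ω| ≤ b * (2 * C * s) ^ m := by
    intro s hs hsr ω htyp
    obtain ⟨L, h1, h2, h3⟩ := hL ω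
    obtain ⟨-, hov, -⟩ := hC.apply hd h (isInnovationIteration_powerIter h1 h2 h3) rfl
      (by linarith) hsr htyp t (by omega)
    rw [hb]
    refine abs_signal_le h (hov.trans ?_)
    gcongr
    calc _ ≤ 1 / √(n : ℝ) + s / √(n : ℝ) := by gcongr
      _ ≤ s / √(n : ℝ) + s / √(n : ℝ) := by gcongr
      _ = _ := by ring
  have : IsProbabilityMeasure (P.map W) := Measure.isProbabilityMeasure_map hWm
  have hμ : ∀ s, 1 ≤ s → s ≤ 2 * r → (P.map W).real {w | b * (2 * C * s) ^ m < |w|} ≤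
      4 * ((t + 1 : ℕ) + 1) ^ 2 * (Real.exp (-s ^ 2 / 2) + Real.exp (-(n : ℝ) / 8)) := by
    intro s hs hsr
    rw [measureReal_def, Measure.map_apply_of_aemeasurable hWm
      (measurableSet_lt measurable_const (by fun_prop))]
    refine ENNReal.toReal_le_of_le_ofReal (by positivity) (le_trans (measure_mono ?_)
      (hp s (by linarith)))
    intro ω hω htyp
    exact absurd (hWtyp s hs hsr ω htyp) (not_le.2 hω)
  obtain ⟨tr, htrm, htrmap, htr⟩ := exists_transport (P.map W)
  have hspike := hd.spike_le_one h
  rw [← hb] at hspike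
  have h4Cr : 1 ≤ 4 * C * r := by nlinarith
  have hxr : x ^ m ≤ (4 * C * r) ^ m := by
    have := hd.le_r
    gcongr
    nlinarith
  have hωle : b * (4 * C * r) ^ m ≤ 1 / 3 := by
    have : 0 ≤ b * (4 * C * r) ^ m := by positivity
    nlinarith
  have htransport : ∀ y, |y| ≤ r → |tr y - y| ≤ b * x ^ m / 16 := by
    intro y hy
    -- Two scales for `W`: `s = 2r`, exceeded with probability below the density at `r`, and `s =
    -- x/(64C)`, exceeded with small probability and giving (x/32)^m, well below the tolerance.
    refine abs_transport_sub_le (μ := P.map W) htr (R := r) (ω := b * (2 * C * (2 * r)) ^ m)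
      (τ' := b * (2 * C * (x / (64 * C))) ^ m) (by linarith) (by positivity) ?_ (by positivity) ?_
      (by positivity) hy ?_ ?_
    · rw [show 2 * C * (2 * r) = 4 * C * r by ring]
      exact hspike
    · calc b * x ^ m / 16 * (r + 2) ≤ b * (4 * C * r) ^ m * (r + 2) := by
            gcongr
            have : b * x ^ m ≤ b * (4 * C * r) ^ m := by gcongr
            have : 0 ≤ b * x ^ m := by positivity
            linarith
        _ ≤ 1 := hspike
    · have hs1 : 1 ≤ x / (64 * C) := by rw [le_div_iff₀ (by positivity)]; linarith
      have hs2 : x / (64 * C) ≤ 2 * r := by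
        have := hd.le_r
        rw [div_le_iff₀ (by positivity)]
        nlinarith
      have e1 := hμ _ hs1 hs2
      have e2 := hd.moderate
      rw [h.exp_eq] at e2
      have e3 : b * (2 * C * (x / (64 * C))) ^ m ≤ b * x ^ m / 1024 := by
        have : 2 * C * (x / (64 * C)) = x * (1 / 32) := by field_simp; norm_num
        rw [this, mul_pow]
        have h5 : (1 / 32 : ℝ) ^ m ≤ (1 / 32) ^ 2 :=
          pow_le_pow_of_le_one (by norm_num) (by norm_num) hm
        calc b * (x ^ m * (1 / 32) ^ m) ≤ b * (x ^ m * (1 / 32) ^ 2) := by gcongr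
          _ = _ := by ring
      have e4 : b * (2 * C * (2 * r)) ^ m *
          (P.map W).real {w | b * (2 * C * (x / (64 * C))) ^ m < |w|} ≤ b * x ^ m / 512 := by
        rw [show 2 * C * (2 * r) = 4 * C * r by ring, mul_assoc]
        calc _ ≤ b * ((4 * C * r) ^ m * (4 * ((t + 1 : ℕ) + 1) ^ 2 *
              (Real.exp (-(x / (64 * C)) ^ 2 / 2) + Real.exp (-(n : ℝ) / 8)))) := by gcongr
          _ ≤ b * (1 / 512) := by gcongr
          _ ≤ b * (x ^ m / 512) := by gcongr
          _ = _ := by ring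
      have : 0 ≤ b * x ^ m := by positivity
      linarith
    · have e1 := hμ (2 * r) (by linarith) le_rfl
      have e2 := hd.large
      rw [h.exp_eq] at e2
      refine e1.trans (e2.trans ?_)
      have e3 := exp_neg_le_gaussianPDFReal r
      have e4 := h.exp_neg_le
      rw [← hb] at e4
      calc Real.exp (-(m * x)) * Real.exp (-r ^ 2 / 2) / 768
          = Real.exp (-(m * x)) * 1 / 16 * (Real.exp (-r ^ 2 / 2) / 3) / 16 := by ring
        _ ≤ b * x ^ m / 16 * gaussianPDFReal 0 1 r / 16 := by gcongr
  let ξ' : Ω → Vec n := fun ω => ξ t ω + (tr (inner ℝ (ξ t ω) v + W ω) - inner ℝ (ξ t ω) v) • v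
  have hξ' : HasLaw ξ' (stdGaussian (Vec n)) P :=
    hasLaw_transported (hξ t (by omega)) ⟨hWm, rfl⟩ hWind h.unit_spike htrm.measurable htrmap
  refine ⟨ξ', hξ', ?_⟩
  have hsub : {ω | |β| * (x / √(n : ℝ)) ^ m <
      ‖powerIter (spiked β v (Z ω)) u (t + 1) - ‖ξ' ω‖⁻¹ • ξ' ω‖} ⊆
      {ω | ¬ TypicalAt (t + 1) v (2 * r) (fun r => ξ r ω)
        (fun q => powerIter (spiked β v (Z ω)) u q)} ∪
      ({ω | r / 2 < |inner ℝ (ξ t ω) v|} ∪ {ω | ‖ξ' ω‖ < √(n : ℝ) / 2}) := by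
    intro ω hω
    by_contra hcon
    simp only [Set.mem_union, Set.mem_ofPred_eq, not_or, not_not, not_lt] at hcon
    obtain ⟨htyp, hG, hξn⟩ := hcon
    rw [Set.mem_ofPred_eq] at hω
    refine absurd hω (not_lt.2 ?_)
    obtain ⟨L, h1, h2, h3⟩ := hL ω
    obtain ⟨-, -, herr⟩ := hC.apply hd h (isInnovationIteration_powerIter h1 h2 h3) rfl
      (by linarith) le_rfl htyp t (by omega)
    have herr1 := herr (by omega) (by omega)
    have hW1 := hWtyp (2 * r) (by linarith) le_rfl ω htyp
    rw [show 2 * C * (2 * r) = 4 * C * r by ring] at hW1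
    -- Here |W| ≤ 1/3 and r ≥ 1, so r/2 for the Gaussian component leaves room.
    have hY : |inner ℝ (ξ t ω) v + W ω| ≤ r :=
      (abs_add_le _ _).trans (by linarith)
    have hτ := htransport _ hY
    obtain ⟨g, hg⟩ : ∃ g, g = W ω • v + ∑ r ∈ Finset.range (t + 1), L t r • ξ r ω := ⟨_, rfl⟩
    have hug : powerIter (spiked β v (Z ω)) u (t + 1) = ‖g‖⁻¹ • g := by
      have e1 : act (spiked β v (Z ω)) (powerIter (spiked β v (Z ω)) u t) =
          (√(n : ℝ))⁻¹ • g := by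
        rw [h3 t (by omega), hg, smul_add, smul_smul]
        congr 2
        simp only [W]
        field_simp
      rw [powerIter, e1, normalize_smul_of_pos (by positivity)]
    have hdiff : ‖g - ξ' ω‖ ≤ b * x ^ m / 8 := by
      -- The signal cancels into the displacement of the transport at G + W, so its worst-case size
      -- does not enter.
      have e1 : g - ξ' ω = (inner ℝ (ξ t ω) v + W ω - tr (inner ℝ (ξ t ω) v + W ω)) • v +
          (∑ r ∈ Finset.range (t + 1), L t r • ξ r ω - ξ t ω) := by
        rw [hg]
        simp only [ξ']
        module
      have e2 : C * √(n : ℝ) * (Real.exp (-(ε * x)) ^ t * |inner ℝ u v| + 2 * r / √(n : ℝ)) ^ m ≤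
          b * x ^ m / 16 := by
        calc _ ≤ C * √(n : ℝ) * (1 / √(n : ℝ) + 2 * r / √(n : ℝ)) ^ m := by gcongr
          _ ≤ C * √(n : ℝ) * (4 * r / √(n : ℝ)) ^ m := by
            rw [← add_div]
            gcongr
            linarith
          _ = 16 * C * (4 * r) ^ m / √(n : ℝ) ^ (m - 1) / 16 := by
            rw [div_pow, show √(n : ℝ) ^ m = √(n : ℝ) ^ (m - 1) * √(n : ℝ) by
              rw [← pow_succ, Nat.sub_add_cancel (by omega)]]
            field_simp
          _ ≤ |β| / √(n : ℝ) ^ (m - 1) / 16 := by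
            gcongr
            exact hd.past.trans h.le_beta
          _ ≤ b * x ^ m / 16 := by
            rw [← hb]
            gcongr
            exact le_mul_of_one_le_right hb0 hxm
      rw [e1]
      refine (norm_add_le _ _).trans ?_
      rw [norm_smul, h.unit_spike, mul_one, Real.norm_eq_abs, abs_sub_comm]
      linarith
    have hξ0 : 0 < ‖ξ' ω‖ := by
      have : 0 < √(n : ℝ) / 2 := by positivity
      linarith
    rw [hug]
    calc ‖‖g‖⁻¹ • g - ‖ξ' ω‖⁻¹ • ξ' ω‖ ≤ 2 * ‖g - ξ' ω‖ / ‖ξ' ω‖ :=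
          norm_normalize_sub_le g (ξ' ω) (norm_pos_iff.1 hξ0)
      _ ≤ 2 * (b * x ^ m / 8) / (√(n : ℝ) / 2) := by gcongr
      _ = b * x ^ m / √(n : ℝ) / 2 := by ring
      _ ≤ b * x ^ m / √(n : ℝ) := by
        have : 0 ≤ b * x ^ m / √(n : ℝ) := by positivity
        linarith
      _ = |β| * (x / √(n : ℝ)) ^ m := by
        rw [hb, div_pow, show √(n : ℝ) ^ m = √(n : ℝ) ^ (m - 1) * √(n : ℝ) by
          rw [← pow_succ, Nat.sub_add_cancel (by omega)]]
        field_simp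
  have hx3 : 0 ≤ x ^ 3 := by positivity
  have p1 := (hp (2 * r) (by linarith)).trans (ENNReal.ofReal_le_ofReal (hd.failure_le h))
  have p2 : P {ω | r / 2 < |inner ℝ (ξ t ω) v|} ≤
      ENNReal.ofReal (2 * Real.exp (-(x ^ 3 / 8))) := by
    refine (HasLaw.measure_le (hξ t (by omega)) {z | r / 2 < |inner ℝ z v|}).trans
      ((stdGaussian_abs_inner_gt_le h.unit_spike.le (by linarith)).trans
        (ENNReal.ofReal_le_ofReal ?_))
    rw [← hd.r_sq]
    apply le_of_eq
    congr 2
    ring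
  have p3 : P {ω | ‖ξ' ω‖ < √(n : ℝ) / 2} ≤ ENNReal.ofReal (Real.exp (-(x ^ 3 / 8))) := by
    refine (HasLaw.measure_le hξ' {z | ‖z‖ < √(n : ℝ) / 2}).trans
      ((stdGaussian_norm_lt_le n).trans (ENNReal.ofReal_le_ofReal (Real.exp_le_exp.2 ?_)))
    have := hd.norms
    rw [h.exp_eq] at this
    linarith
  refine (measure_mono hsub).trans ((measure_union_le _ _).trans
    ((add_le_add p1 ((measure_union_le _ _).trans (add_le_add p2 p3))).trans_eq ?_))
  rw [← ENNReal.ofReal_add (by positivity) (by positivity),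
    ← ENNReal.ofReal_add (by positivity) (by positivity)]
  congr 1
  ring

end HighDimension

/-! ### Translation of the hypotheses and the main theorem -/

section Conclusion

variable {m n T : ℕ} {β ε δ : ℝ} {u v : Vec n}

theorem rpow_neg_mul_log_sq (hn : 0 < n) :
    (n : ℝ) ^ (-(1 / 8 * Real.log n ^ 2)) = Real.exp (-(Real.log n ^ 3 / 8)) := by
  rw [Real.rpow_def_of_pos (by exact_mod_cast hn)]
  congr 1
  ring

theorem weakSignal_log (hm : 2 ≤ m) (hε : 0 < ε) (hn : 2 ≤ n) (hu : ‖u‖ = 1) (hv : ‖v‖ = 1)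
    (h1 : (n : ℝ) ^ ε ≤ |β|) (h2 : |β * (inner ℝ u v) ^ (m - 1)| ≤ (n : ℝ) ^ (-ε))
    (h3 : |β| ≤ (n : ℝ) ^ (((m : ℝ) - 1) / 2 - δ)) :
    WeakSignal m ε δ (Real.log n) β u v := by
  have hn0 : (0 : ℝ) < n := by positivity
  have hn1 : (1 : ℝ) < n := by exact_mod_cast hn
  refine ⟨Real.exp_log hn0, hm, hε, Real.log_pos hn1, hu, hv, ?_, ?_, ?_⟩
  · rwa [mul_comm, ← Real.rpow_def_of_pos hn0]
  · rwa [← mul_neg_one, mul_comm ε, mul_assoc, mul_neg_one, ← Real.rpow_def_of_pos hn0]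
  · refine h3.trans_eq ?_
    rw [Real.rpow_sub hn0, Real.rpow_def_of_pos hn0 δ, div_eq_mul_inv, ← Real.exp_neg,
      mul_comm (Real.log n), Real.sqrt_eq_rpow, ← Real.rpow_natCast, ← Real.rpow_mul hn0.le]
    congr 2
    push_cast [Nat.cast_sub (show 1 ≤ m by omega)]
    ring

theorem WeakSignal.log_abs_le {x : ℝ} (h : WeakSignal m ε δ x β u v) :
    Real.log |β| ≤ ((m : ℝ) - 1) * x / 2 - δ * x := by
  have hb : 0 < |β| := by linarith [h.one_le_beta]
  rw [Real.log_le_iff_le_exp hb]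
  refine h.beta_le.trans_eq ?_
  have h2 := h.two_le
  rw [h.sqrt_eq, ← Real.exp_nat_mul, ← Real.exp_add]
  congr 1
  push_cast [Nat.cast_sub (show 1 ≤ m by omega)]
  ring

/-- The number of steps is large enough to bring the initial overlap to the noise level. -/
theorem WeakSignal.time_bounds {x : ℝ} (h : WeakSignal m ε δ x β u v) (hδ : 0 < δ)
    (hT : 1 + 1 / ε * (1 / 2 - Real.log |β| / (((m : ℝ) - 1) * x)) ≤ (T : ℝ)) :
    2 ≤ T ∧ Real.exp (-(ε * x)) ^ (T - 1) * |inner ℝ u v| ≤ 1 / √(n : ℝ) := by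
  have hx := h.log_pos
  have hε := h.eps_pos
  have h2 := h.two_le
  have hm : (0 : ℝ) < (m : ℝ) - 1 := by
    have : (2 : ℝ) ≤ m := by exact_mod_cast h2
    linarith
  have hb : 0 < |β| := by linarith [h.one_le_beta]
  have key : ((m : ℝ) - 1) * x / 2 - Real.log |β| ≤ ε * ((T : ℝ) - 1) * (((m : ℝ) - 1) * x) := by
    have e1 : 1 / ε * (1 / 2 - Real.log |β| / (((m : ℝ) - 1) * x)) ≤ (T : ℝ) - 1 := by linarith
    rw [one_div_mul_eq_div, div_le_iff₀ hε, sub_le_iff_le_add, ← sub_le_iff_le_add',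
      le_div_iff₀ (by positivity)] at e1
    linarith
  -- The margin δ makes the required number of steps exceed 1 strictly.
  have hT2 : 2 ≤ T := by
    have e2 : 0 < ε * ((T : ℝ) - 1) * (((m : ℝ) - 1) * x) := by
      have := h.log_abs_le
      have := mul_pos hδ hx
      linarith
    have e3 : 0 < (T : ℝ) - 1 := by
      by_contra! hle
      have : ε * ((T : ℝ) - 1) * (((m : ℝ) - 1) * x) ≤ 0 :=
        mul_nonpos_of_nonpos_of_nonneg (mul_nonpos_of_nonneg_of_nonpos hε.le hle) (by positivity)
      linarith
    have : (1 : ℝ) < T := by linarith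
    exact_mod_cast this
  refine ⟨hT2, ?_⟩
  rw [h.sqrt_eq, one_div, ← Real.exp_neg]
  -- The hypothesis controls the power ⟨u,v⟩^(m-1) by n^(-ε)/|β|, so the comparison is made after
  -- raising to the power `m - 1`.
  refine le_of_pow_le_pow_left₀ (n := m - 1) (by omega) (Real.exp_pos _).le ?_
  have e4 : |inner ℝ u v| ^ (m - 1) ≤ Real.exp (-(ε * x)) * Real.exp (-Real.log |β|) := by
    have := h.init_le
    rw [abs_mul, abs_pow] at this
    rw [Real.exp_neg (Real.log |β|), Real.exp_log hb, ← div_eq_mul_inv, le_div_iff₀ hb]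
    linarith
  rw [mul_pow]
  calc _ ≤ (Real.exp (-(ε * x)) ^ (T - 1)) ^ (m - 1) *
        (Real.exp (-(ε * x)) * Real.exp (-Real.log |β|)) := by gcongr
    _ = Real.exp (((m : ℝ) - 1) * (((T : ℝ) - 1) * -(ε * x)) + (-(ε * x) + -Real.log |β|)) := by
      rw [← Real.exp_nat_mul, ← Real.exp_nat_mul, ← Real.exp_add, ← Real.exp_add]
      push_cast [Nat.cast_sub (show 1 ≤ m by omega), Nat.cast_sub (show 1 ≤ T by omega)]
      rfl
    _ ≤ Real.exp (((m : ℝ) - 1) * -(x / 2)) := by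
      gcongr
      have := mul_pos hε hx
      linarith
    _ = _ := by
      rw [← Real.exp_nat_mul]
      push_cast [Nat.cast_sub (show 1 ≤ m by omega)]
      rfl

end Conclusion

end SpikedTensor

end

theorem theorem2p2 :
    ∃ c : ℝ, 0 < c ∧
    ∀ k : ℕ, 3 ≤ k → ∀ ε δ : ℝ, 0 < ε → 0 < δ → ∀ T : ℕ,
    ∃ C : ℝ, 0 < C ∧
    ∀ n : ℕ, 2 ≤ n → ∀ (β : ℝ) (u v : SpikedTensor.Vec n), ‖u‖ = 1 → ‖v‖ = 1 →
      (n : ℝ) ^ ε ≤ |β| →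
      |β * (inner ℝ u v) ^ (k - 2)| ≤ (n : ℝ) ^ (-ε) →
      |β| ≤ (n : ℝ) ^ (((k : ℝ) - 2) / 2 - δ) →
    ∀ (Ω : Type*) [MeasurableSpace Ω] (P : MeasureTheory.Measure Ω)
      [MeasureTheory.IsProbabilityMeasure P] (Z : Ω → SpikedTensor.Tensor k n),
      SpikedTensor.IsGaussianNoise P Z →
      -- for fixed `n`, the iterates almost surely do not converge to `v` or to `-v`
      (∀ᵐ ω ∂P,
        ¬ Filter.Tendsto (SpikedTensor.powerIter (SpikedTensor.spiked β v (Z ω)) u)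
            Filter.atTop (nhds v) ∧
        ¬ Filter.Tendsto (SpikedTensor.powerIter (SpikedTensor.spiked β v (Z ω)) u)
            Filter.atTop (nhds (-v))) ∧
      -- quantitatively, the iterates up to time `T` stay far away from `v` and `-v`
      P {ω | ∃ t ≤ T,
          ‖SpikedTensor.powerIter (SpikedTensor.spiked β v (Z ω)) u t - v‖ < 1 ∨
          ‖SpikedTensor.powerIter (SpikedTensor.spiked β v (Z ω)) u t + v‖ < 1}
        ≤ ENNReal.ofReal (C * (n : ℝ) ^ (-(c * Real.log n ^ 2))) ∧
      -- after the stated number of steps, `u_T` is close to a normalized standard Gaussian vector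
      (1 + 1 / ε * (1 / 2 - Real.log |β| / (((k : ℝ) - 2) * Real.log n)) ≤ (T : ℝ) →
        ∃ ξ : Ω → SpikedTensor.Vec n,
          ProbabilityTheory.HasLaw ξ
            (ProbabilityTheory.stdGaussian (SpikedTensor.Vec n)) P ∧
          P {ω | |β| * (Real.log n / √(n : ℝ)) ^ (k - 1) <
              ‖SpikedTensor.powerIter (SpikedTensor.spiked β v (Z ω)) u T - ‖ξ ω‖⁻¹ • ξ ω‖}
            ≤ ENNReal.ofReal (C * (n : ℝ) ^ (-(c * Real.log n ^ 2)))) := by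
  -- The exponent 1/8 comes from the Gaussian tail at r/2 with r² = (log n)³.
  refine ⟨1 / 8, by norm_num, fun k hk ε δ hε hδ T => ?_⟩
  obtain ⟨m, rfl⟩ : ∃ m, k = m + 1 := ⟨k - 1, by omega⟩
  have hm : 2 ≤ m := by omega
  obtain ⟨C, hC1, hC⟩ := SpikedTensor.exists_iterate_bounds m hm T
  obtain ⟨x₀, hx₀⟩ :=
    Filter.eventually_atTop.1 (SpikedTensor.eventually_highDim m T hC1 hε hδ)
  -- The 4 counts the failure events of the coupling; the other term makes the probability bounds
  -- trivial when log n < x₀.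
  refine ⟨max 4 (Real.exp (x₀ ^ 3 / 8)), by positivity, ?_⟩
  intro n hn β u v hu hv h1 h2 h3 Ω _ P _ Z hZ
  have hn0 : 0 < n := by omega
  have hk2 : ((m + 1 : ℕ) : ℝ) - 2 = (m : ℝ) - 1 := by push_cast; ring
  rw [show m + 1 - 2 = m - 1 by omega] at h2
  rw [hk2] at h3 ⊢
  rw [SpikedTensor.rpow_neg_mul_log_sq hn0, show m + 1 - 1 = m by omega]
  have hw := SpikedTensor.weakSignal_log hm hε hn hu hv h1 h2 h3
  refine ⟨?_, ?_⟩
  · filter_upwards [SpikedTensor.ae_not_tendsto_powerIter hn hZ β u v (c := 1) (by simpa),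
      SpikedTensor.ae_not_tendsto_powerIter hn hZ β u v (c := -1) (by simpa)] with ω ha hb
    exact ⟨by simpa using ha, by simpa using hb⟩
  rcases le_or_gt x₀ (Real.log n) with hx | hx
  · have hd := hx₀ _ hx
    have h4 : 4 * Real.exp (-(Real.log n ^ 3 / 8)) ≤
        max 4 (Real.exp (x₀ ^ 3 / 8)) * Real.exp (-(Real.log n ^ 3 / 8)) := by
      gcongr
      exact le_max_left _ _
    refine ⟨(SpikedTensor.measure_powerIter_near_spike_le hC hd hw hZ).trans
      (ENNReal.ofReal_le_ofReal (le_trans ?_ h4)), fun hT => ?_⟩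
    · linarith [Real.exp_pos (-(Real.log n ^ 3 / 8))]
    · obtain ⟨hT2, hα⟩ := hw.time_bounds hδ hT
      obtain ⟨ξ, hξ, hP⟩ := SpikedTensor.exists_gaussian_near_powerIter hC hd hw hZ hT2 hα
      exact ⟨ξ, hξ, hP.trans (ENNReal.ofReal_le_ofReal h4)⟩
  · have h5 : (1 : ENNReal) ≤ ENNReal.ofReal
        (max 4 (Real.exp (x₀ ^ 3 / 8)) * Real.exp (-(Real.log n ^ 3 / 8))) := by
      rw [ENNReal.one_le_ofReal]
      have hlog := hw.log_pos
      calc (1 : ℝ) = Real.exp (Real.log n ^ 3 / 8) * Real.exp (-(Real.log n ^ 3 / 8)) := by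
            rw [← Real.exp_add, add_neg_cancel, Real.exp_zero]
        _ ≤ Real.exp (x₀ ^ 3 / 8) * Real.exp (-(Real.log n ^ 3 / 8)) := by gcongr
        _ ≤ _ := by
          gcongr
          exact le_max_right _ _
    -- In low dimension any standard Gaussian vector on the space will do, for instance the rescaled
    -- noise applied to `u`.
    exact ⟨MeasureTheory.prob_le_one.trans h5, fun _ =>
      ⟨_, SpikedTensor.hasLaw_sqrt_smul_act hn0 hZ hu, MeasureTheory.prob_le_one.trans h5⟩⟩
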